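/- A text is a string $T[1..n]$, $n\ge 1$, of natural numbers with $T[n]=\$=0$ and $T[k]\ge 1$ for $k<n$. Strings are compared lexicographically, and the rank of a string $P$ among the suffixes of $T$ is the number of nonempty suffixes of $T$ that are smaller than $P$. If $\mathrm{SA}[1..n]$ lists the starting positions of the suffixes of $T$ in increasing lexicographic order, the Burrows--Wheeler transform of $T$ is the string with $\mathrm{BWT}[i]=T[\mathrm{SA}[i]-1]$ if $\mathrm{SA}[i]>1$ and $\mathrm{BWT}[i]=T[n]$ otherwise. Its run-length encoding RLBWT is the list of pairs (starting position, symbol) of the maximal runs of equal symbols in $\mathrm{BWT}$. Model: a deterministic word RAM in which arithmetic, logic and comparison operations on $w$-bit words and accesses to memory cells take constant time; space is measured in words. Write $\lg x=\max\{1,\log_2 x\}$. Theorem. There are fixed programs for construction and for queries, and a constant $\kappa$, such that the following holds for all texts $S[1..m]$ and $S'[1..m']$ with $r$ and $r'$ runs in their BWTs, all integers $\tau\ge 1$, and all word lengths $w\ge\kappa\log_2(m+m'+\tau)$ for which every symbol of $S$ and $S'$ fits in one word. Given $\tau$, $m$, $m'$, $r$, $r'$ and the RLBWTs of $S$ and $S'$,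 the construction program builds a data structure of $$O\!\left(\frac m\tau+r+r'\right)$$ words in time $$O\!\left(\tau^2(r+r')\lg(r\tau+r'\tau)+\frac m\tau\Bigl(\lg(r\tau)+\lg(r'\tau)+\lg\frac m\tau\Bigr)\right)$$ and in $$O\!\left(\tau^2(r+r')+\frac m\tau\right)$$ words of space. From this data structure alone, which it leaves unchanged, the query program computes, given the rank of any suffix $S[j..m]$, $1\le j\le m$, among the suffixes of $S$ (but not $j$), the rank of $S[j..m]$ among the suffixes of $S'$ in time $$O\!\left(\tau\Bigl(\lg\frac m\tau+\lg r+\lg r'\Bigr)\right).$$ All constants hidden in the $O$-notation are absolute. -/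

import Mathlib

/-! ## Strings, suffix ranks, and the run-length encoded Burrows-Wheeler transform

A string is a list of natural numbers; `<` and `≤` on lists are the lexicographic order (a proper
prefix is smaller).  Positions are 0-based here: `S.drop j`, for `j < S.length`, is a nonempty
suffix of `S`. -/

/-- A text: a string whose last symbol is the sentinel `$ = 0` and whose other symbols are
positive. -/
def IsText (S : List ℕ) : Prop :=
  ∃ T : List ℕ, S = T ++ [0] ∧ ∀ c ∈ T, 0 < c

/-- The rank of `P` among the suffixes of `S`: the number of nonempty suffixes of `S` that are
lexicographically smaller than `P`. -/
def suffixRank (S P : List ℕ) : ℕ :=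
  ((Finset.range S.length).filter fun j => S.drop j < P).card

/-- The suffix array: the positions of `S` sorted by the lexicographic order of their suffixes. -/
def suffixArray (S : List ℕ) : List ℕ :=
  (List.range S.length).mergeSort fun i j => decide (S.drop i ≤ S.drop j)

/-- The Burrows-Wheeler transform: for each suffix in lexicographic order the symbol that precedes
it, cyclically. -/
def bwt (S : List ℕ) : List ℕ :=
  (suffixArray S).map fun j => S.getD (if j = 0 then S.length - 1 else j - 1) 0

/-- The (0-based) positions of `B` at which a maximal run of equal symbols starts. -/
def runStarts (B : List ℕ) : List ℕ :=
  (List.range B.length).filter fun i => decide (i = 0 ∨ B[i]? ≠ B[i - 1]?)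

/-- The run-length encoded BWT: the list of pairs `(λ, c)` of the 1-based starting position and the
symbol of each run of the BWT, from left to right. -/
def rlbwt (S : List ℕ) : List (ℕ × ℕ) :=
  (runStarts (bwt S)).map fun i => (i + 1, (bwt S).getD i 0)

/-- The number of runs in the BWT. -/
def numRuns (S : List ℕ) : ℕ := (rlbwt S).length

/-! ## The word RAM

Words have `w` bits.  There is a memory of `2 ^ w` words, addressed by words, and registers, of
which every program mentions only finitely many.  Programs are written in structured form and do
not depend on `w`. -/

namespace WordRAM

/-- The operations on words: arithmetic modulo `2 ^ w`, unsigned division with remainder, bitwise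
logic, shifts, and the unsigned comparisons, whose result is `1` or `0`. -/
inductive Op
  | add | sub | mul | div | mod | and | or | xor | shl | shr | lt | eq

/-- The value of an operation. -/
def Op.eval {w : ℕ} : Op → BitVec w → BitVec w → BitVec w
  | .add, a, b => a + b
  | .sub, a, b => a - b
  | .mul, a, b => a * b
  | .div, a, b => a / b
  | .mod, a, b => a % b
  | .and, a, b => a &&& b
  | .or, a, b => a ||| b
  | .xor, a, b => a ^^^ b
  | .shl, a, b => a <<< b
  | .shr, a, b => a >>> b
  | .lt, a, b => if a < b then 1 else 0
  | .eq, a, b => if a = b then 1 else 0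

/-- A machine state: the contents of the registers and of the memory. -/
structure State (w : ℕ) where
  reg : ℕ → BitVec w
  mem : BitVec w → BitVec w

/-- Expressions: constants, registers, memory cells with a computed address, operations. -/
inductive Expr
  | const (k : ℕ)
  | reg (x : ℕ)
  | load (addr : Expr)
  | op (o : Op) (e f : Expr)

namespace Expr

/-- The value of an expression. -/
def eval {w : ℕ} (s : State w) : Expr → BitVec w
  | const k => BitVec.ofNat w k
  | reg x => s.reg x
  | load a => s.mem (a.eval s)
  | op o e f => o.eval (e.eval s) (f.eval s)

/-- The time to evaluate an expression: one step for each constant, register access, memory access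
and operation. -/
def time : Expr → ℕ
  | const _ => 1
  | reg _ => 1
  | load a => a.time + 1
  | op _ e f => e.time + f.time + 1

/-- The least `N` such that evaluating the expression accesses only memory cells with addresses
smaller than `N`. -/
def space {w : ℕ} (s : State w) : Expr → ℕ
  | const _ => 0
  | reg _ => 0
  | load a => max (a.space s) ((a.eval s).toNat + 1)
  | op _ e f => max (e.space s) (f.space s)

end Expr

/-- Programs. A condition holds if its value is not zero. -/
inductive Prog
  | skip
  | assign (x : ℕ) (e : Expr)
  | store (addr e : Expr)
  | seq (p q : Prog)
  | ite (c : Expr) (p q : Prog)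
  | loop (c : Expr) (p : Prog)

/-- `Exec p s s' t N`: started in the state `s`, the program `p` halts in the state `s'` after
exactly `t` steps, and `N` is the least number such that the execution accesses only memory cells
with addresses smaller than `N`. -/
inductive Exec {w : ℕ} : Prog → State w → State w → ℕ → ℕ → Prop
  | skip (s : State w) : Exec .skip s s 1 0
  | assign (s : State w) (x : ℕ) (e : Expr) :
      Exec (.assign x e) s ⟨Function.update s.reg x (e.eval s), s.mem⟩ (e.time + 1) (e.space s)
  | store (s : State w) (a e : Expr) :
      Exec (.store a e) s ⟨s.reg, Function.update s.mem (a.eval s) (e.eval s)⟩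
        (a.time + e.time + 1) (max (max (a.space s) (e.space s)) ((a.eval s).toNat + 1))
  | seq {p q : Prog} {s s₁ s₂ : State w} {t₁ t₂ N₁ N₂ : ℕ} :
      Exec p s s₁ t₁ N₁ → Exec q s₁ s₂ t₂ N₂ →
      Exec (.seq p q) s s₂ (t₁ + t₂) (max N₁ N₂)
  | ite_true {c : Expr} {p q : Prog} {s s₁ : State w} {t N : ℕ} :
      c.eval s ≠ 0 → Exec p s s₁ t N →
      Exec (.ite c p q) s s₁ (c.time + 1 + t) (max (c.space s) N)
  | ite_false {c : Expr} {p q : Prog} {s s₁ : State w} {t N : ℕ} :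
      c.eval s = 0 → Exec q s s₁ t N →
      Exec (.ite c p q) s s₁ (c.time + 1 + t) (max (c.space s) N)
  | loop_true {c : Expr} {p : Prog} {s s₁ s₂ : State w} {t₁ t₂ N₁ N₂ : ℕ} :
      c.eval s ≠ 0 → Exec p s s₁ t₁ N₁ → Exec (.loop c p) s₁ s₂ t₂ N₂ →
      Exec (.loop c p) s s₂ (c.time + 1 + t₁ + t₂) (max (max (c.space s) N₁) N₂)
  | loop_false {c : Expr} {p : Prog} {s : State w} :
      c.eval s = 0 → Exec (.loop c p) s s (c.time + 1) (c.space s)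

/-- The memory cells with addresses `0, 1, …` contain the numbers of the list `l`. -/
def Holds {w : ℕ} (mem : BitVec w → BitVec w) (l : List ℕ) : Prop :=
  ∀ (k : ℕ) (h : k < l.length), mem (BitVec.ofNat w k) = BitVec.ofNat w l[k]

end WordRAM

/-! ## Suffix-rank support -/

/-- `IsInput S S' τ s`: in the state `s` the registers `0, …, 4` contain `τ`, the lengths of `S` and
`S'`, and the numbers of runs of `S` and `S'`, and the memory contains, from address `0` on, the
run-length encoded BWT of `S` followed by that of `S'`, two words for each run.  The other registers
and memory cells are arbitrary. -/
def IsInput {w : ℕ} (S S' : List ℕ) (τ : ℕ) (s : WordRAM.State w) : Prop :=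
  s.reg 0 = BitVec.ofNat w τ ∧
  s.reg 1 = BitVec.ofNat w S.length ∧
  s.reg 2 = BitVec.ofNat w S'.length ∧
  s.reg 3 = BitVec.ofNat w (numRuns S) ∧
  s.reg 4 = BitVec.ofNat w (numRuns S') ∧
  WordRAM.Holds s.mem ((rlbwt S ++ rlbwt S').flatMap fun p => [p.1, p.2])

/-- `AnswersQueries query S S' D L T`: the first `L` words of the memory contents `D` are a data
structure from which `query` computes, in at most `T` steps, the rank among the suffixes of `S'` of
any suffix of `S` whose rank among the suffixes of `S` is given in register `0`; the answer is
delivered in register `0`.  A query accesses none of the memory outside the data structure, and it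
leaves the data structure as it was. -/
def AnswersQueries {w : ℕ} (query : WordRAM.Prog) (S S' : List ℕ) (D : BitVec w → BitVec w)
    (L : ℕ) (T : ℝ) : Prop :=
  ∀ j < S.length, ∀ s : WordRAM.State w,
    (∀ a : BitVec w, a.toNat < L → s.mem a = D a) →
    s.reg 0 = BitVec.ofNat w (suffixRank S (S.drop j)) →
    ∃ (s' : WordRAM.State w) (t N : ℕ),
      WordRAM.Exec query s s' t N ∧ (t : ℝ) ≤ T ∧ N ≤ L ∧
      s'.reg 0 = BitVec.ofNat w (suffixRank S' (S.drop j)) ∧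
      ∀ a : BitVec w, a.toNat < L → s'.mem a = D a

/-- The binary logarithm as it is used in `O`-bounds: it is never smaller than `1`. -/
noncomputable def lg (x : ℝ) : ℝ := max 1 (Real.logb 2 x)

/-! ## Reasoning about word-RAM programs with natural numbers

Program states are abstracted to states over `ℕ` that carry a clock.  As long as no operation
overflows, the operations of the machine agree with those on natural numbers. -/

/-! Let `B`, `B'` be the transforms of `S`, `S'`, of lengths m, m', with r, r' runs. Prepending a
positive symbol c to a string of rank i gives a string of rank `rankMap B c i`, the number of
positions p with (B[p], p) < (c, i) (`suffixRank_cons`). With c = B[i] this is the LF-mapping, which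
leads from the rank of a suffix to that of the suffix starting one position earlier; its inverse
`psi` moves to the right. LF is a translation on every run of `B`, and `psi` is one on the image of
every run, so each of LF, `psi` and `rankMap` is evaluated by binary searches in tables with one
entry per run (`SortedRuns.pieces`, `Pieces.locate`, `Pieces.rank_eq`).

The data structure consists of these tables for both strings and of samples: for the positions at
distance 0, τ, 2τ, … from the last one, the pair (rank in `S`, rank in `S'`), sorted by the first
component. A query applies `psi` until the current rank is a sampled one, which takes fewer than τ
steps, reads off the rank in `S'`, and retraces its steps: LF on `S` supplies the symbols, and
`rankMap` on `S'` prepends them.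

The construction must not spend m steps on finding the samples, so it takes τ steps at once with
constantly many binary searches. In `S`: LF iterated τ times is still a piecewise translation. It
can break only at points `psi^[t] x` with t < τ and x the start of a run, so there are at most rτ
pieces, and on each of them the τ symbols that are read are the same (`SortedPoints.translate`,
`context_translate`). In `S'`: a block X of τ symbols has to be prepended at once, which is the map
`rankList B' X`. The ranks with a given label of length τ (their first τ symbols) form an interval,
and these intervals are disjoint. The sum of the end points of the interval, the `name`, therefore
orders the labels, and it also places an X that does not occur, because its empty interval never
lies strictly inside another one. Hence q < `rankList B' X i` holds exactly if (name of the label of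
q, `psi^[τ] q`) < (name of X, i); this is `lt_rankList_iff`, the heart of the proof. On at most r'τ
pieces the name is constant and `psi^[τ]` a translation (`SortedRuns.iterated_pieces`), so the
search that serves single symbols also serves blocks. The tables cost τ machine-level steps, each
with a few binary searches, for each of the (r + r')τ break points, which gives the term with τ²;
the samples then cost O(m/τ) block steps and one sort.

Programs are verified over ℕ, with a clock. No operation overflows, because addresses, ranks and
names are small compared with `2 ^ w`; symbols of the texts are only copied and compared, so they
may fill a whole word. -/

namespace WordRAM

/-- A machine state over the natural numbers, with a clock. -/
structure NatState where
  reg : ℕ → ℕ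
  mem : ℕ → ℕ
  clk : ℕ

/-- Parameters of a computation: the word length, a bound on the addresses, and a bound on the
results of arithmetic operations. -/
structure Env where
  w : ℕ
  N : ℕ
  M : ℕ

/-- The bounds of `E` are compatible with the word length. -/
structure Env.Valid (E : Env) : Prop where
  addr : E.N ≤ 2 ^ E.w
  value : E.M ≤ 2 ^ E.w
  bool : 2 ≤ E.M

/-- The state `σ` of the machine represents the state `s`. -/
def Rel {w : ℕ} (σ : State w) (s : NatState) : Prop :=
  (∀ x, (σ.reg x).toNat = s.reg x) ∧ ∀ a < 2 ^ w, (σ.mem (BitVec.ofNat w a)).toNat = s.mem a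

/-- The operations on natural numbers. -/
def Op.natEval : Op → ℕ → ℕ → ℕ
  | .add, a, b => a + b
  | .sub, a, b => a - b
  | .mul, a, b => a * b
  | .div, a, b => a / b
  | .mod, a, b => a % b
  | .and, a, b => a &&& b
  | .or, a, b => a ||| b
  | .xor, a, b => a ^^^ b
  | .shl, a, _ => a
  | .shr, a, _ => a
  | .lt, a, b => if a < b then 1 else 0
  | .eq, a, b => if a = b then 1 else 0

/-- A sufficient condition for the machine operation to agree with that on natural numbers. -/
def Op.Safe (M : ℕ) : Op → ℕ → ℕ → Prop
  | .add, a, b => a + b < M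
  | .sub, a, b => b ≤ a
  | .mul, a, b => a * b < M
  | .shl, _, _ => False
  | .shr, _, _ => False
  -- Division by zero yields 0 for words and for natural numbers alike, and the other operations
  -- here cannot overflow.
  | _, _, _ => True

namespace Expr

/-- The value of an expression over the natural numbers. -/
def natEval (s : NatState) : Expr → ℕ
  | const k => k
  | reg x => s.reg x
  | load a => s.mem (a.natEval s)
  | op o e f => o.natEval (e.natEval s) (f.natEval s)

/-- No overflow occurs in the evaluation of the expression, and all addresses are admissible. -/
def Safe (E : Env) (s : NatState) : Expr → Prop
  | const k => k < E.M
  | reg _ => True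
  | load a => a.Safe E s ∧ a.natEval s < E.N
  | op o e f => e.Safe E s ∧ f.Safe E s ∧ o.Safe E.M (e.natEval s) (f.natEval s)

instance : Add Expr := ⟨op .add⟩
instance : Sub Expr := ⟨op .sub⟩
instance : Mul Expr := ⟨op .mul⟩
instance : Div Expr := ⟨op .div⟩
instance (k : ℕ) : OfNat Expr k := ⟨const k⟩

/-- Comparison. -/
def lt (e f : Expr) : Expr := op .lt e f

/-- Test for equality. -/
def eq (e f : Expr) : Expr := op .eq e f

/-- Lexicographic comparison of two pairs. -/
def lex (a b x y : Expr) : Expr := op .or (lt a x) (op .and (eq a x) (lt b y))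

end Expr

open Classical in
/-- The truth value of a proposition as a number. -/
noncomputable def truth (p : Prop) : ℕ := if p then 1 else 0

@[simp] theorem truth_eq_zero {p : Prop} : truth p = 0 ↔ ¬ p := by simp [truth]

theorem ite_eq_truth {p : Prop} [Decidable p] : (if p then 1 else 0) = truth p := by
  unfold truth; split_ifs <;> rfl

/-- The strict lexicographic order on pairs of natural numbers. -/
def PLt (a b : ℕ × ℕ) : Prop := a.1 < b.1 ∨ a.1 = b.1 ∧ a.2 < b.2

instance (a b : ℕ × ℕ) : Decidable (PLt a b) := by unfold PLt; infer_instance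

namespace Expr

variable (E : Env) (s : NatState) (a b x y : Expr) (k : ℕ)

@[simp] theorem natEval_add : (a + b).natEval s = a.natEval s + b.natEval s := rfl
@[simp] theorem natEval_sub : (a - b).natEval s = a.natEval s - b.natEval s := rfl
@[simp] theorem natEval_mul : (a * b).natEval s = a.natEval s * b.natEval s := rfl
@[simp] theorem natEval_div : (a / b).natEval s = a.natEval s / b.natEval s := rfl
@[simp] theorem natEval_ofNat : (no_index (OfNat.ofNat k : Expr)).natEval s = k := rfl
@[simp] theorem natEval_reg : (reg k).natEval s = s.reg k := rfl
@[simp] theorem natEval_load : (load a).natEval s = s.mem (a.natEval s) := rfl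
@[simp] theorem natEval_lt : (lt a b).natEval s = truth (a.natEval s < b.natEval s) :=
  ite_eq_truth
@[simp] theorem natEval_eq : (eq a b).natEval s = truth (a.natEval s = b.natEval s) :=
  ite_eq_truth
@[simp] theorem natEval_lex : (lex a b x y).natEval s =
    truth (PLt (a.natEval s, b.natEval s) (x.natEval s, y.natEval s)) := by
  rw [← ite_eq_truth]
  simp only [lex, lt, eq, natEval, Op.natEval, PLt]
  split_ifs <;> simp_all <;> omega

@[simp] theorem safe_add : (a + b).Safe E s ↔
    a.Safe E s ∧ b.Safe E s ∧ a.natEval s + b.natEval s < E.M := Iff.rfl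
@[simp] theorem safe_sub : (a - b).Safe E s ↔
    a.Safe E s ∧ b.Safe E s ∧ b.natEval s ≤ a.natEval s := Iff.rfl
@[simp] theorem safe_mul : (a * b).Safe E s ↔
    a.Safe E s ∧ b.Safe E s ∧ a.natEval s * b.natEval s < E.M := Iff.rfl
@[simp] theorem safe_div : (a / b).Safe E s ↔ a.Safe E s ∧ b.Safe E s := by
  show _ ∧ _ ∧ True ↔ _
  simp
@[simp] theorem safe_ofNat : (no_index (OfNat.ofNat k : Expr)).Safe E s ↔ k < E.M := Iff.rfl
@[simp] theorem safe_reg : (reg k).Safe E s ↔ True := Iff.rfl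
@[simp] theorem safe_load : (load a).Safe E s ↔ a.Safe E s ∧ a.natEval s < E.N := Iff.rfl
@[simp] theorem safe_lt : (lt a b).Safe E s ↔ a.Safe E s ∧ b.Safe E s := by
  show _ ∧ _ ∧ True ↔ _
  simp
@[simp] theorem safe_eq : (eq a b).Safe E s ↔ a.Safe E s ∧ b.Safe E s := by
  show _ ∧ _ ∧ True ↔ _
  simp
@[simp] theorem safe_lex : (lex a b x y).Safe E s ↔
    a.Safe E s ∧ b.Safe E s ∧ x.Safe E s ∧ y.Safe E s := by
  simp only [lex, Safe, safe_lt, safe_eq, Op.Safe]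
  tauto

@[simp] theorem time_add : (a + b).time = a.time + b.time + 1 := rfl
@[simp] theorem time_sub : (a - b).time = a.time + b.time + 1 := rfl
@[simp] theorem time_mul : (a * b).time = a.time + b.time + 1 := rfl
@[simp] theorem time_div : (a / b).time = a.time + b.time + 1 := rfl
@[simp] theorem time_ofNat : (no_index (OfNat.ofNat k : Expr)).time = 1 := rfl
@[simp] theorem time_reg : (reg k).time = 1 := rfl
@[simp] theorem time_load : (load a).time = a.time + 1 := rfl
@[simp] theorem time_lt : (lt a b).time = a.time + b.time + 1 := rfl
@[simp] theorem time_eq : (eq a b).time = a.time + b.time + 1 := rfl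
@[simp] theorem time_lex : (lex a b x y).time =
    2 * a.time + b.time + 2 * x.time + y.time + 5 := by
  simp only [lex, lt, eq, time]; ring

-- The bridge between machine and numbers: as every intermediate result is below `E.M`, no reduction
-- modulo `2 ^ E.w` takes place. `E.Valid.bool` is needed so that the word 1 differs from 0.
variable {E s} in
theorem eval_eq_natEval {σ : State E.w} (h : Rel σ s) (hE : E.Valid) (e : Expr)
    (he : e.Safe E s) : (e.eval σ).toNat = e.natEval s ∧ e.space σ ≤ E.N := by
  have hM := hE.value
  have one : (1 : BitVec E.w).toNat = 1 := by
    simpa [Nat.pos_iff_ne_zero] using Nat.one_lt_two_pow_iff.1 (hE.bool.trans hM)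
  induction e with
  | const k =>
    have : k < E.M := he
    simp [eval, natEval, space, Nat.mod_eq_of_lt (this.trans_le hM)]
  | reg x => simp [eval, natEval, space, h.1]
  | load a ih =>
    obtain ⟨h1, h2⟩ := ih he.1
    have h3 : a.natEval s < E.N := he.2
    refine ⟨?_, ?_⟩
    · simp only [eval, natEval]
      rw [← h.2 _ (h3.trans_le hE.addr), ← h1]
      simp
    · simp only [space, h1]; omega
  | op o e f ihe ihf =>
    obtain ⟨he1, he2, he3⟩ := he
    obtain ⟨h1, h2⟩ := ihe he1
    obtain ⟨h3, h4⟩ := ihf he2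
    refine ⟨?_, by simp [space, h2, h4]⟩
    simp only [eval, natEval]
    rw [← h1, ← h3] at he3 ⊢
    generalize e.eval σ = u at *
    generalize f.eval σ = v at *
    cases o <;> simp only [Op.Safe] at he3 <;> simp only [Op.eval, Op.natEval]
    · rw [BitVec.toNat_add, Nat.mod_eq_of_lt (he3.trans_le hM)]
    · rw [BitVec.toNat_sub_of_le (by simpa [BitVec.le_def] using he3)]
    · rw [BitVec.toNat_mul, Nat.mod_eq_of_lt (he3.trans_le hM)]
    · exact BitVec.toNat_udiv
    · exact BitVec.toNat_umod
    · exact BitVec.toNat_and ..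
    · exact BitVec.toNat_or ..
    · exact BitVec.toNat_xor ..
    · simp only [BitVec.lt_def]
      split_ifs
      · exact one
      · simp
    · simp only [← BitVec.toNat_inj]
      split_ifs
      · exact one
      · simp

end Expr

/-- `Runs E p s Q`: started in a state that represents `s`, the program `p` halts in a state that
represents some `s'` with `Q s'`; the clock counts the steps, and only addresses below `E.N` are
accessed. -/
def Runs (E : Env) (p : Prog) (s : NatState) (Q : NatState → Prop) : Prop :=
  E.Valid → ∀ σ : State E.w, Rel σ s → ∃ (σ' : State E.w) (t n : ℕ) (s' : NatState),
    Exec p σ σ' t n ∧ n ≤ E.N ∧ s'.clk = s.clk + t ∧ Rel σ' s' ∧ Q s'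

/-- The state after `t` steps that change neither registers nor memory. -/
def NatState.tick (s : NatState) (t : ℕ) : NatState := ⟨s.reg, s.mem, s.clk + t⟩

@[simp] theorem NatState.tick_reg (s : NatState) (t : ℕ) : (s.tick t).reg = s.reg := rfl
@[simp] theorem NatState.tick_mem (s : NatState) (t : ℕ) : (s.tick t).mem = s.mem := rfl
@[simp] theorem NatState.tick_clk (s : NatState) (t : ℕ) : (s.tick t).clk = s.clk + t := rfl

/-- The weakest precondition of a program without loops. -/
def wp (E : Env) : Prog → (NatState → Prop) → NatState → Prop
  | .skip, Q, s => Q (s.tick 1)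
  | .assign x e, Q, s =>
      e.Safe E s ∧ Q ⟨Function.update s.reg x (e.natEval s), s.mem, s.clk + (e.time + 1)⟩
  | .store a e, Q, s => a.Safe E s ∧ e.Safe E s ∧ a.natEval s < E.N ∧
      Q ⟨s.reg, Function.update s.mem (a.natEval s) (e.natEval s), s.clk + (a.time + e.time + 1)⟩
  | .seq p q, Q, s => wp E p (wp E q Q) s
  | .ite c p q, Q, s => c.Safe E s ∧ (c.natEval s ≠ 0 → wp E p Q (s.tick (c.time + 1))) ∧
      (c.natEval s = 0 → wp E q Q (s.tick (c.time + 1)))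
  -- Loops are excluded here and treated by `Runs.loop` or `Runs.loop_of_invariant`; `wp` only has
  -- to unfold straight-line code with branches.
  | .loop _ _, _, _ => False

namespace Runs

variable {E : Env} {p q : Prog} {c : Expr} {s : NatState} {Q Q' : NatState → Prop}

theorem mono (h : Runs E p s Q) (hQ : ∀ s', Q s' → Q' s') : Runs E p s Q' := fun hE σ hσ => by
  obtain ⟨σ', t, n, s', h1, h2, h3, h4, h5⟩ := h hE σ hσ
  exact ⟨σ', t, n, s', h1, h2, h3, h4, hQ _ h5⟩

theorem seq (h : Runs E p s fun s' => Runs E q s' Q) : Runs E (.seq p q) s Q := fun hE σ hσ => by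
  obtain ⟨σ', t, n, s', h1, h2, h3, h4, h5⟩ := h hE σ hσ
  obtain ⟨σ'', t', n', s'', k1, k2, k3, k4, k5⟩ := h5 hE σ' h4
  exact ⟨σ'', _, _, s'', .seq h1 k1, max_le h2 k2, by omega, k4, k5⟩

theorem skip (h : Q (s.tick 1)) : Runs E .skip s Q := fun _ σ hσ =>
  ⟨σ, 1, 0, s.tick 1, .skip σ, Nat.zero_le _, rfl, hσ, h⟩

theorem assign {x : ℕ} {e : Expr} (he : e.Safe E s)
    (h : Q ⟨Function.update s.reg x (e.natEval s), s.mem, s.clk + (e.time + 1)⟩) :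
    Runs E (.assign x e) s Q := fun hE σ hσ => by
  obtain ⟨h1, h2⟩ := e.eval_eq_natEval hσ hE he
  refine ⟨_, _, _, ⟨_, _, s.clk + (e.time + 1)⟩, .assign σ x e, h2, rfl, ⟨fun y => ?_, hσ.2⟩, h⟩
  by_cases hy : y = x
  · subst hy; simpa using h1
  · simpa [Function.update_of_ne hy] using hσ.1 y

theorem store {a e : Expr} (ha : a.Safe E s) (he : e.Safe E s) (haN : a.natEval s < E.N)
    (h : Q ⟨s.reg, Function.update s.mem (a.natEval s) (e.natEval s),
      s.clk + (a.time + e.time + 1)⟩) :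
    Runs E (.store a e) s Q := fun hE σ hσ => by
  obtain ⟨h1, h2⟩ := e.eval_eq_natEval hσ hE he
  obtain ⟨h3, h4⟩ := a.eval_eq_natEval hσ hE ha
  refine ⟨_, _, _, ⟨_, _, s.clk + (a.time + e.time + 1)⟩, .store σ a e, ?_, rfl, ⟨hσ.1, fun y hy => ?_⟩, h⟩
  · rw [h3]; exact max_le (max_le h4 h2) haN
  -- Addresses below `2 ^ E.w` are represented injectively, so the cell updated in the machine is
  -- the one updated over ℕ.
  · have key : BitVec.ofNat E.w y = a.eval σ ↔ y = a.natEval s := by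
      rw [← BitVec.toNat_inj, h3, BitVec.toNat_ofNat, Nat.mod_eq_of_lt hy]
    by_cases hya : y = a.natEval s
    · have := key.2 hya
      rw [this, hya]
      simpa using h1
    · have := mt key.1 hya
      simp only [Function.update_of_ne hya, Function.update_of_ne this]
      exact hσ.2 y hy

theorem ite (hc : c.Safe E s) (h1 : c.natEval s ≠ 0 → Runs E p (s.tick (c.time + 1)) Q)
    (h2 : c.natEval s = 0 → Runs E q (s.tick (c.time + 1)) Q) :
    Runs E (.ite c p q) s Q := fun hE σ hσ => by
  obtain ⟨k1, k2⟩ := c.eval_eq_natEval hσ hE hc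
  by_cases h : c.natEval s = 0
  · obtain ⟨σ', t, n, s', r1, r2, r3, r4, r5⟩ := h2 h hE σ hσ
    refine ⟨σ', _, _, s', .ite_false ?_ r1, max_le k2 r2, by rw [r3, s.tick_clk]; omega, r4, r5⟩
    rw [← BitVec.toNat_inj, k1, h]; simp
  · obtain ⟨σ', t, n, s', r1, r2, r3, r4, r5⟩ := h1 h hE σ hσ
    refine ⟨σ', _, _, s', .ite_true ?_ r1, max_le k2 r2, by rw [r3, s.tick_clk]; omega, r4, r5⟩
    rw [Ne, ← BitVec.toNat_inj, k1]; simpa using h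

/-- Unfolding a loop once. -/
theorem loop (hc : c.Safe E s)
    (h1 : c.natEval s ≠ 0 → Runs E p (s.tick (c.time + 1)) fun s' => Runs E (.loop c p) s' Q)
    (h2 : c.natEval s = 0 → Q (s.tick (c.time + 1))) :
    Runs E (.loop c p) s Q := fun hE σ hσ => by
  obtain ⟨k1, k2⟩ := c.eval_eq_natEval hσ hE hc
  by_cases h : c.natEval s = 0
  · refine ⟨σ, _, _, s.tick (c.time + 1), .loop_false ?_, k2, rfl, hσ, h2 h⟩
    rw [← BitVec.toNat_inj, k1, h]; simp
  · obtain ⟨σ', t, n, s', r1, r2, r3, r4, r5⟩ := h1 h hE σ hσ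
    obtain ⟨σ'', t', n', s'', u1, u2, u3, u4, u5⟩ := r5 hE σ' r4
    refine ⟨σ'', _, _, s'', .loop_true ?_ r1 u1, max_le (max_le k2 r2) u2, ?_, u4, u5⟩
    · rw [Ne, ← BitVec.toNat_inj, k1]; simpa using h
    · rw [u3, r3, s.tick_clk]; omega

/-- A loop with an invariant that is indexed by the number of remaining iterations. -/
theorem loop_of_invariant (I : ℕ → NatState → Prop)
    (hs : ∀ k s, I (k + 1) s → c.Safe E s ∧ c.natEval s ≠ 0 ∧
      Runs E p (s.tick (c.time + 1)) (I k))
    (h0 : ∀ s, I 0 s → c.Safe E s ∧ c.natEval s = 0 ∧ Q (s.tick (c.time + 1)))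
    (k : ℕ) (hk : I k s) : Runs E (.loop c p) s Q := by
  induction k generalizing s with
  | zero =>
    obtain ⟨h1, h2, h3⟩ := h0 s hk
    exact loop h1 (fun h => absurd h2 h) fun _ => h3
  | succ k ih =>
    obtain ⟨h1, h2, h3⟩ := hs k s hk
    exact loop h1 (fun _ => h3.mono fun s' hs' => ih hs') fun h => absurd h h2

theorem of_wp (h : wp E p Q s) : Runs E p s Q := by
  induction p generalizing s Q with
  | skip => exact skip h
  | assign x e => exact assign h.1 h.2
  | store a e => exact store h.1 h.2.1 h.2.2.1 h.2.2.2
  | seq p q ihp ihq => exact seq ((ihp h).mono fun s' hs' => ihq hs')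
  | ite c p q ihp ihq => exact ite h.1 (fun hc => ihp (h.2.1 hc)) fun hc => ihq (h.2.2 hc)
  | loop c p => exact h.elim

/-- A block of instructions without loops followed by another program. -/
theorem block (h : wp E p (fun s' => Runs E q s' Q) s) : Runs E (.seq p q) s Q :=
  seq (of_wp h)

end Runs

infixr:35 ";;" => Prog.seq

end WordRAM

/-! ## Tables of pairs and binary search -/

namespace WordRAM

open WordRAM.Expr WordRAM.Prog

/-- The memory contains the pairs `g 0, …, g (n - 1)` from address `base` on. -/
def Table (mem : ℕ → ℕ) (base n : ℕ) (g : ℕ → ℕ × ℕ) : Prop :=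
  ∀ k < n, mem (base + 2 * k) = (g k).1 ∧ mem (base + 2 * k + 1) = (g k).2

theorem Table.congr {mem mem' : ℕ → ℕ} {base n : ℕ} {g : ℕ → ℕ × ℕ} (h : Table mem base n g)
    (hm : ∀ a, base ≤ a → a < base + 2 * n → mem' a = mem a) : Table mem' base n g := fun k hk => by
  rw [hm _ (by omega) (by omega), hm _ (by omega) (by omega)]
  exact h k hk

/-- Binary search: register `80` holds the base address of a sorted table, register `81` its
length; register `84` receives the number of entries smaller than the pair in the registers
`82`, `83`. -/
def search : Prog :=
  (assign 84 0 ;; assign 85 (reg 81)) ;;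
  loop (lt (reg 84) (reg 85))
    (assign 86 ((reg 84 + reg 85) / 2) ;;
     ite (lex (load (reg 80 + 2 * reg 86)) (load (reg 80 + 2 * reg 86 + 1)) (reg 82) (reg 83))
       (assign 84 (reg 86 + 1)) (assign 85 (reg 86)))

/-- Bisection: all entries before register `84` are smaller than the wanted pair, none from register
`85` on is, and the window is shorter than `2 ^ b`, so `b` rounds suffice. Instead of sortedness,
`hg` only asks that the entries below the wanted pair form an initial segment; repeated entries are
thus allowed, and components that cannot affect the comparison may be arbitrary. -/
theorem runs_search_loop {E : Env} {Q : NatState → Prop} {n : ℕ} {g : ℕ → ℕ × ℕ} {s₀ : NatState}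
    (ht : Table s₀.mem (s₀.reg 80) n g)
    (hg : ∀ j k, j < k → k < n → PLt (g k) (s₀.reg 82, s₀.reg 83) →
      PLt (g j) (s₀.reg 82, s₀.reg 83))
    (hN : s₀.reg 80 + 2 * n ≤ E.N) (hM : E.N + 2 * n + 3 ≤ E.M) {C : ℕ}
    (hQ : ∀ s', s'.mem = s₀.mem → (∀ x < 84, s'.reg x = s₀.reg x) → s'.reg 84 ≤ n →
      (∀ k < n, k < s'.reg 84 ↔ PLt (g k) (s₀.reg 82, s₀.reg 83)) → s'.clk ≤ C → Q s') (b : ℕ) :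
    ∀ s : NatState, s.mem = s₀.mem → (∀ x < 84, s.reg x = s₀.reg x) → s.reg 84 ≤ s.reg 85 →
      s.reg 85 ≤ n → (∀ k < s.reg 84, PLt (g k) (s₀.reg 82, s₀.reg 83)) →
      (∀ k < n, s.reg 85 ≤ k → ¬ PLt (g k) (s₀.reg 82, s₀.reg 83)) →
      s.reg 85 - s.reg 84 < 2 ^ b → s.clk + (50 * b + 10) ≤ C →
      Runs E (loop (lt (reg 84) (reg 85))
        (assign 86 ((reg 84 + reg 85) / 2) ;;
          ite (lex (load (reg 80 + 2 * reg 86)) (load (reg 80 + 2 * reg 86 + 1)) (reg 82) (reg 83))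
          (assign 84 (reg 86 + 1)) (assign 85 (reg 86)))) s Q := by
  induction b with
  | zero =>
    intro s hm hf h1 h2 h3 h4 h5 h6
    refine Runs.loop (by simp) (fun h => ?_) fun _ => ?_
    · simp at h h5; omega
    · have h7 : s.reg 84 = s.reg 85 := by simp at h5; omega
      refine hQ _ hm hf (h1.trans h2) (fun k hk => ⟨h3 k, fun h => ?_⟩) (by simp; omega)
      by_contra h8
      exact h4 k hk (by simp at h8; omega) h
  | succ b ih =>
    intro s hm hf h1 h2 h3 h4 h5 h6
    refine Runs.loop (by simp) (fun h => Runs.of_wp ?_) fun h => ?_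
    · have h7 : s.reg 84 < s.reg 85 := by simpa using h
      have hmid := ht ((s.reg 84 + s.reg 85) / 2) (by omega)
      rw [pow_succ] at h5
      simp [wp, hf, hm, hmid]
      split_ands <;> try omega
      · intro hlt
        split_ands <;> try omega
        refine ih _ rfl (fun x hx => ?_) ?_ ?_ (fun k hk => ?_) (fun k hk => ?_) ?_ ?_ <;> simp at *
        · simp [Function.update_of_ne, show x ≠ 84 by omega, show x ≠ 86 by omega, hf x hx]
        · omega
        · exact h2
        · rcases Nat.lt_or_eq_of_le hk with h | h
          · exact hg _ _ h (by omega) hlt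
          · rw [h]; exact hlt
        · exact h4 k hk
        · omega
        · omega
      · intro hlt
        refine ih _ rfl (fun x hx => ?_) ?_ ?_ (fun k hk => ?_) (fun k hk => ?_) ?_ ?_ <;> simp at *
        · simp [Function.update_of_ne, show x ≠ 85 by omega, show x ≠ 86 by omega, hf x hx]
        · omega
        · omega
        · exact h3 k hk
        · intro h hc
          rcases Nat.eq_or_lt_of_le h with h | h
          · exact hlt (h ▸ hc)
          · exact hlt (hg _ _ h hk hc)
        · omega
        · omega
    · have h7 : s.reg 84 = s.reg 85 := by simp at h; omega
      refine hQ _ hm hf (h1.trans h2) (fun k hk => ⟨h3 k, fun h => ?_⟩) (by simp; omega)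
      by_contra h8
      exact h4 k hk (by simp at h8; omega) h

/-- A bound on the time of a binary search. -/
def searchCost (n : ℕ) : ℕ := 50 * (Nat.log 2 n + 2)

theorem runs_search {E : Env} {s : NatState} {Q : NatState → Prop} {n : ℕ} {g : ℕ → ℕ × ℕ}
    (ht : Table s.mem (s.reg 80) n g) (hn : s.reg 81 = n)
    (hg : ∀ j k, j < k → k < n → PLt (g k) (s.reg 82, s.reg 83) → PLt (g j) (s.reg 82, s.reg 83))
    (hN : s.reg 80 + 2 * n ≤ E.N) (hM : E.N + 2 * n + 3 ≤ E.M)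
    (hQ : ∀ s', s'.mem = s.mem → (∀ x < 84, s'.reg x = s.reg x) → s'.reg 84 ≤ n →
      (∀ k < n, k < s'.reg 84 ↔ PLt (g k) (s.reg 82, s.reg 83)) →
      s'.clk ≤ s.clk + searchCost n → Q s') :
    Runs E search s Q := by
  refine Runs.block ?_
  simp [wp]
  refine ⟨by omega, runs_search_loop ht hg hN hM hQ (Nat.log 2 n + 1) _ rfl (fun x hx => ?_)
    ?_ ?_ (fun k hk => ?_) (fun k hk h => ?_) ?_ ?_⟩
  · simp [Function.update_of_ne, show x ≠ 84 by omega, show x ≠ 85 by omega]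
  · simp
  · simp [hn]
  · simp at hk
  · simp at h; omega
  · simpa [hn] using Nat.lt_pow_succ_log_self Nat.one_lt_two n
  · simp [searchCost]; omega

end WordRAM

/-! ## Merge sort of tables -/

namespace WordRAM

open WordRAM.Expr WordRAM.Prog

/-- The memory contains the pairs of the list from address `base` on. -/
def Seg (mem : ℕ → ℕ) : ℕ → List (ℕ × ℕ) → Prop
  | _, [] => True
  | base, p :: l => mem base = p.1 ∧ mem (base + 1) = p.2 ∧ Seg mem (base + 2) l

theorem Seg.congr {mem mem' : ℕ → ℕ} {l : List (ℕ × ℕ)} {base : ℕ} (h : Seg mem base l)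
    (hm : ∀ a, base ≤ a → a < base + 2 * l.length → mem' a = mem a) : Seg mem' base l := by
  induction l generalizing base with
  | nil => trivial
  | cons p l ih =>
    simp only [List.length_cons] at hm
    exact ⟨(hm _ (by omega) (by omega)).trans h.1, (hm _ (by omega) (by omega)).trans h.2.1,
      ih h.2.2 fun a h1 h2 => hm a (by omega) (by omega)⟩

theorem seg_append {mem : ℕ → ℕ} {l l' : List (ℕ × ℕ)} {base : ℕ} :
    Seg mem base (l ++ l') ↔ Seg mem base l ∧ Seg mem (base + 2 * l.length) l' := by
  induction l generalizing base with
  | nil => simp [Seg]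
  | cons p l ih =>
    simp only [List.cons_append, Seg, ih, List.length_cons, and_assoc]
    rw [show base + 2 + 2 * l.length = base + 2 * (l.length + 1) by ring]

theorem seg_iff_table {mem : ℕ → ℕ} {l : List (ℕ × ℕ)} {base : ℕ} :
    Seg mem base l ↔ Table mem base l.length fun k => l.getD k (0, 0) := by
  induction l generalizing base with
  | nil => simp [Seg, Table]
  | cons p l ih =>
    rw [Seg, ih]
    refine ⟨fun ⟨h1, h2, h3⟩ k hk => ?_, fun h => ⟨?_, ?_, fun k hk => ?_⟩⟩
    · cases k with
      | zero => simpa using ⟨h1, h2⟩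
      | succ k =>
        have := h3 k (by simpa using hk)
        simpa [mul_add, add_assoc, add_comm 2] using this
    · simpa using (h 0 (by simp)).1
    · simpa using (h 0 (by simp)).2
    · have := h (k + 1) (by simpa using hk)
      simpa [mul_add, add_assoc, add_comm 2] using this

/-- Merging with respect to the lexicographic order. -/
abbrev mergePairs (a b : List (ℕ × ℕ)) : List (ℕ × ℕ) :=
  a.merge b fun p q => !decide (PLt q p)

/-- Merging: the registers `84`, `89` point to sorted tables whose lengths are in the registers
`87`, `88`; register `85` points to the output. -/
def mergeLoop : Prog :=
  loop (reg 87 + reg 88)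
    (assign 91 0 ;;
     ite (reg 88)
       (ite (reg 87)
         (assign 91 (lex (load (reg 89)) (load (reg 89 + 1)) (load (reg 84)) (load (reg 84 + 1))))
         (assign 91 1))
       skip ;;
     ite (reg 91)
       (store (reg 85) (load (reg 89)) ;; store (reg 85 + 1) (load (reg 89 + 1)) ;;
         assign 89 (reg 89 + 2) ;; assign 88 (reg 88 - 1))
       (store (reg 85) (load (reg 84)) ;; store (reg 85 + 1) (load (reg 84 + 1)) ;;
         assign 84 (reg 84 + 2) ;; assign 87 (reg 87 - 1)) ;;
     assign 85 (reg 85 + 2))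

/-- Both inputs lie below `D` and the output above it, so what remains to be read is never
overwritten. The induction is on the number of remaining pairs; `right` and `left` are the two ways
of emitting one pair. -/
theorem runs_mergeLoop {E : Env} {Q : NatState → Prop} {D : ℕ} (hM : E.N + 4 ≤ E.M) (k : ℕ) :
    ∀ (a b : List (ℕ × ℕ)) (s : NatState), a.length + b.length = k →
    Seg s.mem (s.reg 84) a → Seg s.mem (s.reg 89) b → s.reg 87 = a.length → s.reg 88 = b.length →
    s.reg 84 + 2 * a.length ≤ D → s.reg 89 + 2 * b.length ≤ D → D ≤ s.reg 85 →
    s.reg 85 + 2 * (a.length + b.length) ≤ E.N →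
    (∀ s', Seg s'.mem (s.reg 85) (mergePairs a b) →
      (∀ x, x < s.reg 85 → s'.mem x = s.mem x) →
      (∀ x < 84, s'.reg x = s.reg x) → s'.reg 86 = s.reg 86 → s'.reg 90 = s.reg 90 →
      s'.reg 85 = s.reg 85 + 2 * (a.length + b.length) →
      s'.clk ≤ s.clk + 80 * (a.length + b.length) + 4 → Q s') →
    Runs E mergeLoop s Q := by
  induction k with
  | zero =>
    intro a b s hk ha hb h1 h2 h3 h4 h5 h6 hQ
    obtain rfl : a = [] := List.length_eq_zero_iff.1 (by omega)
    obtain rfl : b = [] := List.length_eq_zero_iff.1 (by omega)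
    simp at h1 h2
    refine Runs.loop (by simp; omega) (fun h => ?_) fun _ => ?_
    · simp [h1, h2] at h
    · refine hQ _ ?_ (fun x _ => rfl) (fun x _ => rfl) rfl rfl rfl ?_
      · simp [Seg]
      · simp
  | succ k ih =>
    intro a b s hk ha hb h1 h2 h3 h4 h5 h6 hQ
    refine Runs.loop (by simp; omega) (fun _ => Runs.of_wp ?_) fun h => ?_
    swap
    · simp at h; omega
    have right : ∀ y ys s', b = y :: ys → mergePairs a b = y :: mergePairs a ys →
        s'.mem = Function.update (Function.update s.mem (s.reg 85) y.1) (s.reg 85 + 1) y.2 →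
        (∀ x < 84, s'.reg x = s.reg x) → s'.reg 84 = s.reg 84 → s'.reg 86 = s.reg 86 →
        s'.reg 87 = s.reg 87 → s'.reg 88 = ys.length → s'.reg 89 = s.reg 89 + 2 →
        s'.reg 90 = s.reg 90 → s'.reg 85 = s.reg 85 + 2 → s'.clk ≤ s.clk + 80 →
        Runs E mergeLoop s' Q := by
      intro y ys s' hby hm h7 h8 h9 h10 h11 h12 h13 h14 h15 h16
      subst hby
      simp only [List.length_cons] at *
      have hmem : ∀ x, x < s.reg 85 → s'.mem x = s.mem x := fun x hx => by
        rw [h7, Function.update_of_ne (by omega), Function.update_of_ne (by omega)]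
      refine ih a ys s' (by omega) ?_ ?_ (by omega) (by omega) (by omega) (by omega)
        (by omega) (by omega) fun s'' k1 k2 k3 k4 k5 k6 k7 => ?_
      · rw [h9]; exact ha.congr fun x _ _ => hmem x (by omega)
      · rw [h13]; exact hb.2.2.congr fun x _ _ => hmem x (by omega)
      · refine hQ s'' ?_ (fun x hx => (k2 x (by omega)).trans (hmem x hx))
          (fun x hx => (k3 x hx).trans (h8 x hx)) (by omega) (by omega) (by omega) (by omega)
        rw [h15] at k1
        rw [hm]
        refine ⟨?_, ?_, k1⟩
        · rw [k2 _ (by omega), h7, Function.update_of_ne (by omega), Function.update_self]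
        · rw [k2 _ (by omega), h7, Function.update_self]
    have left : ∀ y ys s', a = y :: ys → mergePairs a b = y :: mergePairs ys b →
        s'.mem = Function.update (Function.update s.mem (s.reg 85) y.1) (s.reg 85 + 1) y.2 →
        (∀ x < 84, s'.reg x = s.reg x) → s'.reg 84 = s.reg 84 + 2 → s'.reg 86 = s.reg 86 →
        s'.reg 87 = ys.length → s'.reg 88 = s.reg 88 → s'.reg 89 = s.reg 89 →
        s'.reg 90 = s.reg 90 → s'.reg 85 = s.reg 85 + 2 → s'.clk ≤ s.clk + 80 →
        Runs E mergeLoop s' Q := by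
      intro y ys s' hby hm h7 h8 h9 h10 h11 h12 h13 h14 h15 h16
      subst hby
      simp only [List.length_cons] at *
      have hmem : ∀ x, x < s.reg 85 → s'.mem x = s.mem x := fun x hx => by
        rw [h7, Function.update_of_ne (by omega), Function.update_of_ne (by omega)]
      refine ih ys b s' (by omega) ?_ ?_ (by omega) (by omega) (by omega) (by omega)
        (by omega) (by omega) fun s'' k1 k2 k3 k4 k5 k6 k7 => ?_
      · rw [h9]; exact ha.2.2.congr fun x _ _ => hmem x (by omega)
      · rw [h13]; exact hb.congr fun x _ _ => hmem x (by omega)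
      · refine hQ s'' ?_ (fun x hx => (k2 x (by omega)).trans (hmem x hx))
          (fun x hx => (k3 x hx).trans (h8 x hx)) (by omega) (by omega) (by omega) (by omega)
        rw [h15] at k1
        rw [hm]
        refine ⟨?_, ?_, k1⟩
        · rw [k2 _ (by omega), h7, Function.update_of_ne (by omega), Function.update_self]
        · rw [k2 _ (by omega), h7, Function.update_self]
    rw [mergeLoop] at left right
    cases a with
    | nil =>
      cases b with
      | nil => simp at hk
      | cons y ys =>
        obtain ⟨hb1, hb2, hb3⟩ := hb
        simp only [List.length_cons, List.length_nil] at *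
        simp [wp, h1, h2]
        split_ands <;> try omega
        refine right y ys _ rfl (by simp) ?_ (fun x hx => ?_) ?_ ?_ ?_ ?_ ?_ ?_ ?_ ?_ <;>
          simp (disch := omega) [hb1, hb2, Function.update_of_ne, h1]
    | cons x xs =>
      obtain ⟨ha1, ha2, ha3⟩ := ha
      cases b with
      | nil =>
        simp only [List.length_cons, List.length_nil] at *
        simp [wp, h1, h2]
        split_ands <;> try omega
        refine left x xs _ rfl (by simp) ?_ (fun x hx => ?_) ?_ ?_ ?_ ?_ ?_ ?_ ?_ ?_ <;>
          simp (disch := omega) [ha1, ha2, Function.update_of_ne, h2]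
      | cons y ys =>
        obtain ⟨hb1, hb2, hb3⟩ := hb
        simp only [List.length_cons] at *
        simp [wp, h1, h2, ha1, ha2, hb1, hb2]
        split_ands <;> try omega
        · intro hlt
          split_ands <;> try omega
          refine right y ys _ rfl ?_ ?_ (fun x hx => ?_) ?_ ?_ ?_ ?_ ?_ ?_ ?_ ?_
          · rw [mergePairs, List.cons_merge_cons_neg]
            simpa using hlt
          all_goals simp (disch := omega) [hb2, Function.update_of_ne, h1]
        · intro hlt
          split_ands <;> try omega
          refine left x xs _ rfl ?_ ?_ (fun x hx => ?_) ?_ ?_ ?_ ?_ ?_ ?_ ?_ ?_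
          · rw [mergePairs, List.cons_merge_cons_pos]
            simpa using hlt
          all_goals simp (disch := omega) [ha2, Function.update_of_ne, h2]

end WordRAM

/-! ### Copying, passes of merge sort, and the sorting program -/

namespace WordRAM

open WordRAM.Expr WordRAM.Prog

/-- Copying: registers `84`, `85`, `86` hold the target address, the source address and the number
of pairs. -/
def copyLoop : Prog :=
  loop (reg 86)
    (store (reg 84) (load (reg 85)) ;; store (reg 84 + 1) (load (reg 85 + 1)) ;;
     assign 84 (reg 84 + 2) ;; assign 85 (reg 85 + 2) ;; assign 86 (reg 86 - 1))

theorem runs_copyLoop {E : Env} {Q : NatState → Prop} (hM : E.N + 4 ≤ E.M)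
    (l : List (ℕ × ℕ)) : ∀ s : NatState, Seg s.mem (s.reg 85) l → s.reg 86 = l.length →
    s.reg 84 + 2 * l.length ≤ s.reg 85 → s.reg 85 + 2 * l.length ≤ E.N →
    (∀ s', Seg s'.mem (s.reg 84) l →
      (∀ x, x < s.reg 84 ∨ s.reg 84 + 2 * l.length ≤ x → s'.mem x = s.mem x) →
      (∀ x < 84, s'.reg x = s.reg x) → s'.clk ≤ s.clk + 40 * l.length + 2 → Q s') →
    Runs E copyLoop s Q := by
  induction l with
  | nil =>
    intro s h1 h2 h3 h4 hQ
    refine Runs.loop (by simp) (fun h => absurd h2 h) fun _ => ?_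
    exact hQ _ trivial (fun x _ => rfl) (fun x _ => rfl) (by simp)
  | cons p l ih =>
    intro s h1 h2 h3 h4 hQ
    obtain ⟨h5, h6, h7⟩ := h1
    simp only [List.length_cons] at *
    refine Runs.loop (by simp) (fun h => Runs.of_wp ?_) fun h => ?_
    · simp (disch := omega) [wp, h2, h5, h6, Function.update_of_ne]
      split_ands <;> try omega
      refine ih _ ?_ ?_ ?_ ?_ fun s' k1 k2 k3 k4 => ?_
      · refine h7.congr fun x _ _ => ?_
        simp (disch := omega) [Function.update_of_ne]
      · simp
      · simp; omega
      · simp; omega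
      · simp at k1 k2 k4
        refine hQ s' ⟨?_, ?_, k1⟩ (fun x hx => ?_) (fun x hx => ?_) (by omega)
        · rw [k2 _ (by omega)]; simp
        · rw [k2 _ (by omega)]; simp
        · rw [k2 _ (by omega)]; simp (disch := omega) [Function.update_of_ne]
        · rw [k3 x hx]; simp (disch := omega) [Function.update_of_ne]
    · simp at h; omega

/-- One pass of bottom-up merge sort: consecutive blocks of length `w` are merged in pairs. -/
def mergePass (w : ℕ) (l : List (ℕ × ℕ)) : List (ℕ × ℕ) :=
  if l = [] ∨ w = 0 then l
  else mergePairs (l.take w) ((l.drop w).take w) ++ mergePass w (l.drop (w + w))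
termination_by l.length
decreasing_by
  rename_i h
  rw [not_or] at h
  have := List.length_pos_iff.2 h.1
  simp; omega

theorem mergePass_perm (w : ℕ) (l : List (ℕ × ℕ)) : (mergePass w l).Perm l := by
  induction hn : l.length using Nat.strong_induction_on generalizing l with
  | _ n ih =>
    rw [mergePass]
    split_ifs with h
    · rfl
    · rw [not_or] at h
      have h1 := List.length_pos_iff.2 h.1
      have h2 := ih _ (by simp; omega) (l.drop (w + w)) rfl
      refine ((List.merge_perm_append _).append h2).trans ?_
      rw [← List.drop_drop, List.append_assoc, List.take_append_drop, List.take_append_drop]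

/-- The non-strict lexicographic order. -/
abbrev PLe (p q : ℕ × ℕ) : Prop := ¬ PLt q p

theorem mergePairs_sorted {a b : List (ℕ × ℕ)} (ha : a.Pairwise PLe) (hb : b.Pairwise PLe) :
    (mergePairs a b).Pairwise PLe := by
  have := List.pairwise_merge (le := fun p q => !decide (PLt q p)) (fun a b c => ?_)
    (fun a b => ?_) a b (by simpa using ha) (by simpa using hb)
  · simpa using this
  · simp only [Bool.not_eq_true', decide_eq_false_iff_not]; unfold PLt; omega
  · simp only [Bool.or_eq_true, Bool.not_eq_true', decide_eq_false_iff_not]; unfold PLt; omega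

/-- Every block of length `w` is sorted. -/
def BlockSorted (w : ℕ) (l : List (ℕ × ℕ)) : Prop :=
  ∀ i, ((l.drop (i * w)).take w).Pairwise PLe

/-- Two neighbouring sorted blocks become one sorted block of doubled length. The blocks of the
result stay aligned with multiples of `w + w`, because a merged block can be shorter only if nothing
follows it. -/
theorem BlockSorted.mergePass {w : ℕ} (hw : 0 < w) {l : List (ℕ × ℕ)} (h : BlockSorted w l) :
    BlockSorted (w + w) (mergePass w l) := by
  induction hn : l.length using Nat.strong_induction_on generalizing l with
  | _ n ih =>
    rw [WordRAM.mergePass]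
    split_ifs with h0
    · rcases h0 with h0 | h0
      · subst h0; intro i; simp
      · omega
    · rw [not_or] at h0
      have h1 := List.length_pos_iff.2 h0.1
      have h2 : BlockSorted (w + w) (WordRAM.mergePass w (l.drop (w + w))) :=
        ih _ (by simp; omega) (l := l.drop (w + w)) (fun i => by
          have := h (i + 2)
          rwa [List.drop_drop, show w + w + i * w = (i + 2) * w by ring]) rfl
      have h3 := mergePairs_sorted (by simpa using h 0) (by simpa using h 1)
      have h4 := (mergePass_perm w (l.drop (w + w))).length_eq
      generalize hA : mergePairs (l.take w) ((l.drop w).take w) = A at *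
      generalize WordRAM.mergePass w (l.drop (w + w)) = R at *
      have h5 : A.length = min w l.length + min w (l.length - w) := by
        rw [← hA]; simp [mergePairs]
      simp only [List.length_drop] at h4
      have h6 : A.length = w + w ∨ A.length < w + w ∧ R = [] := by
        by_cases hc : A.length = w + w
        · exact .inl hc
        · exact .inr ⟨by omega, List.length_eq_zero_iff.1 (by omega)⟩
      intro i
      rcases h6 with h6 | ⟨h6, rfl⟩
      · cases i with
        | zero => simpa [← h6] using h3
        | succ i =>
          have := h2 i
          rwa [List.drop_append, List.drop_eq_nil_of_le (by rw [h6]; nlinarith), List.nil_append,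
            h6, show (i + 1) * (w + w) - (w + w) = i * (w + w) by
              rw [add_mul, one_mul, Nat.add_sub_cancel]]
      · rw [List.append_nil]
        exact (h3.sublist (List.drop_sublist _ _)).sublist (List.take_sublist _ _)

/-- One pass of merge sort: blocks of length `reg 83` of the table at `reg 84` with `reg 86`
entries are merged into the table at `reg 85`. -/
def passLoop : Prog :=
  loop (reg 86)
    ((assign 87 (reg 83) ;; ite (lt (reg 86) (reg 87)) (assign 87 (reg 86)) skip ;;
      assign 86 (reg 86 - reg 87) ;;
      assign 88 (reg 83) ;; ite (lt (reg 86) (reg 88)) (assign 88 (reg 86)) skip ;;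
      assign 86 (reg 86 - reg 88) ;;
      assign 89 (reg 84 + 2 * reg 87) ;; assign 90 (reg 89 + 2 * reg 88)) ;;
     mergeLoop ;; assign 84 (reg 90))

theorem runs_passLoop {E : Env} {Q : NatState → Prop} {D w : ℕ} (hM : 2 * E.N + 4 ≤ E.M)
    (hw : 0 < w) (n : ℕ) : ∀ (l : List (ℕ × ℕ)) (s : NatState), l.length ≤ n →
    Seg s.mem (s.reg 84) l → s.reg 86 = l.length → s.reg 83 = w →
    s.reg 84 + 2 * l.length ≤ D → D ≤ s.reg 85 → s.reg 85 + 2 * l.length ≤ E.N →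
    (∀ s', Seg s'.mem (s.reg 85) (mergePass w l) → (∀ x, x < s.reg 85 → s'.mem x = s.mem x) →
      (∀ x < 84, s'.reg x = s.reg x) → s'.clk ≤ s.clk + 150 * l.length + 2 → Q s') →
    Runs E passLoop s Q := by
  induction n with
  | zero =>
    intro l s hn h1 h2 h3 h4 h5 h6 hQ
    obtain rfl : l = [] := List.length_eq_zero_iff.1 (by omega)
    refine Runs.loop (by simp) (fun h => absurd h2 h) fun _ => ?_
    refine hQ _ ?_ (fun x _ => rfl) (fun x _ => rfl) (by simp)
    simp [mergePass, Seg]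
  | succ n ih =>
    intro l s hn h1 h2 h3 h4 h5 h6 hQ
    refine Runs.loop (by simp) (fun h => ?_) fun h => ?_
    · have hl : 0 < l.length := by simp at h; omega
      have hne : l ≠ [] := List.length_pos_iff.1 hl
      set a := l.take w with ha
      set b := (l.drop w).take w with hb
      set r := l.drop (w + w) with hr
      have hlr : l = a ++ b ++ r := by
        rw [ha, hb, hr, ← List.drop_drop, List.append_assoc, List.take_append_drop,
          List.take_append_drop]
      have hpass : mergePass w l = mergePairs a b ++ mergePass w r := by
        rw [mergePass, if_neg (by simp [hne]; omega)]
      have la : a.length = min w l.length := by simp [ha]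
      have lb : b.length = min w (l.length - w) := by simp [hb]
      have lr : r.length = l.length - (w + w) := by simp [hr]
      have lm : (mergePairs a b).length = a.length + b.length := by simp [mergePairs]
      have hseg : Seg s.mem (s.reg 84) (a ++ b ++ r) := hlr ▸ h1
      rw [seg_append, seg_append, List.length_append] at hseg
      -- The conditionals truncate the two block lengths to what is left of the table and thereby
      -- create several branches; all of them leave the registers described here.
      have main : ∀ s₁ : NatState, s₁.mem = s.mem → (∀ x < 84, s₁.reg x = s.reg x) →
          s₁.reg 84 = s.reg 84 → s₁.reg 85 = s.reg 85 → s₁.reg 86 = r.length →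
          s₁.reg 87 = a.length → s₁.reg 88 = b.length → s₁.reg 89 = s.reg 84 + 2 * a.length →
          s₁.reg 90 = s.reg 84 + 2 * (a.length + b.length) → s₁.clk ≤ s.clk + 50 →
          Runs E (mergeLoop ;; assign 84 (reg 90)) s₁ fun s' => Runs E passLoop s' Q := by
        intro s₁ m1 m2 m3 m4 m5 m6 m7 m8 m9 m10
        refine Runs.seq ?_
        refine runs_mergeLoop (D := D) (by omega) _ a b s₁ rfl ?_ ?_ m6 m7 (by omega) (by omega)
          (by omega) (by omega) fun s₂ k1 k2 k3 k4 k5 k6 k7 => Runs.assign (by simp) ?_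
        · rw [m1, m3]; exact hseg.1.1
        · rw [m1, m8]; exact hseg.1.2
        · refine ih r _ (by omega) ?_ ?_ ?_ ?_ ?_ ?_ fun s₃ q1 q2 q3 q4 => ?_
          · simp only [natEval_reg, Function.update_self, k5, m9]
            refine hseg.2.congr fun x _ _ => ?_
            rw [k2 _ (by omega), m1]
          · simp [k4, m5]
          · simp [k3, m2, h3]
          · simp [k5, m9]; omega
          · simp [k6]; omega
          · simp [k6]; omega
          · simp at q1 q2 q3 q4
            refine hQ s₃ ?_ (fun x hx => ?_) (fun x hx => ?_) (by omega)
            · rw [hpass, seg_append]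
              constructor
              · rw [m4] at k1
                exact k1.congr fun x _ _ => q2 _ (by omega)
              · rw [k6, m4] at q1
                rwa [lm]
            · rw [q2 _ (by omega), k2 _ (by omega), m1]
            · rw [q3 x hx, Function.update_of_ne (by omega), k3 x hx, m2 x hx]
      refine Runs.block ?_
      simp [wp, h2, h3]
      split_ands <;> intros <;> split_ands <;> try omega
      all_goals intros; split_ands <;> try omega
      all_goals
        refine main _ rfl (fun x hx => ?_) ?_ ?_ ?_ ?_ ?_ ?_ ?_ ?_ <;>
          simp (disch := omega) [Function.update_of_ne] <;> omega
    · have : l = [] := List.length_eq_zero_iff.1 (by simp at h; omega)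
      subst this
      refine hQ _ ?_ (fun x _ => rfl) (fun x _ => rfl) (by simp)
      simp [mergePass, Seg]

/-- Merge sort of the table at address `reg 80` with `reg 81` entries; register `82` points to
free memory. -/
def sort : Prog :=
  assign 83 1 ;;
  loop (lt (reg 83) (reg 81))
    ((assign 84 (reg 80) ;; assign 85 (reg 82) ;; assign 86 (reg 81)) ;; passLoop ;;
     (assign 84 (reg 80) ;; assign 85 (reg 82) ;; assign 86 (reg 81)) ;; copyLoop ;;
     assign 83 (2 * reg 83))

/-- `b` bounds the number of doublings of the block length `w` that are still needed, by `l₀.length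
≤ w * 2 ^ b`. A round is one pass into the free memory and one copy back, both in linear time. -/
theorem runs_sort_loop {E : Env} {Q : NatState → Prop} (hM : 4 * E.N + 4 ≤ E.M) {C : ℕ}
    {l₀ : List (ℕ × ℕ)} {s₀ : NatState} (hn : s₀.reg 81 = l₀.length)
    (hscr : s₀.reg 80 + 2 * l₀.length ≤ s₀.reg 82) (hN : s₀.reg 82 + 2 * l₀.length ≤ E.N)
    (hQ : ∀ (s' : NatState) (l : List (ℕ × ℕ)), l.Perm l₀ → l.Pairwise PLe →
      Seg s'.mem (s₀.reg 80) l →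
      (∀ x, x < s₀.reg 80 ∨ s₀.reg 80 + 2 * l₀.length ≤ x ∧ x < s₀.reg 82 → s'.mem x = s₀.mem x) →
      (∀ x < 83, s'.reg x = s₀.reg x) → s'.clk ≤ C → Q s') (b : ℕ) :
    ∀ (s : NatState) (l : List (ℕ × ℕ)) (w : ℕ), s.reg 83 = w → 0 < w → l₀.length ≤ w * 2 ^ b →
      BlockSorted w l → l.Perm l₀ → Seg s.mem (s₀.reg 80) l →
      (∀ x, x < s₀.reg 80 ∨ s₀.reg 80 + 2 * l₀.length ≤ x ∧ x < s₀.reg 82 → s.mem x = s₀.mem x) →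
      (∀ x < 83, s.reg x = s₀.reg x) → s.clk + (b * (200 * l₀.length + 40) + 10) ≤ C →
      Runs E (loop (lt (reg 83) (reg 81))
        ((assign 84 (reg 80) ;; assign 85 (reg 82) ;; assign 86 (reg 81)) ;; passLoop ;;
          (assign 84 (reg 80) ;; assign 85 (reg 82) ;; assign 86 (reg 81)) ;; copyLoop ;;
          assign 83 (2 * reg 83))) s Q := by
  have fin : ∀ (s : NatState) (l : List (ℕ × ℕ)) (w : ℕ), l₀.length ≤ w →
      BlockSorted w l → l.Perm l₀ → l.Pairwise PLe := by
    intro s l w h1 h2 h3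
    have := h2 0
    rwa [zero_mul, List.drop_zero, List.take_of_length_le (h3.length_eq.trans_le h1)] at this
  induction b with
  | zero =>
    intro s l w hw hw0 hb hs hp hseg hm hf hC
    have hlen := hp.length_eq
    refine Runs.loop (by simp) (fun h => ?_) fun h => ?_
    · simp [hf, hn] at h; omega
    · exact hQ _ l hp (fin s l w (by simpa using hb) hs hp) hseg hm hf (by simp; omega)
  | succ b ih =>
    intro s l w hw hw0 hb hs hp hseg hm hf hC
    have hlen := hp.length_eq
    have hC' : s.clk + (b * (200 * l₀.length + 40) + 10) + (200 * l₀.length + 40) ≤ C := by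
      rw [add_mul] at hC; omega
    refine Runs.loop (by simp) (fun h => Runs.block ?_) fun h => ?_
    · have hwn : w < l₀.length := by simpa [hf, hn, hw] using h
      simp [wp, hf, hn]
      refine Runs.seq (runs_passLoop (D := s₀.reg 82) (w := w) (by omega) hw0 _ l _ le_rfl
        ?_ ?_ ?_ ?_ ?_ ?_ fun s₁ h1 h2 h3 h4 => Runs.block ?_)
      · simpa using hseg
      · simp [hlen]
      · simp [hw]
      · simp [hlen, hscr]
      · simp
      · simp [hlen, hN]
      · simp at h1 h2 h3 h4
        have hp' := mergePass_perm w l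
        have hlen' := hp'.length_eq.trans hlen
        have h3' : ∀ x < 83, s₁.reg x = s₀.reg x := fun x hx => by
          rw [h3 x (by omega)]; simp (disch := omega) [Function.update_of_ne, hf x hx]
        simp [wp, h3', hn]
        refine Runs.seq (runs_copyLoop (by omega) (mergePass w l) _ ?_ ?_ ?_ ?_
          fun s₂ k1 k2 k3 k4 => Runs.of_wp ?_)
        · simpa using h1
        · simp [hlen']
        · simp [hlen', hscr]
        · simp [hlen', hN]
        · simp [hlen'] at k1 k2 k3 k4
          have h83 : s₂.reg 83 = w := by
            rw [k3 83 (by omega)]; simp [h3, hw]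
          simp [wp, h83]
          split_ands <;> try omega
          refine ih _ (mergePass w l) (w + w) ?_ (by omega) ?_ (hs.mergePass hw0) (hp'.trans hp)
            ?_ (fun x hx => ?_) (fun x hx => ?_) ?_
          · simp; omega
          · rw [pow_succ] at hb
            calc _ ≤ _ := hb
              _ = _ := by ring
          · simpa using k1
          · simp only
            rw [k2 x (by omega), h2 x (by omega), hm x hx]
          · simp only
            rw [Function.update_of_ne (by omega), k3 x (by omega)]
            simp (disch := omega) [Function.update_of_ne, h3' x hx]
          · simp; omega
    · have hwn : l₀.length ≤ w := by simpa [hf, hn, hw] using h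
      exact hQ _ l hp (fin s l w hwn hs hp) hseg hm hf (by simp; omega)

theorem runs_sort {E : Env} {Q : NatState → Prop} (hM : 4 * E.N + 4 ≤ E.M)
    {n : ℕ} {g : ℕ → ℕ × ℕ} {s : NatState} (ht : Table s.mem (s.reg 80) n g) (hn : s.reg 81 = n)
    (hscr : s.reg 80 + 2 * n ≤ s.reg 82) (hN : s.reg 82 + 2 * n ≤ E.N)
    (hQ : ∀ (s' : NatState) (l : List (ℕ × ℕ)), l.Perm ((List.range n).map g) →
      l.Pairwise PLe → Table s'.mem (s.reg 80) n (fun k => l.getD k (0, 0)) →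
      (∀ x, x < s.reg 80 ∨ s.reg 80 + 2 * n ≤ x ∧ x < s.reg 82 → s'.mem x = s.mem x) →
      (∀ x < 83, s'.reg x = s.reg x) →
      s'.clk ≤ s.clk + (Nat.log 2 n + 1) * (200 * n + 40) + 20 → Q s') :
    Runs E sort s Q := by
  have hlen : ((List.range n).map g).length = n := by simp
  refine Runs.block ?_
  simp [wp]
  split_ands <;> try omega
  refine runs_sort_loop hM (s₀ := s) (l₀ := (List.range n).map g) (by simp [hn])
    (by simpa using hscr) (by simpa using hN) (C := s.clk +
      (Nat.log 2 n + 1) * (200 * n + 40) + 20) ?_ (Nat.log 2 n + 1) _ ((List.range n).map g) 1 rfl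
    one_pos ?_ ?_ (List.Perm.refl _) ?_ (fun x _ => rfl) (fun x hx => ?_) ?_
  · intro s' l h1 h2 h3 h4 h5 h6
    have hl := h1.length_eq.trans hlen
    refine hQ s' l h1 h2 ?_ (by simpa using h4) h5 h6
    have := seg_iff_table.1 h3
    rwa [hl] at this
  · simpa using (Nat.lt_pow_succ_log_self Nat.one_lt_two n).le
  · intro i
    have : (List.take 1 (List.drop (i * 1) ((List.range n).map g))).length ≤ 1 := by simp
    rcases hl : List.take 1 (List.drop (i * 1) ((List.range n).map g)) with _ | ⟨p, _ | ⟨q, t⟩⟩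
    · simp
    · simp
    · rw [hl] at this; simp at this
  · refine seg_iff_table.2 ?_
    rw [hlen]
    intro k hk
    simpa [hk] using ht k hk
  · simp (disch := omega) [Function.update_of_ne]
  · simp; omega

end WordRAM

/-! ## The LF-mapping of a string -/

namespace Bwt

open WordRAM

/-- The number of positions `p` of `B` with `(B p, p) < (c, i)`. -/
def rankMap (B : List ℕ) (c i : ℕ) : ℕ :=
  ((Finset.range B.length).filter fun p => PLt (B.getD p 0, p) (c, i)).card

/-- The LF-mapping. -/
def lf (B : List ℕ) (p : ℕ) : ℕ := rankMap B (B.getD p 0) p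

/-- The inverse of the LF-mapping. -/
noncomputable def psi (B : List ℕ) (q : ℕ) : ℕ :=
  Function.invFunOn (lf B) (Set.Iio B.length) q

variable {B : List ℕ}

theorem rankMap_le (c i : ℕ) : rankMap B c i ≤ B.length :=
  (Finset.card_filter_le _ _).trans (Finset.card_range _).le

theorem rankMap_mono {c c' i i' : ℕ} (h : ∀ p, PLt p (c, i) → PLt p (c', i')) :
    rankMap B c i ≤ rankMap B c' i' :=
  Finset.card_le_card (Finset.monotone_filter_right _ fun _ _ hp => h _ hp)

/-- The sets counted by `rankMap` are initial segments of the positions in the order of the pairs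
`(B p, p)`, hence nested; `p` belongs to every segment whose bound exceeds its own pair, but not to
the segment counted by `lf B p`. -/
theorem lf_lt_rankMap_iff {p c i : ℕ} (hp : p < B.length) :
    lf B p < rankMap B c i ↔ PLt (B.getD p 0, p) (c, i) := by
  constructor
  · intro h
    by_contra hc
    refine absurd h (not_lt.2 (rankMap_mono fun x hx => ?_))
    simp only [PLt] at *; omega
  · intro h
    unfold lf rankMap
    refine Finset.card_lt_card (Finset.ssubset_iff_subset_ne.2 ⟨?_, ?_⟩)
    · refine Finset.monotone_filter_right _ fun x _ hx => ?_
      simp only [PLt] at *; omega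
    · intro he
      have : p ∈ (Finset.range B.length).filter fun x => PLt (B.getD x 0, x) (c, i) := by
        exact Finset.mem_filter.2 ⟨Finset.mem_range.2 hp, h⟩
      rw [← he] at this
      simp [PLt] at this

theorem lf_lt_lf_iff {p p' : ℕ} (hp : p < B.length) :
    lf B p < lf B p' ↔ PLt (B.getD p 0, p) (B.getD p' 0, p') := lf_lt_rankMap_iff hp

theorem lf_lt {p : ℕ} (hp : p < B.length) : lf B p < B.length := by
  have : lf B p < rankMap B (B.getD p 0) (p + 1) := (lf_lt_rankMap_iff hp).2 (by simp [PLt])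
  exact this.trans_le (rankMap_le _ _)

theorem lf_injOn : Set.InjOn (lf B) (Set.Iio B.length) := by
  intro p hp p' hp' h
  by_contra hne
  have h1 := lf_lt_lf_iff (p' := p') hp
  have h2 := lf_lt_lf_iff (p' := p) hp'
  simp only [PLt] at *
  omega

theorem exists_lf_eq {q : ℕ} (hq : q < B.length) : ∃ p ∈ Set.Iio B.length, lf B p = q := by
  have := Finset.surjOn_of_injOn_of_card_le (s := Finset.range B.length)
    (t := Finset.range B.length) (lf B) (fun p hp => by simpa using lf_lt (by simpa using hp))
    (by simpa [Set.InjOn] using (lf_injOn (B := B))) le_rfl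
  obtain ⟨p, hp, h⟩ := this (show q ∈ (Finset.range B.length : Set ℕ) by simpa using hq)
  exact ⟨p, by simpa using hp, h⟩

theorem psi_lt {q : ℕ} (hq : q < B.length) : psi B q < B.length :=
  Function.invFunOn_mem (exists_lf_eq hq)

theorem lf_psi {q : ℕ} (hq : q < B.length) : lf B (psi B q) = q :=
  Function.invFunOn_eq (exists_lf_eq hq)

theorem psi_lf {p : ℕ} (hp : p < B.length) : psi B (lf B p) = p :=
  lf_injOn (psi_lt (lf_lt hp)) hp (lf_psi (lf_lt hp))

/-- The first symbol of the rotation with rank `q`. -/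
noncomputable def fstSym (B : List ℕ) (q : ℕ) : ℕ := B.getD (psi B q) 0

/-- The previous statement seen from the target side: listed by rank, the pairs `(fstSym B q, psi B
q)` are sorted, so a value of `rankMap` is a cut that can be found by comparing pairs. -/
theorem lt_rankMap_iff {q c i : ℕ} (hq : q < B.length) :
    q < rankMap B c i ↔ PLt (fstSym B q, psi B q) (c, i) := by
  have := lf_lt_rankMap_iff (c := c) (i := i) (psi_lt hq)
  rwa [lf_psi hq] at this

theorem plt_of_lt {q q' : ℕ} (h : q < q') (hq' : q' < B.length) :
    PLt (fstSym B q, psi B q) (fstSym B q', psi B q') := by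
  rw [← lt_rankMap_iff (h.trans hq')]
  change q < lf B (psi B q')
  rwa [lf_psi hq']

/-- The composition of the maps `rankMap B c` for the symbols `c` of a string. -/
def rankList (B : List ℕ) : List ℕ → ℕ → ℕ
  | [], i => i
  | c :: X, i => rankMap B c (rankList B X i)

/-- The first `t` symbols of the rotation with rank `q`. -/
noncomputable def label (B : List ℕ) : ℕ → ℕ → List ℕ
  | 0, _ => []
  | t + 1, q => fstSym B q :: label B t (psi B q)

theorem psi_iterate_lt {q : ℕ} (hq : q < B.length) (t : ℕ) : (psi B)^[t] q < B.length := by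
  induction t generalizing q with
  | zero => simpa
  | succ t ih => exact ih (psi_lt hq)

theorem lf_iterate_lt {q : ℕ} (hq : q < B.length) (t : ℕ) : (lf B)^[t] q < B.length := by
  induction t generalizing q with
  | zero => simpa
  | succ t ih => exact ih (lf_lt hq)

theorem lf_psi_iterate {q : ℕ} (hq : q < B.length) (t : ℕ) : (lf B)^[t] ((psi B)^[t] q) = q := by
  induction t with
  | zero => rfl
  | succ t ih => rw [Function.iterate_succ_apply, Function.iterate_succ_apply' (psi B),
      lf_psi (psi_iterate_lt hq t), ih]

theorem rankList_mono (X : List ℕ) : Monotone (rankList B X) := by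
  induction X with
  | nil => exact monotone_id
  | cons c X ih =>
    intro i j h
    have := ih h
    refine rankMap_mono fun p hp => ?_
    simp only [PLt] at *; omega

theorem rankList_le {X : List ℕ} {i : ℕ} (hi : i ≤ B.length) : rankList B X i ≤ B.length := by
  cases X with
  | nil => exact hi
  | cons c X => exact rankMap_le _ _

/-- Backward search. By `lt_rankMap_iff` the cuts for `c :: X` compare the pair of `q` with two
pairs whose first component is `c`; lying between them forces the first symbol to be `c` and `psi B
q` to lie between the cuts for `X`. -/
theorem rankList_bounds_iff {X : List ℕ} {a b q : ℕ} (hq : q < B.length) :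
    rankList B X a ≤ q ∧ q < rankList B X b ↔
      label B X.length q = X ∧ a ≤ (psi B)^[X.length] q ∧ (psi B)^[X.length] q < b := by
  induction X generalizing q with
  | nil => simp [rankList, label]
  | cons c X ih =>
    have := ih (psi_lt hq)
    rw [List.length_cons, Function.iterate_succ_apply, label, List.cons.injEq, and_assoc, ← this,
      rankList, rankList, ← not_lt, lt_rankMap_iff hq, lt_rankMap_iff hq]
    simp only [PLt]
    omega

/-- A cut for `X` cannot separate two ranks with a common label other than `X`: the common first
symbol is at most `c` by one comparison and at least `c` by the other, and after removing it the cut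
for the tail separates the images under `psi`. -/
theorem label_eq_of_separated {X : List ℕ} {a q q' : ℕ} (hq : q < B.length) (hq' : q' < B.length)
    (hl : label B X.length q = label B X.length q') (h : q < rankList B X a)
    (h' : rankList B X a ≤ q') : label B X.length q = X := by
  induction X generalizing q q' with
  | nil => rfl
  | cons c X ih =>
    rw [List.length_cons, label, label, List.cons.injEq] at hl
    rw [rankList, lt_rankMap_iff hq] at h
    rw [rankList, ← not_lt, lt_rankMap_iff hq'] at h'
    rw [List.length_cons, label, ih (psi_lt hq) (psi_lt hq') hl.2, List.cons.injEq]
    all_goals simp only [PLt] at h h'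
    · refine ⟨?_, rfl⟩; omega
    · omega
    · omega

/-- A number that determines, together with the order, the interval of rotations that start
with `X`. -/
def name (B X : List ℕ) : ℕ := rankList B X 0 + rankList B X B.length

theorem label_length (t q : ℕ) : (label B t q).length = t := by
  induction t generalizing q with
  | zero => rfl
  | succ t ih => simp [label, ih]

theorem label_bounds {t q : ℕ} (hq : q < B.length) :
    rankList B (label B t q) 0 ≤ q ∧ q < rankList B (label B t q) B.length := by
  rw [rankList_bounds_iff hq, label_length]
  exact ⟨rfl, Nat.zero_le _, psi_iterate_lt hq t⟩

/-- Let `Y` be the label of `q`; its interval contains `q`, so it is nonempty. If `q` lies outside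
the interval of `X`, then by `label_eq_of_separated` the whole interval of `Y` lies on the same
side. Nonemptiness makes the sum of its end points strictly smaller or strictly larger, even if the
interval of `X` is empty. If `q` lies inside, then `Y = X`, the names agree, and the second
components decide by `rankList_bounds_iff`. -/
theorem lt_rankList_iff {X : List ℕ} {i q : ℕ} (hi : i ≤ B.length) (hq : q < B.length) :
    q < rankList B X i ↔
      PLt (name B (label B X.length q), (psi B)^[X.length] q) (name B X, i) := by
  have hb := label_bounds (t := X.length) hq
  have m1 := rankList_mono (B := B) X (Nat.zero_le i)
  have m2 := rankList_mono (B := B) X hi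
  have hXle : rankList B X B.length ≤ B.length := rankList_le le_rfl
  set Y := label B X.length q with hY
  have hYl : Y.length = X.length := label_length _ _
  have hYb : ∀ {x}, x < B.length → rankList B Y 0 ≤ x → x < rankList B Y B.length →
      label B X.length x = Y := fun hx h1 h2 => by
    have := (rankList_bounds_iff hx).1 ⟨h1, h2⟩
    rw [hYl] at this
    exact this.1
  rcases lt_or_ge q (rankList B X 0) with h | h
  · have hle : rankList B Y B.length ≤ rankList B X 0 := by
      -- Otherwise the cut `rankList B X 0` is itself a rank in the interval of `Y`; it has the
      -- label of `q` and is separated from `q`, so `Y = X`, which would put `q` behind the cut.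
      by_contra hc
      have hx : rankList B X 0 < B.length := by
        have : rankList B Y B.length ≤ B.length := rankList_le le_rfl
        omega
      have e1 := hYb hx (by omega) (by omega)
      have e2 := label_eq_of_separated hq hx (by rw [e1]) h le_rfl
      have := (rankList_bounds_iff hq).2 ⟨e2, Nat.zero_le _, psi_iterate_lt hq _⟩
      omega
    simp only [PLt, name]
    omega
  · rcases lt_or_ge q (rankList B X B.length) with h' | h'
    · have e := (rankList_bounds_iff hq).1 ⟨h, h'⟩
      have key := rankList_bounds_iff (X := X) (a := 0) (b := i) hq
      rw [show Y = X from e.1]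
      have e1 : PLt (name B X, (psi B)^[X.length] q) (name B X, i) ↔
          (psi B)^[X.length] q < i := by simp [PLt]
      have e2 : rankList B X 0 ≤ q ∧ q < rankList B X i ↔ (psi B)^[X.length] q < i := by
        rw [key]
        exact ⟨fun h => h.2.2, fun h => ⟨e.1, Nat.zero_le _, h⟩⟩
      rw [e1, ← e2]
      exact ⟨fun hh => ⟨h, hh⟩, And.right⟩
    · have hle : rankList B X B.length ≤ rankList B Y 0 := by
        by_contra hc
        have hx : rankList B Y 0 < B.length := by omega
        have e1 := hYb hx le_rfl (by omega)
        have e2 := label_eq_of_separated hx hq (by rw [e1]) (not_le.1 hc) h'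
        have := (rankList_bounds_iff hq).2 ⟨(hY ▸ e1 ▸ e2 : label B X.length q = X), Nat.zero_le _,
          psi_iterate_lt hq _⟩
        omega
      simp only [PLt, name]
      omega

/-- Apply `lt_rankList_iff` to the label of `q'` and its `t`-th image under `psi`. The resulting cut
is not below `q'`: a rank there would share label and image with `q'`, and `lf^[t]` recovers a rank
from its image. -/
theorem plt_label_of_lt {t q q' : ℕ} (h : q < q') (hq' : q' < B.length) :
    PLt (name B (label B t q), (psi B)^[t] q) (name B (label B t q'), (psi B)^[t] q') := by
  have hl := label_length (B := B) t q'
  have h1 := lt_rankList_iff (X := label B t q') (psi_iterate_lt hq' t).le (h.trans hq')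
  rw [hl] at h1
  refine h1.1 (h.trans_le ?_)
  by_contra hc
  set x := rankList B (label B t q') ((psi B)^[t] q') with hx
  have hxn : x < B.length := by omega
  have h2 := fun y hy => rankList_bounds_iff (X := label B t q') (a := (psi B)^[t] q')
    (b := (psi B)^[t] q' + 1) (q := y) (B := B) hy
  simp only [hl, ← hx] at h2
  have h3 : (psi B)^[t] x = (psi B)^[t] q' := by
    have := (h2 x hxn).1 ⟨le_rfl, (not_le.1 hc).trans ((h2 q' hq').2 ⟨rfl, le_rfl, by omega⟩).2⟩
    omega
  have h4 := lf_psi_iterate hxn t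
  rw [h3, lf_psi_iterate hq' t] at h4
  omega

/-! ### Piecewise translations -/

/-- `F 0, …, F K` cut the interval `[0, n)` into pieces on which `key` is constant and `f` is a
translation; the pairs `(key q, f q)` increase with `q`. -/
structure Pieces (n K : ℕ) (key f F : ℕ → ℕ) : Prop where
  zero : F 0 = 0
  last : F K = n
  mono : ∀ j k, j ≤ k → k ≤ K → F j ≤ F k
  lt : ∀ k < K, F k < n
  step : ∀ k < K, ∀ q, F k ≤ q → q < F (k + 1) → key q = key (F k) ∧ f q = f (F k) + (q - F k)
  strict : ∀ q q', q < q' → q' < n → PLt (key q, f q) (key q', f q')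

namespace Pieces

variable {n K : ℕ} {key f F : ℕ → ℕ}

/-- Pieces may be empty, since `F` need not be strictly increasing; but the last one that starts at
or before `q` does contain `q`. -/
theorem locate (h : Pieces n K key f F) {q cnt : ℕ} (hq : q < n) (hK : cnt ≤ K)
    (hcnt : ∀ k < K, k < cnt ↔ F k ≤ q) :
    0 < cnt ∧ F (cnt - 1) ≤ q ∧ q < F cnt ∧ f q = f (F (cnt - 1)) + (q - F (cnt - 1)) := by
  have hz := h.zero
  have hl := h.last
  have hK0 : 0 < K := by
    by_contra hc
    obtain rfl : K = 0 := by omega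
    omega
  have h0 : 0 < cnt := (hcnt 0 hK0).2 (by omega)
  have h1 := (hcnt (cnt - 1) (by omega)).1 (by omega)
  have h2 : q < F cnt := by
    rcases Nat.lt_or_ge cnt K with hc | hc
    · by_contra hx
      have := (hcnt cnt hc).2 (by omega)
      omega
    · obtain rfl : cnt = K := by omega
      omega
  refine ⟨h0, h1, h2, (h.step (cnt - 1) (by omega) q h1 ?_).2⟩
  rwa [Nat.sub_add_cancel h0]

/-- With the bound `(c, i + 1)`, `cnt` counts the pieces whose first pair is at most `(c, i)`, so
for `0 < cnt` the cut `g` lies between `F (cnt - 1)` and `F cnt`. If the key of that last piece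
differs from `c`, it is smaller and the whole piece lies below the cut. If it equals `c`, the second
components grow by one from `f (F (cnt - 1))` on, and the cut is reached after `i - f (F (cnt - 1))`
steps or at the end of the piece. -/
theorem rank_eq (h : Pieces n K key f F) {g c i cnt : ℕ} (hgn : g ≤ n)
    (hg : ∀ q < n, q < g ↔ PLt (key q, f q) (c, i)) (hK : cnt ≤ K)
    (hcnt : ∀ k < K, k < cnt ↔ PLt (key (F k), f (F k)) (c, i + 1)) :
    (cnt = 0 ∨ key (F (cnt - 1)) ≠ c → g = F cnt) ∧
    (0 < cnt → key (F (cnt - 1)) = c → f (F (cnt - 1)) ≤ i ∧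
      g = min (F (cnt - 1) + (i - f (F (cnt - 1)))) (F cnt)) := by
  have hFn : F cnt ≤ n := h.last ▸ h.mono cnt K hK le_rfl
  have hup : g ≤ F cnt := by
    rcases Nat.lt_or_ge cnt K with hc | hc
    · have h1 := mt (hcnt cnt hc).2 (lt_irrefl _)
      have h2 := mt (hg _ (h.lt cnt hc)).1
      by_contra hx
      refine h2 (fun h3 => h1 ?_) (by omega)
      simp only [PLt] at *; omega
    · obtain rfl : cnt = K := by omega
      rwa [h.last]
  have hmem : ∀ k < cnt, ∀ q, F k ≤ q → q < F (k + 1) →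
      (q < g ↔ PLt (key (F k), f (F k) + (q - F k)) (c, i)) := by
    intro k hk q h1 h2
    have hq : q < n := h2.trans_le (h.last ▸ h.mono (k + 1) K (by omega) le_rfl)
    obtain ⟨e1, e2⟩ := h.step k (by omega) q h1 h2
    rw [hg q hq, e1, e2]
  have hlow : 0 < cnt → F (cnt - 1) ≤ g := by
    intro h0
    by_contra hx
    have hlt := h.lt (cnt - 1) (by omega)
    have h1 := (hcnt (cnt - 1) (by omega)).1 (by omega)
    have h2 := h.strict g (F (cnt - 1)) (by omega) hlt
    have h3 := mt (hg g (by omega)).2 (lt_irrefl _)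
    apply h3
    simp only [PLt] at *; omega
  constructor
  · rintro (rfl | hne)
    · have := h.zero; omega
    · rcases Nat.eq_zero_or_pos cnt with rfl | h0
      · have := h.zero; omega
      refine le_antisymm hup (not_lt.1 fun hlt => ?_)
      have h1 := (hcnt (cnt - 1) (by omega)).1 (by omega)
      have h2 := hmem (cnt - 1) (by omega) g (hlow h0) (by rwa [Nat.sub_add_cancel h0])
      simp only [PLt] at *; omega
  · intro h0 he
    have h1 := (hcnt (cnt - 1) (by omega)).1 (by omega)
    have h2 : f (F (cnt - 1)) ≤ i := by simp only [PLt] at *; omega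
    have h3 := hmem (cnt - 1) (by omega)
    rw [Nat.sub_add_cancel h0] at h3
    have hlow := hlow h0
    refine ⟨h2, ?_⟩
    have hF := h.mono (cnt - 1) cnt (by omega) hK
    rw [he] at h3
    simp only [PLt, lt_self_iff_false, false_or, true_and] at h3
    apply le_antisymm
    · refine le_min (not_lt.1 fun hlt => ?_) hup
      have := h3 (F (cnt - 1) + (i - f (F (cnt - 1)))) (by omega) (by omega)
      omega
    · by_contra hlt
      have := h3 g hlow (by omega)
      omega

end Pieces

/-- The neighbours `i - 1` and `i` stay neighbours under `g` until the orbit of `i` meets the break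
set `L`. As `h` undoes `g`, an orbit that meets `x` after `k` steps starts at `h^[k] x`; so the
break points of the iterate are orbits of those of `g` under the inverse. -/
theorem iterate_step {n : ℕ} {g h sym : ℕ → ℕ} {L : Set ℕ} (hg : ∀ i < n, g i < n)
    (hh : ∀ i < n, h (g i) = i)
    (hs : ∀ i, 0 < i → i < n → i ∉ L → g i = g (i - 1) + 1 ∧ sym i = sym (i - 1)) (t i : ℕ)
    (hi : 0 < i) (hin : i < n) (hL : ∀ k < t, ∀ x ∈ L, h^[k] x ≠ i) :
    g^[t] i = g^[t] (i - 1) + 1 ∧ ∀ k < t, sym (g^[k] i) = sym (g^[k] (i - 1)) := by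
  induction t generalizing i with
  | zero => exact ⟨by simp; omega, by simp⟩
  | succ t ih =>
    obtain ⟨h1, h2⟩ := hs i hi hin fun hx => hL 0 (by omega) i hx rfl
    obtain ⟨h3, h4⟩ := ih (g i) (by omega) (hg i hin) fun k hk x hx he =>
      hL (k + 1) (by omega) x hx (by rw [Function.iterate_succ_apply', he, hh i hin])
    rw [show g i - 1 = g (i - 1) by omega] at h3 h4
    refine ⟨h3, fun k hk => ?_⟩
    cases k with
    | zero => exact h2
    | succ k => exact h4 k (by omega)

end Bwt

/-! ## Runs and sampled points -/

namespace Bwt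

open WordRAM

variable {B : List ℕ}

/-- The start of the `k`-th run; the length of the string if there is no such run. -/
def runStart (B : List ℕ) (k : ℕ) : ℕ := (runStarts B).getD k B.length

theorem mem_runStarts {x : ℕ} :
    x ∈ runStarts B ↔ x < B.length ∧ (x = 0 ∨ B[x]? ≠ B[x - 1]?) := by
  simp [runStarts]

theorem runStarts_pairwise : (runStarts B).Pairwise (· < ·) :=
  List.Pairwise.filter _ List.pairwise_lt_range

theorem runStart_of_lt {k : ℕ} (hk : k < (runStarts B).length) :
    runStart B k = (runStarts B)[k] := List.getD_eq_getElem _ _ hk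

theorem runStart_mem {k : ℕ} (hk : k < (runStarts B).length) : runStart B k ∈ runStarts B := by
  rw [runStart_of_lt hk]; exact List.getElem_mem hk

theorem runStart_lt {k : ℕ} (hk : k < (runStarts B).length) : runStart B k < B.length :=
  (mem_runStarts.1 (runStart_mem hk)).1

theorem runStart_length : runStart B (runStarts B).length = B.length := by simp [runStart]

theorem runStart_strictMono {j k : ℕ} (h : j < k) (hk : k ≤ (runStarts B).length) :
    runStart B j < runStart B k := by
  rcases hk.lt_or_eq with hk | rfl
  · rw [runStart_of_lt hk, runStart_of_lt (h.trans hk)]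
    exact List.pairwise_iff_getElem.1 runStarts_pairwise _ _ _ _ h
  · rw [runStart_length]; exact runStart_lt h

theorem exists_runStart_eq {x : ℕ} (hx : x ∈ runStarts B) :
    ∃ k < (runStarts B).length, runStart B k = x := by
  obtain ⟨k, hk, h⟩ := List.getElem_of_mem hx
  exact ⟨k, hk, (runStart_of_lt hk).trans h⟩

theorem runStarts_length_pos (hB : 0 < B.length) : 0 < (runStarts B).length :=
  List.length_pos_of_mem (mem_runStarts.2 ⟨hB, .inl rfl⟩)

theorem runStart_zero (hB : 0 < B.length) : runStart B 0 = 0 := by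
  obtain ⟨k, hk, h⟩ := exists_runStart_eq (B := B) (mem_runStarts.2 ⟨hB, .inl rfl⟩)
  rcases Nat.eq_zero_or_pos k with rfl | h0
  · exact h
  · have := runStart_strictMono h0 hk.le; omega

theorem runStarts_length_le : (runStarts B).length ≤ B.length :=
  (List.length_filter_le _ _).trans List.length_range.le

theorem getD_eq_of_notMem {i : ℕ} (hin : i < B.length) (h : i ∉ runStarts B) :
    B.getD i 0 = B.getD (i - 1) 0 := by
  have : B[i]? = B[i - 1]? := by
    by_contra hc
    exact h (mem_runStarts.2 ⟨hin, .inr hc⟩)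
  simp [List.getD_eq_getElem?_getD, this]

theorem exists_between {F : ℕ → ℕ} {K n q : ℕ} (h0 : F 0 = 0) (hK : F K = n) (hq : q < n) :
    ∃ k < K, F k ≤ q ∧ q < F (k + 1) := by
  classical
  have hex : ∃ k, q < F k := ⟨K, by omega⟩
  have h1 := Nat.find_spec hex
  have h2 : Nat.find hex ≤ K := Nat.find_min' hex (by omega)
  have h3 : Nat.find hex ≠ 0 := fun h => by rw [h] at h1; omega
  refine ⟨Nat.find hex - 1, by omega, not_lt.1 (Nat.find_min hex (by omega)), ?_⟩
  rwa [Nat.sub_add_cancel (Nat.pos_of_ne_zero h3)]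

theorem exists_run (hB : 0 < B.length) {p : ℕ} (hp : p < B.length) :
    ∃ k < (runStarts B).length, runStart B k ≤ p ∧ p < runStart B (k + 1) :=
  exists_between (runStart_zero hB) runStart_length hp

theorem notMem_runStarts {k i : ℕ} (h1 : runStart B k < i)
    (h2 : i < runStart B (k + 1)) : i ∉ runStarts B := fun hi => by
  obtain ⟨j, hj, rfl⟩ := exists_runStart_eq hi
  rcases lt_trichotomy j k with h | rfl | h
  · by_cases hk : k < (runStarts B).length
    · have := runStart_strictMono h hk.le; omega
    · have h3 : runStart B k = B.length := by simp [runStart, not_lt.1 hk]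
      have := runStart_lt hj; omega
  · omega
  · rcases Nat.eq_or_lt_of_le (Nat.succ_le_of_lt h) with h | h
    · rw [Nat.succ_eq_add_one] at h; rw [h] at h2; omega
    · have := runStart_strictMono h hj.le; rw [Nat.succ_eq_add_one] at this; omega

theorem getD_eq_of_run {k p : ℕ} (h1 : runStart B k ≤ p)
    (h2 : p < runStart B (k + 1)) : B.getD p 0 = B.getD (runStart B k) 0 := by
  have hle : runStart B (k + 1) ≤ B.length := by
    rcases Nat.lt_or_ge (k + 1) (runStarts B).length with h | h
    · exact (runStart_lt h).le
    · simp [runStart, h]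
  induction p, h1 using Nat.le_induction with
  | base => rfl
  | succ p hp ih =>
    rw [getD_eq_of_notMem (by omega) (notMem_runStarts (by omega) h2)]
    exact ih (by omega)

/-- No pair fits between `(c, i - 1)` and `(c, i)`, and `lf` is surjective, so no rank can be
skipped. -/
theorem lf_succ {i : ℕ} (hi : 0 < i) (hin : i < B.length)
    (h : B.getD i 0 = B.getD (i - 1) 0) : lf B i = lf B (i - 1) + 1 := by
  have h1 : lf B (i - 1) < lf B i := (lf_lt_lf_iff (by omega)).2 (by
    rw [h]; simp only [PLt, true_and]; omega)
  by_contra hc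
  have h2 : lf B (i - 1) + 1 < lf B i := by omega
  obtain ⟨p, hp, h3⟩ := exists_lf_eq (B := B) (h2.trans (lf_lt hin))
  have h4 := (lf_lt_lf_iff (p' := i) hp).1 (by rw [h3]; exact h2)
  have h5 := (lf_lt_lf_iff (B := B) (p' := p) (p := i - 1) (by omega)).1 (by omega)
  simp only [PLt] at h4 h5
  omega

theorem lf_run {k d : ℕ}
    (hd : runStart B k + d < runStart B (k + 1)) :
    lf B (runStart B k + d) = lf B (runStart B k) + d := by
  have hle : runStart B (k + 1) ≤ B.length := by
    rcases Nat.lt_or_ge (k + 1) (runStarts B).length with h | h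
    · exact (runStart_lt h).le
    · simp [runStart, h]
  induction d with
  | zero => rfl
  | succ d ih =>
    rw [lf_succ (by omega) (by omega), show runStart B k + (d + 1) - 1 = runStart B k + d by omega,
      ih (by omega)]
    · rfl
    · exact getD_eq_of_notMem (by omega) (notMem_runStarts (k := k) (by omega) hd)

/-- The pairs of symbol and start of the runs. -/
def runPair (B : List ℕ) (k : ℕ) : ℕ × ℕ := (B.getD (runStart B k) 0, runStart B k)

/-- The ranks at which the images of the sorted runs under the LF-mapping start. -/
def runImage (B : List ℕ) (l : List (ℕ × ℕ)) (k : ℕ) : ℕ :=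
  if k < l.length then rankMap B (l.getD k (0, 0)).1 (l.getD k (0, 0)).2 else B.length

/-- `l` is the sorted list of the pairs of symbol and start of the runs of `B`. -/
structure SortedRuns (B : List ℕ) (l : List (ℕ × ℕ)) : Prop where
  perm : l.Perm ((List.range (runStarts B).length).map (runPair B))
  sorted : l.Pairwise PLe

namespace SortedRuns

variable {l : List (ℕ × ℕ)}

theorem length (hl : SortedRuns B l) : l.length = (runStarts B).length := by
  rw [hl.perm.length_eq]; simp

theorem exists_sorted (hl : SortedRuns B l) {k : ℕ} (hk : k < (runStarts B).length) :
    ∃ j < (runStarts B).length, l.getD j (0, 0) = runPair B k := by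
  have : runPair B k ∈ l := hl.perm.mem_iff.2 (List.mem_map_of_mem (List.mem_range.2 hk))
  obtain ⟨j, hj, h⟩ := List.getElem_of_mem this
  exact ⟨j, by rwa [← length hl], by rw [List.getD_eq_getElem _ _ hj, h]⟩

theorem exists_run (hl : SortedRuns B l) {j : ℕ} (hj : j < (runStarts B).length) :
    ∃ k < (runStarts B).length, l.getD j (0, 0) = runPair B k := by
  have hj' : j < l.length := by rwa [length hl]
  have : l.getD j (0, 0) ∈ l := by rw [List.getD_eq_getElem _ _ hj']; exact List.getElem_mem hj'
  obtain ⟨k, hk, h⟩ := List.mem_map.1 (hl.perm.mem_iff.1 this)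
  exact ⟨k, List.mem_range.1 hk, h.symm⟩

theorem strict (hl : SortedRuns B l) {j k : ℕ} (h : j < k) (hk : k < (runStarts B).length) :
    PLt (l.getD j (0, 0)) (l.getD k (0, 0)) := by
  have hlen := length hl
  have hnd : l.Nodup := by
    refine hl.perm.nodup_iff.2 (List.nodup_range.map_on fun a ha b hb he => ?_)
    have he : runStart B a = runStart B b := congrArg Prod.snd he
    rw [List.mem_range] at ha hb
    rcases lt_trichotomy a b with h | h | h
    · have := runStart_strictMono h hb.le; omega
    · exact h
    · have := runStart_strictMono h ha.le; omega
  rw [List.getD_eq_getElem _ _ (by omega), List.getD_eq_getElem _ _ (by omega)]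
  have h1 := List.pairwise_iff_getElem.1 hl.sorted j k (by omega) (by omega) h
  have h2 : l[j] ≠ l[k] := fun he => h.ne ((hnd.getElem_inj_iff).1 he)
  have h3 : l[j].1 ≠ l[k].1 ∨ l[j].2 ≠ l[k].2 := by
    by_contra hc; push Not at hc; exact h2 (Prod.ext hc.1 hc.2)
  simp only [PLe, PLt] at *
  omega

/-- The run containing `p` has the symbol of `p` and starts no later than `p`; its pair is therefore
also below that of the `j`-th sorted run. -/
theorem exists_of_plt (hl : SortedRuns B l) {p j : ℕ} (hB : 0 < B.length) (hp : p < B.length)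
    (h : PLt (B.getD p 0, p) (l.getD j (0, 0))) :
    ∃ i < j, ∃ k < (runStarts B).length, l.getD i (0, 0) = runPair B k ∧ runStart B k ≤ p ∧
      p < runStart B (k + 1) := by
  obtain ⟨k, hk, h1, h2⟩ := Bwt.exists_run hB hp
  obtain ⟨i, hi, h3⟩ := exists_sorted hl hk
  refine ⟨i, not_le.1 fun hle => ?_, k, hk, h3, h1, h2⟩
  have h4 : ¬ PLt (l.getD i (0, 0)) (l.getD j (0, 0)) := by
    rcases Nat.eq_or_lt_of_le hle with rfl | hlt
    · simp [PLt]
    · have := strict hl hlt hi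
      simp only [PLt] at *; omega
  rw [h3, runPair, ← getD_eq_of_run h1 h2] at h4
  simp only [PLt] at *; omega

theorem runImage_eq_lf (hl : SortedRuns B l) {j k : ℕ} (hj : j < (runStarts B).length)
    (h : l.getD j (0, 0) = runPair B k) : runImage B l j = lf B (runStart B k) := by
  rw [runImage, if_pos (by rwa [length hl]), h]; rfl

theorem runImage_zero (hl : SortedRuns B l) (hB : 0 < B.length) : runImage B l 0 = 0 := by
  have h0 := runStarts_length_pos hB
  obtain ⟨k, hk, h⟩ := exists_run hl h0
  rw [runImage_eq_lf hl h0 h]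
  by_contra hc
  have hlt := lf_lt (runStart_lt hk)
  obtain ⟨p, hp, he⟩ := exists_lf_eq hB
  have := (lf_lt_lf_iff (p' := runStart B k) hp).1 (by omega)
  obtain ⟨i, hi, _⟩ := exists_of_plt hl hB hp (j := 0) (by rw [h]; exact this)
  omega

/-- The images of the sorted runs follow each other without gaps, so they can be computed as partial
sums of run lengths. A rank between the image of the last position `e` of the run and the next image
would come from a position in one of the runs sorted up to `j`, but with a pair above that of `e`,
which is impossible. -/
theorem runImage_succ (hl : SortedRuns B l) (hB : 0 < B.length) {j k : ℕ} (hj : j < (runStarts B).length)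
    (hk : k < (runStarts B).length) (h : l.getD j (0, 0) = runPair B k) :
    runImage B l (j + 1) = runImage B l j + (runStart B (k + 1) - runStart B k) := by
  have hlen := length hl
  have hlt := runStart_strictMono (Nat.lt_succ_self k) hk
  have hle : runStart B (k + 1) ≤ B.length := by
    rcases Nat.lt_or_ge (k + 1) (runStarts B).length with h | h
    · exact (runStart_lt h).le
    · simp [runStart, h]
  rw [Nat.succ_eq_add_one] at hlt
  set e := runStart B (k + 1) - 1 with he
  have hx : lf B e = runImage B l j + (e - runStart B k) := by
    have := lf_run (B := B) (k := k) (d := e - runStart B k) (by omega)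
    rw [runImage_eq_lf hl hj h, ← this]
    congr 1; omega
  have hBe : B.getD e 0 = B.getD (runStart B k) 0 := getD_eq_of_run (by omega) (by omega)
  have hup : lf B e < runImage B l (j + 1) := by
    rw [runImage]
    split_ifs with hc
    · rw [lf_lt_rankMap_iff (by omega), hBe]
      have h1 := strict hl (Nat.lt_succ_self j) (by omega)
      obtain ⟨k', hk', h2⟩ := exists_run hl (j := j + 1) (by omega)
      rw [Nat.succ_eq_add_one, h, h2] at h1
      rw [h2]
      simp only [PLt, runPair] at *
      have : runStart B k < runStart B k' → e < runStart B k' := by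
        intro h3
        rcases Nat.lt_or_ge k k' with h4 | h4
        · rcases Nat.eq_or_lt_of_le (Nat.succ_le_of_lt h4) with h5 | h5
          · rw [Nat.succ_eq_add_one] at h5; rw [← h5]; omega
          · have := runStart_strictMono h5 hk'.le
            rw [Nat.succ_eq_add_one] at this; omega
        · rcases Nat.eq_or_lt_of_le h4 with rfl | h5
          · omega
          · have := runStart_strictMono h5 hk.le; omega
      omega
    · exact lf_lt (by omega)
  have hlast : runImage B l (j + 1) ≤ lf B e + 1 := by
    by_contra hc
    have hc : lf B e + 1 < runImage B l (j + 1) := not_le.1 hc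
    have hFn : runImage B l (j + 1) ≤ B.length := by
      rw [runImage]; split_ifs
      · exact rankMap_le _ _
      · exact le_rfl
    obtain ⟨p, hp, h3⟩ := exists_lf_eq (B := B) (hc.trans_le hFn)
    rw [Set.mem_Iio] at hp
    have h4 := (lf_lt_lf_iff (B := B) (p' := p) (p := e) (by omega)).1 (by omega)
    rw [hBe] at h4
    have : ∃ i ≤ j, ∃ k < (runStarts B).length, l.getD i (0, 0) = runPair B k ∧
        runStart B k ≤ p ∧ p < runStart B (k + 1) := by
      rw [runImage] at hc
      split_ifs at hc with hj1
      · rw [← h3, lf_lt_rankMap_iff hp] at hc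
        obtain ⟨i, hi, h5⟩ := exists_of_plt hl hB hp hc
        exact ⟨i, by omega, h5⟩
      · obtain ⟨k, hk, h1, h2⟩ := Bwt.exists_run hB hp
        obtain ⟨i, hi, h3⟩ := exists_sorted hl hk
        exact ⟨i, by omega, k, hk, h3, h1, h2⟩
    obtain ⟨i, hi, k', hk', h5, h6, h7⟩ := this
    have h8 := getD_eq_of_run h6 h7
    rcases Nat.eq_or_lt_of_le hi with rfl | hi
    · rw [h5] at h
      have h9 : runStart B k' = runStart B k := congrArg Prod.snd h
      have : k' = k := by
        rcases lt_trichotomy k' k with h | h | h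
        · have := runStart_strictMono h hk.le; omega
        · exact h
        · have := runStart_strictMono h hk'.le; omega
      subst this
      rw [h8] at h4
      simp only [PLt] at h4; omega
    · have h9 := strict hl hi hj
      rw [h5, h] at h9
      rw [h8] at h4
      simp only [PLt, runPair] at h4 h9
      have : k' < k := by
        by_contra hcc
        rcases Nat.eq_or_lt_of_le (not_lt.1 hcc) with rfl | hcc
        · omega
        · have := runStart_strictMono hcc hk'.le; omega
      rcases Nat.eq_or_lt_of_le (Nat.succ_le_of_lt this) with h10 | h10
      · rw [Nat.succ_eq_add_one] at h10; rw [h10] at h7; omega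
      · have := runStart_strictMono h10 hk.le; rw [Nat.succ_eq_add_one] at this; omega
  omega

theorem pieces (hl : SortedRuns B l) (hB : 0 < B.length) :
    Pieces B.length (runStarts B).length (fstSym B) (psi B) (runImage B l) where
  zero := runImage_zero hl hB
  last := by simp [runImage, length hl]
  mono := by
    intro j k hjk hk
    induction k, hjk using Nat.le_induction with
    | base => rfl
    | succ k _ ih =>
      obtain ⟨i, hi, h⟩ := exists_run hl (j := k) (by omega)
      rw [runImage_succ hl hB (by omega) hi h]
      exact (ih (by omega)).trans (Nat.le_add_right _ _)
  lt := by
    intro k hk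
    obtain ⟨i, hi, h⟩ := exists_run hl hk
    rw [runImage_eq_lf hl hk h]
    exact lf_lt (runStart_lt hi)
  step := by
    intro k hk q h1 h2
    obtain ⟨i, hi, h⟩ := exists_run hl hk
    rw [runImage_succ hl hB hk hi h] at h2
    have hF := runImage_eq_lf hl hk h
    have hpsi := psi_lf (runStart_lt hi)
    rw [hF] at h1 h2 ⊢
    obtain ⟨d, rfl⟩ := Nat.exists_eq_add_of_le h1
    have hle : runStart B (i + 1) ≤ B.length := by
      rcases Nat.lt_or_ge (i + 1) (runStarts B).length with h | h
      · exact (runStart_lt h).le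
      · simp [runStart, h]
    have hd := lf_run (B := B) (k := i) (d := d) (by omega)
    have hpsi' := psi_lf (B := B) (p := runStart B i + d) (by omega)
    rw [← hd, fstSym, fstSym, hpsi', hpsi]
    refine ⟨getD_eq_of_run (by omega) (by omega), ?_⟩
    rw [hd]; omega
  strict := fun _ _ h h' => plt_of_lt h h'

theorem psi_runImage (hl : SortedRuns B l) {j : ℕ} (hj : j < (runStarts B).length) :
    (fstSym B (runImage B l j), psi B (runImage B l j)) = l.getD j (0, 0) := by
  obtain ⟨k, hk, h⟩ := exists_run hl hj
  rw [runImage_eq_lf hl hj h, fstSym, psi_lf (runStart_lt hk), h, runPair]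

end SortedRuns

/-! ### Iterating piecewise translations -/

/-- `F 0, …, F (K - 1)` are the points `h^[t] x` with `t < τ` and `x ∈ L`, in increasing order, and
`F K = n`. -/
structure SortedPoints (n K τ : ℕ) (h : ℕ → ℕ) (L : Set ℕ) (F : ℕ → ℕ) : Prop where
  zero : F 0 = 0
  last : F K = n
  mono : ∀ j k, j ≤ k → k ≤ K → F j ≤ F k
  lt : ∀ k < K, F k < n
  surj : ∀ t < τ, ∀ x ∈ L, ∃ k < K, F k = h^[t] x

/-- The first components of a list, followed by `n`. -/
def pointFun (l : List (ℕ × ℕ)) (n k : ℕ) : ℕ := if k < l.length then (l.getD k (0, 0)).1 else n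

/-- The index `m` encodes the source `m / τ` and the exponent `m % τ`. Repeated points are kept and
give empty pieces. The source 0 with exponent 0 ensures that the smallest point is 0. -/
theorem sortedPoints_of_perm {n K τ : ℕ} {h src : ℕ → ℕ} {l : List (ℕ × ℕ)} (hτ : 0 < τ)
    (hK : 0 < K) (h0 : src 0 = 0) (hsrc : ∀ k < K, src k < n) (hh : ∀ x < n, h x < n)
    (hl : l.Perm ((List.range (K * τ)).map fun m => (h^[m % τ] (src (m / τ)), 0)))
    (hs : l.Pairwise PLe) :
    SortedPoints n (K * τ) τ h {x | ∃ k < K, x = src k} (pointFun l n) := by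
  have hlen : l.length = K * τ := by rw [hl.length_eq]; simp
  have hit : ∀ t x, x < n → h^[t] x < n := by
    intro t
    induction t with
    | zero => exact fun x hx => hx
    | succ t ih => exact fun x hx => ih _ (hh x hx)
  have hmem : ∀ k < K * τ, ∃ m < K * τ, l.getD k (0, 0) = (h^[m % τ] (src (m / τ)), 0) := by
    intro k hk
    have hk' : k < l.length := by omega
    have : l.getD k (0, 0) ∈ l := by rw [List.getD_eq_getElem _ _ hk']; exact List.getElem_mem hk'
    obtain ⟨m, hm, he⟩ := List.mem_map.1 (hl.mem_iff.1 this)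
    exact ⟨m, List.mem_range.1 hm, he.symm⟩
  have hlt : ∀ k < K * τ, pointFun l n k < n := by
    intro k hk
    obtain ⟨m, hm, he⟩ := hmem k hk
    rw [pointFun, if_pos (by omega), he]
    exact hit _ _ (hsrc _ (Nat.div_lt_of_lt_mul (by rwa [mul_comm])))
  have hmono : ∀ j k, j ≤ k → k ≤ K * τ → pointFun l n j ≤ pointFun l n k := by
    intro j k hjk hk
    rcases Nat.eq_or_lt_of_le hk with rfl | hk
    · rcases Nat.eq_or_lt_of_le hjk with rfl | hjk
      · exact le_rfl
      · rw [pointFun.eq_1 _ _ (K * τ), if_neg (by omega)]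
        exact (hlt j hjk).le
    rcases Nat.eq_or_lt_of_le hjk with rfl | hjk
    · exact le_rfl
    rw [pointFun, pointFun, if_pos (by omega), if_pos (by omega),
      List.getD_eq_getElem _ _ (by omega), List.getD_eq_getElem _ _ (by omega)]
    have := List.pairwise_iff_getElem.1 hs j k (by omega) (by omega) hjk
    simp only [PLe, PLt] at this; omega
  have hsurj : ∀ t < τ, ∀ x ∈ {x | ∃ k < K, x = src k},
      ∃ k < K * τ, pointFun l n k = h^[t] x := by
    rintro t ht x ⟨k, hk, rfl⟩
    have hm : k * τ + t < K * τ := by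
      have : (k + 1) * τ ≤ K * τ := Nat.mul_le_mul_right _ hk
      rw [add_mul] at this; omega
    have : (h^[t] (src k), 0) ∈ l := hl.mem_iff.2 (List.mem_map.2 ⟨k * τ + t, List.mem_range.2 hm, by
      rw [mul_comm k, Nat.mul_add_mod, Nat.mod_eq_of_lt ht, Nat.mul_add_div hτ, Nat.div_eq_of_lt ht, add_zero]⟩)
    obtain ⟨j, hj, he⟩ := List.getElem_of_mem this
    refine ⟨j, by omega, ?_⟩
    rw [pointFun, if_pos hj, List.getD_eq_getElem _ _ hj, he]
  refine ⟨?_, by simp [pointFun, hlen], hmono, hlt, hsurj⟩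
  obtain ⟨k, hk, he⟩ := hsurj 0 hτ (src 0) ⟨0, hK, rfl⟩
  have := hmono 0 k (Nat.zero_le _) hk.le
  rw [he] at this
  simpa [h0] using this

/-- Strictly between two consecutive points there is no `h^[t] x`, so `iterate_step` applies to each
rank there and its predecessor. -/
theorem SortedPoints.translate {n K τ : ℕ} {g h sym F : ℕ → ℕ} {L : Set ℕ}
    (hF : SortedPoints n K τ h L F) (hg : ∀ i < n, g i < n) (hh : ∀ i < n, h (g i) = i)
    (hs : ∀ i, 0 < i → i < n → i ∉ L → g i = g (i - 1) + 1 ∧ sym i = sym (i - 1))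
    {k q : ℕ} (hk : k < K) (h1 : F k ≤ q) (h2 : q < F (k + 1)) :
    g^[τ] q = g^[τ] (F k) + (q - F k) ∧ ∀ t < τ, sym (g^[t] q) = sym (g^[t] (F k)) := by
  have hn : F (k + 1) ≤ n := hF.last ▸ hF.mono _ _ hk le_rfl
  induction q, h1 using Nat.le_induction with
  | base => simp
  | succ q hq ih =>
    obtain ⟨e1, e2⟩ := ih (by omega)
    obtain ⟨e3, e4⟩ := iterate_step hg hh hs τ (q + 1) (by omega) (by omega) fun t ht x hx he => by
      obtain ⟨j, hj, hFj⟩ := hF.surj t ht x hx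
      rcases Nat.lt_or_ge k j with hc | hc
      · have := hF.mono (k + 1) j hc hj.le; omega
      · have := hF.mono j k hc hk.le; omega
    rw [Nat.add_sub_cancel] at e3 e4
    exact ⟨by omega, fun t ht => (e4 t ht).trans (e2 t ht)⟩

theorem Pieces.step_of_ne {n K : ℕ} {key f F : ℕ → ℕ} (h : Pieces n K key f F) {q : ℕ}
    (hqn : q < n) (hne : q ∉ {x | ∃ k < K, x = F k}) :
    f q = f (q - 1) + 1 ∧ key q = key (q - 1) := by
  obtain ⟨k, hk, h1, h2⟩ := exists_between h.zero h.last hqn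
  have h3 : F k ≠ q := fun he => hne ⟨k, hk, he.symm⟩
  obtain ⟨e1, e2⟩ := h.step k hk q h1 h2
  obtain ⟨e3, e4⟩ := h.step k hk (q - 1) (by omega) (by omega)
  exact ⟨by omega, by omega⟩

theorem label_congr {t q q' : ℕ}
    (h : ∀ k < t, fstSym B ((psi B)^[k] q) = fstSym B ((psi B)^[k] q')) :
    label B t q = label B t q' := by
  induction t generalizing q q' with
  | zero => rfl
  | succ t ih =>
    rw [label, label, show fstSym B q = fstSym B q' from h 0 (by omega)]
    rw [ih fun k hk => h (k + 1) (by omega)]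

/-- The `t` symbols that precede the rotation with rank `i`. -/
def context (B : List ℕ) : ℕ → ℕ → List ℕ
  | 0, _ => []
  | t + 1, i => B.getD ((lf B)^[t] i) 0 :: context B t i

theorem context_congr {t i i' : ℕ}
    (h : ∀ k < t, B.getD ((lf B)^[k] i) 0 = B.getD ((lf B)^[k] i') 0) :
    context B t i = context B t i' := by
  induction t with
  | zero => rfl
  | succ t ih => rw [context, context, h t (by omega), ih fun k hk => h k (by omega)]

theorem context_length (t i : ℕ) : (context B t i).length = t := by
  induction t with
  | zero => rfl
  | succ t ih => simp [context, ih]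

theorem label_lf_iterate {p : ℕ} (hp : p < B.length) (t : ℕ) :
    label B t ((lf B)^[t] p) = context B t p := by
  induction t with
  | zero => rfl
  | succ t ih =>
    rw [label, context, fstSym, Function.iterate_succ_apply', psi_lf (lf_iterate_lt hp t), ih]

/-- Makes labels computable: the label of `q` is what LF reads on the way back from `psi^[t] q`. -/
theorem context_psi_iterate {q : ℕ} (hq : q < B.length) (t : ℕ) :
    context B t ((psi B)^[t] q) = label B t q := by
  rw [← label_lf_iterate (psi_iterate_lt hq t), lf_psi_iterate hq]

/-- The pieces of the iterated inverse LF-mapping. -/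
theorem SortedRuns.iterated_pieces {l : List (ℕ × ℕ)} (hl : SortedRuns B l) (hB : 0 < B.length)
    {K τ : ℕ} {F : ℕ → ℕ}
    (hF : SortedPoints B.length K τ (lf B) {x | ∃ k < (runStarts B).length, x = runImage B l k} F) :
    Pieces B.length K (fun q => name B (label B τ q)) (psi B)^[τ] F where
  zero := hF.zero
  last := hF.last
  mono := hF.mono
  lt := hF.lt
  step := by
    intro k hk q h1 h2
    obtain ⟨e1, e2⟩ := hF.translate (g := psi B) (sym := fstSym B) (fun i hi => psi_lt hi)
      (fun i hi => lf_psi hi) (fun i _ hin hne => (hl.pieces hB).step_of_ne hin hne) hk h1 h2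
    exact ⟨by rw [label_congr e2], e1⟩
  strict := fun _ _ h h' => plt_label_of_lt h h'

theorem context_translate {K τ : ℕ} {F : ℕ → ℕ}
    (hF : SortedPoints B.length K τ (psi B)
      {x | ∃ k < (runStarts B).length, x = runStart B k} F)
    {k i : ℕ} (hk : k < K) (h1 : F k ≤ i) (h2 : i < F (k + 1)) :
    (lf B)^[τ] i = (lf B)^[τ] (F k) + (i - F k) ∧ context B τ i = context B τ (F k) := by
  obtain ⟨e1, e2⟩ := hF.translate (g := lf B) (sym := fun i => B.getD i 0) (fun i hi => lf_lt hi)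
    (fun i hi => psi_lf hi) (fun i h0 hin hne => by
      have : B.getD i 0 = B.getD (i - 1) 0 := getD_eq_of_notMem hin fun hm => by
        obtain ⟨k, hk, he⟩ := exists_runStart_eq hm
        exact hne ⟨k, hk, he.symm⟩
      exact ⟨lf_succ h0 hin this, this⟩) hk h1 h2
  exact ⟨e1, context_congr e2⟩

end Bwt

/-! ## Suffix ranks and the Burrows-Wheeler transform -/

namespace Bwt

open WordRAM

variable {S : List ℕ}

theorem drop_injective {i j : ℕ} (hi : i < S.length) (hj : j < S.length)
    (h : S.drop i = S.drop j) : i = j := by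
  have := congrArg List.length h
  simp only [List.length_drop] at this
  omega

theorem suffixArray_perm : (suffixArray S).Perm (List.range S.length) := List.mergeSort_perm _ _

theorem suffixArray_length : (suffixArray S).length = S.length := by
  rw [suffixArray_perm.length_eq, List.length_range]

theorem bwt_length : (bwt S).length = S.length := by
  rw [bwt, List.length_map, suffixArray_length]

theorem suffixArray_pairwise : (suffixArray S).Pairwise fun i j => S.drop i ≤ S.drop j := by
  have := List.pairwise_mergeSort (le := fun i j => decide (S.drop i ≤ S.drop j))
    (fun a b c h1 h2 => by simp only [decide_eq_true_eq] at *; exact le_trans h1 h2)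
    (fun a b => by simpa using le_total (S.drop a) (S.drop b)) (List.range S.length)
  simpa [suffixArray] using this

theorem suffixArray_getElem_lt {k : ℕ} (hk : k < (suffixArray S).length) :
    (suffixArray S)[k] < S.length := by
  have : (suffixArray S)[k] ∈ suffixArray S := List.getElem_mem hk
  simpa using suffixArray_perm.mem_iff.1 this

theorem suffixArray_lt_iff {j k : ℕ} (hj : j < (suffixArray S).length)
    (hk : k < (suffixArray S).length) :
    S.drop (suffixArray S)[j] < S.drop (suffixArray S)[k] ↔ j < k := by
  have hle : ∀ {a b : ℕ} (ha : a < (suffixArray S).length) (hb : b < (suffixArray S).length),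
      a < b → S.drop (suffixArray S)[a] < S.drop (suffixArray S)[b] := by
    intro a b ha hb hab
    refine lt_of_le_of_ne (List.pairwise_iff_getElem.1 suffixArray_pairwise a b ha hb hab)
      fun he => ?_
    have h1 := drop_injective (suffixArray_getElem_lt ha) (suffixArray_getElem_lt hb) he
    have hnd : (suffixArray S).Nodup := suffixArray_perm.nodup_iff.2 List.nodup_range
    exact hab.ne ((hnd.getElem_inj_iff).1 h1)
  rcases lt_trichotomy j k with h | rfl | h
  · exact iff_of_true (hle hj hk h) h
  · simp
  · exact iff_of_false (hle hk hj h).asymm h.asymm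

theorem suffixRank_suffixArray {k : ℕ} (hk : k < (suffixArray S).length) :
    suffixRank S (S.drop (suffixArray S)[k]) = k := by
  rw [suffixRank]
  conv_rhs => rw [← Finset.card_range k]
  symm
  refine Finset.card_bij (fun j _ => (suffixArray S).getD j 0) ?_ ?_ ?_
  · intro j hj
    have hjk := Finset.mem_range.1 hj
    have hj' : j < (suffixArray S).length := hjk.trans hk
    simp only [List.getD_eq_getElem _ _ hj']
    exact Finset.mem_filter.2 ⟨Finset.mem_range.2 (suffixArray_getElem_lt hj'),
      (suffixArray_lt_iff hj' hk).2 hjk⟩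
  · intro a ha b hb he
    have ha' : a < (suffixArray S).length := (Finset.mem_range.1 ha).trans hk
    have hb' : b < (suffixArray S).length := (Finset.mem_range.1 hb).trans hk
    simp only [List.getD_eq_getElem _ _ ha', List.getD_eq_getElem _ _ hb'] at he
    have hnd : (suffixArray S).Nodup := suffixArray_perm.nodup_iff.2 List.nodup_range
    exact (hnd.getElem_inj_iff).1 he
  · intro j hj
    obtain ⟨h1, h2⟩ := Finset.mem_filter.1 hj
    have : j ∈ suffixArray S := suffixArray_perm.mem_iff.2 (List.mem_range.2 (Finset.mem_range.1 h1))
    obtain ⟨i, hi, rfl⟩ := List.getElem_of_mem this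
    exact ⟨i, Finset.mem_range.2 ((suffixArray_lt_iff hi hk).1 h2), List.getD_eq_getElem _ _ hi⟩

theorem exists_suffixArray_eq {j : ℕ} (hj : j < S.length) :
    ∃ k, ∃ hk : k < (suffixArray S).length, (suffixArray S)[k] = j ∧
      suffixRank S (S.drop j) = k := by
  have : j ∈ suffixArray S := suffixArray_perm.mem_iff.2 (List.mem_range.2 hj)
  obtain ⟨k, hk, rfl⟩ := List.getElem_of_mem this
  exact ⟨k, hk, rfl, suffixRank_suffixArray hk⟩

theorem suffixRank_lt {j : ℕ} (hj : j < S.length) : suffixRank S (S.drop j) < S.length := by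
  obtain ⟨k, hk, _, h⟩ := exists_suffixArray_eq hj
  rwa [h, ← suffixArray_length]

theorem suffixRank_le {P : List ℕ} : suffixRank S P ≤ S.length :=
  (Finset.card_filter_le _ _).trans (Finset.card_range _).le

theorem bwt_suffixRank {j : ℕ} (hj : j < S.length) :
    (bwt S).getD (suffixRank S (S.drop j)) 0 =
      S.getD (if j = 0 then S.length - 1 else j - 1) 0 := by
  obtain ⟨k, hk, h1, h2⟩ := exists_suffixArray_eq hj
  rw [h2, List.getD_eq_getElem _ _ (by rwa [bwt_length, ← suffixArray_length])]
  simp only [bwt, List.getElem_map, h1]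

theorem suffixRank_lt_suffixRank_iff {j : ℕ} (hj : j < S.length) (P : List ℕ) :
    suffixRank S (S.drop j) < suffixRank S P ↔ S.drop j < P := by
  constructor
  · intro h
    by_contra hc
    refine absurd h (not_lt.2 (Finset.card_le_card (Finset.monotone_filter_right _ ?_)))
    exact fun i _ hi => hi.trans_le (not_lt.1 hc)
  · intro h
    refine Finset.card_lt_card (Finset.ssubset_iff_subset_ne.2
      ⟨Finset.monotone_filter_right _ fun i _ hi => hi.trans h, fun he => ?_⟩)
    have : j ∈ (Finset.range S.length).filter fun i => S.drop i < P :=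
      Finset.mem_filter.2 ⟨Finset.mem_range.2 hj, h⟩
    rw [← he] at this
    exact lt_irrefl _ (Finset.mem_filter.1 this).2

theorem text_pos (hS : IsText S) : 0 < S.length := by
  obtain ⟨T, rfl, _⟩ := hS; simp

theorem text_last (hS : IsText S) : S.getD (S.length - 1) 0 = 0 := by
  obtain ⟨T, rfl, _⟩ := hS; simp

theorem text_symbol_pos (hS : IsText S) {j : ℕ} (hj : j + 1 < S.length) : 0 < S.getD j 0 := by
  obtain ⟨T, rfl, h⟩ := hS
  rw [List.length_append, List.length_singleton] at hj
  have hj' : j < T.length := by omega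
  rw [List.getD_append _ _ _ _ hj', List.getD_eq_getElem _ _ hj']
  exact h _ (List.getElem_mem _)

theorem drop_eq_getD_cons {j : ℕ} (hj : j < S.length) :
    S.drop j = S.getD j 0 :: S.drop (j + 1) := by
  rw [List.getD_eq_getElem _ _ hj, List.drop_eq_getElem_cons hj]

/-- Send `j` to the rank of the suffix that follows cyclically, where the transform has the symbol
`S[j]`; comparing `S.drop j` with `c :: P` means comparing first this symbol and then this rank. The
cyclic successor is wrong only for the last position, but there the symbol 0 < `c` decides before
the ranks matter. -/
theorem suffixRank_cons (hS : IsText S) {c : ℕ} (hc : 0 < c) (P : List ℕ) :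
    suffixRank S (c :: P) = rankMap (bwt S) c (suffixRank S P) := by
  have hpos := text_pos hS
  rw [suffixRank, rankMap, bwt_length]
  have hsym : ∀ j < S.length,
      (bwt S).getD (suffixRank S (S.drop ((j + 1) % S.length))) 0 = S.getD j 0 := by
    intro j hj
    rw [bwt_suffixRank (Nat.mod_lt _ hpos)]
    congr 1
    rcases Nat.lt_or_ge (j + 1) S.length with h | h
    · rw [Nat.mod_eq_of_lt h]; simp
    · obtain h : j + 1 = S.length := by omega
      rw [h, Nat.mod_self]; simp; omega
  have hiff : ∀ j < S.length, S.drop j < c :: P ↔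
      PLt ((bwt S).getD (suffixRank S (S.drop ((j + 1) % S.length))) 0,
        suffixRank S (S.drop ((j + 1) % S.length))) (c, suffixRank S P) := by
    intro j hj
    rw [hsym j hj, drop_eq_getD_cons hj, List.cons_lt_cons_iff]
    simp only [PLt]
    rw [suffixRank_lt_suffixRank_iff (Nat.mod_lt _ hpos)]
    rcases Nat.lt_or_ge (j + 1) S.length with h | h
    · rw [Nat.mod_eq_of_lt h]
    · have h : j = S.length - 1 := by omega
      have := text_last hS
      rw [← h] at this
      rw [this]; simp [hc]
  refine Finset.card_bij (fun j _ => suffixRank S (S.drop ((j + 1) % S.length))) ?_ ?_ ?_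
  · intro j hj
    obtain ⟨h1, h2⟩ := Finset.mem_filter.1 hj
    exact Finset.mem_filter.2 ⟨Finset.mem_range.2 (suffixRank_lt (Nat.mod_lt _ hpos)),
      (hiff j (Finset.mem_range.1 h1)).1 h2⟩
  · intro a ha b hb he
    have ha' := Finset.mem_range.1 (Finset.mem_filter.1 ha).1
    have hb' := Finset.mem_range.1 (Finset.mem_filter.1 hb).1
    obtain ⟨k, hk, h1, h2⟩ := exists_suffixArray_eq (Nat.mod_lt (a + 1) hpos)
    obtain ⟨k', hk', h1', h2'⟩ := exists_suffixArray_eq (Nat.mod_lt (b + 1) hpos)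
    have hkk : k = k' := by rw [← h2, ← h2']; exact he
    subst hkk
    have hmod := h1.symm.trans h1'
    rcases Nat.lt_or_ge (a + 1) S.length with h | h
    · rw [Nat.mod_eq_of_lt h] at hmod
      rcases Nat.lt_or_ge (b + 1) S.length with h' | h'
      · rw [Nat.mod_eq_of_lt h'] at hmod; omega
      · rw [show b + 1 = S.length by omega, Nat.mod_self] at hmod; omega
    · rw [show a + 1 = S.length by omega, Nat.mod_self] at hmod
      rcases Nat.lt_or_ge (b + 1) S.length with h' | h'
      · rw [Nat.mod_eq_of_lt h'] at hmod; omega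
      · omega
  · intro p hp
    obtain ⟨h1, h2⟩ := Finset.mem_filter.1 hp
    have hp' : p < (suffixArray S).length := by rw [suffixArray_length]; exact Finset.mem_range.1 h1
    have hlt := suffixArray_getElem_lt hp'
    set x := (suffixArray S)[p] with hx
    obtain ⟨j, hj, hjx⟩ : ∃ j < S.length, (j + 1) % S.length = x := by
      rcases Nat.eq_zero_or_pos x with h | h
      · exact ⟨S.length - 1, by omega, by
          rw [Nat.sub_add_cancel hpos, Nat.mod_self, h]⟩
      · exact ⟨x - 1, by omega, by rw [Nat.sub_add_cancel h, Nat.mod_eq_of_lt hlt]⟩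
    have hr : suffixRank S (S.drop ((j + 1) % S.length)) = p := by
      rw [hjx, hx]; exact suffixRank_suffixArray hp'
    refine ⟨j, Finset.mem_filter.2 ⟨Finset.mem_range.2 hj, (hiff j hj).2 ?_⟩, hr⟩
    rw [hr]; exact h2

/-- The last suffix `[0]` is the least nonempty string. This provides the first sample, with rank 0
in both strings. -/
theorem suffixRank_last (hS : IsText S) (S' : List ℕ) :
    suffixRank S' (S.drop (S.length - 1)) = 0 := by
  have h1 : S.drop (S.length - 1) = [0] := by
    obtain ⟨T, rfl, _⟩ := hS; simp
  rw [h1, suffixRank, Finset.card_eq_zero, Finset.filter_eq_empty_iff]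
  intro j hj
  rw [drop_eq_getD_cons (Finset.mem_range.1 hj), List.cons_lt_cons_iff]
  simp

theorem bwt_symbol {j : ℕ} (hj : j + 1 < S.length) :
    (bwt S).getD (suffixRank S (S.drop (j + 1))) 0 = S.getD j 0 := by
  rw [bwt_suffixRank hj]; simp

theorem lf_suffixRank (hS : IsText S) {j : ℕ} (hj : j + 1 < S.length) :
    lf (bwt S) (suffixRank S (S.drop (j + 1))) = suffixRank S (S.drop j) := by
  rw [lf, bwt_symbol hj, ← suffixRank_cons hS (text_symbol_pos hS hj),
    ← drop_eq_getD_cons (by omega)]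

theorem rankMap_suffixRank (hS : IsText S) {S' : List ℕ} (hS' : IsText S') {j : ℕ}
    (hj : j + 1 < S.length) :
    rankMap (bwt S') ((bwt S).getD (suffixRank S (S.drop (j + 1))) 0)
      (suffixRank S' (S.drop (j + 1))) = suffixRank S' (S.drop j) := by
  rw [bwt_symbol hj, ← suffixRank_cons hS' (text_symbol_pos hS hj),
    ← drop_eq_getD_cons (by omega)]

theorem psi_suffixRank (hS : IsText S) {j : ℕ} (hj : j + 1 < S.length) :
    psi (bwt S) (suffixRank S (S.drop j)) = suffixRank S (S.drop (j + 1)) := by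
  rw [← lf_suffixRank hS hj, psi_lf]
  rw [bwt_length]; exact suffixRank_lt hj

theorem lf_iterate_suffixRank (hS : IsText S) {j t : ℕ} (hj : j + t < S.length) :
    (lf (bwt S))^[t] (suffixRank S (S.drop (j + t))) = suffixRank S (S.drop j) := by
  induction t generalizing j with
  | zero => rfl
  | succ t ih =>
    rw [Function.iterate_succ_apply, ← add_assoc, lf_suffixRank hS (by omega)]
    exact ih (by omega)

/-- The context read in `S` is the block of symbols between positions `j` and `j + t`; prepending it
in `S'` is one block step of the construction. -/
theorem rankList_context_suffixRank (hS : IsText S) {S' : List ℕ} (hS' : IsText S') {j t : ℕ}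
    (hj : j + t < S.length) :
    rankList (bwt S') (context (bwt S) t (suffixRank S (S.drop (j + t))))
      (suffixRank S' (S.drop (j + t))) = suffixRank S' (S.drop j) := by
  induction t generalizing j with
  | zero => rfl
  | succ t ih =>
    have h1 := ih (j := j + 1) (by omega)
    rw [show j + 1 + t = j + (t + 1) by ring] at h1
    have h2 := lf_iterate_suffixRank hS (j := j + 1) (t := t) (by omega)
    rw [show j + 1 + t = j + (t + 1) by ring] at h2
    rw [context, rankList, h1, h2, rankMap_suffixRank hS hS' (by omega)]

end Bwt

/-! ## Programs for the LF-mapping, its inverse, and ranks -/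

namespace WordRAM

open WordRAM.Expr WordRAM.Prog Bwt

/-- The tables for a piecewise translation. -/
structure RankDS (mem : ℕ → ℕ) (aB aF n K : ℕ) (key f F : ℕ → ℕ) : Prop where
  pieces : Pieces n K key f F
  tabB : Table mem aB K fun k => (key (F k), f (F k))
  tabF : Table mem aF K fun k => (F k, f (F k))
  sentinel : mem (aF + 2 * K) = n

theorem RankDS.mem_F {mem : ℕ → ℕ} {aB aF n K : ℕ} {key f F : ℕ → ℕ}
    (h : RankDS mem aB aF n K key f F) {k : ℕ} (hk : k ≤ K) : mem (aF + 2 * k) = F k := by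
  rcases hk.lt_or_eq with hk | rfl
  · exact (h.tabF k hk).1
  · rw [h.sentinel, h.pieces.last]

theorem RankDS.congr {mem mem' : ℕ → ℕ} {aB aF n K : ℕ} {key f F : ℕ → ℕ}
    (h : RankDS mem aB aF n K key f F)
    (hB : ∀ a, aB ≤ a → a < aB + 2 * K → mem' a = mem a)
    (hF : ∀ a, aF ≤ a → a ≤ aF + 2 * K → mem' a = mem a) :
    RankDS mem' aB aF n K key f F :=
  ⟨h.pieces, h.tabB.congr hB, h.tabF.congr fun a h1 h2 => hF a h1 h2.le,
    (hF _ (by omega) (by omega)).trans h.sentinel⟩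

/-- The rank of the pair in the registers `73`, `74`: the registers `70`, `71` hold the base
addresses of the tables, register `72` the number of pieces; the result is in register `75`. -/
def rankStep : Prog :=
  -- The second component is `i + 1`, so that a piece whose first pair is exactly `(c, i)` is
  -- counted, as `Pieces.rank_eq` requires.
  (assign 80 (reg 70) ;; assign 81 (reg 72) ;; assign 82 (reg 73) ;; assign 83 (reg 74 + 1)) ;;
  search ;;
  -- The end of the last counted piece is the default answer; if all pieces are counted, it is the
  -- sentinel. A last piece with key `c` may lower it.
  (assign 75 (load (reg 71 + 2 * reg 84)) ;;
   ite (reg 84)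
     (ite (eq (load (reg 70 + 2 * (reg 84 - 1))) (reg 73))
       (assign 76 (load (reg 71 + 2 * (reg 84 - 1)) +
          (reg 74 - load (reg 70 + 2 * (reg 84 - 1) + 1))) ;;
        ite (lt (reg 76) (reg 75)) (assign 75 (reg 76)) skip)
       skip)
     skip)

theorem runs_rankStep {E : Env} {s : NatState} {Q : NatState → Prop} {n K g : ℕ}
    {key f F : ℕ → ℕ} (hds : RankDS s.mem (s.reg 70) (s.reg 71) n K key f F) (hK : s.reg 72 = K)
    (hi : s.reg 74 ≤ n) (hgn : g ≤ n)
    (hg : ∀ q < n, q < g ↔ PLt (key q, f q) (s.reg 73, s.reg 74))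
    (hN : s.reg 70 + 2 * K ≤ E.N) (hN' : s.reg 71 + 2 * K < E.N) (hM : 4 * E.N + 4 * n + 10 ≤ E.M)
    (hQ : ∀ s', s'.mem = s.mem → (∀ x < 75, s'.reg x = s.reg x) → s'.reg 75 = g →
      s'.clk ≤ s.clk + (searchCost K + 100) → Q s') :
    Runs E rankStep s Q := by
  refine Runs.block ?_
  simp [wp]
  split_ands <;> try omega
  refine Runs.seq (runs_search (n := K) (g := fun k => (key (F k), f (F k)))
    (by simpa using hds.tabB) (by simpa using hK) ?_ (by simpa using hN) (by omega) ?_)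
  · intro j k hjk hk h
    rcases (hds.pieces.mono j k hjk.le hk.le).lt_or_eq with h1 | h1
    · have := hds.pieces.strict _ _ h1 (hds.pieces.lt k hk)
      simp only [PLt] at *; omega
    · simp only [h1]; exact h
  intro s' hm hf hle hcnt hclk
  simp at hcnt hclk hm
  have hr := hds.pieces.rank_eq hgn hg hle hcnt
  have hf' : ∀ x < 80, s'.reg x = s.reg x := fun x hx => by
    rw [hf x (by omega)]; simp (disch := omega) [Function.update_of_ne]
  obtain ⟨cnt, h84⟩ : ∃ c, s'.reg 84 = c := ⟨_, rfl⟩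
  rw [h84] at hle hr
  have hFc := hds.mem_F hle
  have hfin : ∀ s'' : NatState, s''.mem = s.mem → (∀ x < 75, s''.reg x = s.reg x) →
      s''.reg 75 = g → s''.clk ≤ s'.clk + 70 → Q s'' := fun s'' h1 h2 h3 h4 =>
    hQ s'' h1 h2 h3 (by omega)
  refine Runs.of_wp ?_
  rcases Nat.eq_zero_or_pos cnt with rfl | h0
  · simp [wp, hf', hm, h84]
    split_ands <;> try omega
    refine hfin _ rfl (fun x hx => ?_) ?_ ?_
    · simp (disch := omega) [Function.update_of_ne, hf']
    · simpa [hr] using hFc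
    · simp
  · obtain ⟨hB1, hB2⟩ := hds.tabB (cnt - 1) (by omega)
    have hF1 := hds.mem_F (k := cnt - 1) (by omega)
    have hlt := hds.pieces.lt (cnt - 1) (by omega)
    simp [wp, hf', hm, h84, hFc, hB1, hB2, hF1, h0.ne']
    split_ands <;> try omega
    · intro hk
      obtain ⟨h1, h2⟩ := hr.2 h0 hk
      split_ands <;> try omega
      · intro h3
        refine hfin _ rfl (fun x hx => ?_) ?_ ?_
        · simp (disch := omega) [Function.update_of_ne, hf']
        · simp; omega
        · simp
      · intro h3
        refine hfin _ rfl (fun x hx => ?_) ?_ ?_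
        · simp (disch := omega) [Function.update_of_ne, hf']
        · simp; omega
        · simp
    · intro hk
      refine hfin _ rfl (fun x hx => ?_) ?_ ?_
      · simp (disch := omega) [Function.update_of_ne, hf']
      · simp [hr.1 (.inr hk)]
      · simp

/-- The inverse translation of `reg 74`: register `71` holds the base address of the table of the
pieces, register `72` their number; the result is in register `75`. -/
def psiStep : Prog :=
  -- Against the pair `(i + 1, 0)` the second components never matter: the search counts the pieces
  -- that start at or before `i`.
  (assign 80 (reg 71) ;; assign 81 (reg 72) ;; assign 82 (reg 74 + 1) ;; assign 83 0) ;;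
  search ;;
  assign 75 (load (reg 71 + 2 * (reg 84 - 1) + 1) + (reg 74 - load (reg 71 + 2 * (reg 84 - 1))))

theorem runs_psiStep {E : Env} {s : NatState} {Q : NatState → Prop} {n K aB : ℕ}
    {key f F : ℕ → ℕ} (hds : RankDS s.mem aB (s.reg 71) n K key f F) (hK : s.reg 72 = K)
    (hi : s.reg 74 < n) (hfn : f (s.reg 74) < n)
    (hN' : s.reg 71 + 2 * K < E.N) (hM : 4 * E.N + 4 * n + 10 ≤ E.M)
    (hQ : ∀ s', s'.mem = s.mem → (∀ x < 75, s'.reg x = s.reg x) → s'.reg 75 = f (s.reg 74) →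
      s'.clk ≤ s.clk + (searchCost K + 100) → Q s') :
    Runs E psiStep s Q := by
  refine Runs.block ?_
  simp [wp]
  split_ands <;> try omega
  refine Runs.seq (runs_search (n := K) (g := fun k => (F k, f (F k)))
    (by simpa using hds.tabF) (by simpa using hK) ?_ (by simp; omega) (by omega) ?_)
  · intro j k hjk hk h
    have := hds.pieces.mono j k hjk.le hk.le
    simp [PLt] at *; omega
  intro s' hm hf hle hcnt hclk
  simp at hcnt hclk hm
  have hcnt' : ∀ k < K, k < s'.reg 84 ↔ F k ≤ s.reg 74 := fun k hk => by
    rw [hcnt k hk]; simp only [PLt]; omega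
  obtain ⟨h0, h1, h2, h3⟩ := hds.pieces.locate hi hle hcnt'
  have hf' : ∀ x < 80, s'.reg x = s.reg x := fun x hx => by
    rw [hf x (by omega)]; simp (disch := omega) [Function.update_of_ne]
  obtain ⟨cnt, h84⟩ : ∃ c, s'.reg 84 = c := ⟨_, rfl⟩
  rw [h84] at hle h0 h1 h2 h3
  obtain ⟨hF1, hF2⟩ := hds.tabF (cnt - 1) (by omega)
  refine Runs.of_wp ?_
  simp [wp, hf', hm, h84, hF1, hF2]
  split_ands <;> try omega
  refine hQ _ rfl (fun x hx => ?_) ?_ ?_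
  · simp (disch := omega) [Function.update_of_ne, hf']
  · simp [h3]
  · simp; omega

/-- The tables of a string: the runs, the sorted runs, and their images under the LF-mapping. -/
structure StringDS (mem : ℕ → ℕ) (aA aB aF : ℕ) (B : List ℕ) (l : List (ℕ × ℕ)) : Prop where
  pos : 0 < B.length
  sorted : SortedRuns B l
  tabA : Table mem aA ((runStarts B).length + 1) fun k => (runStart B k, B.getD (runStart B k) 0)
  ds : RankDS mem aB aF B.length (runStarts B).length (fstSym B) (psi B) (runImage B l)

/-- The LF-mapping of `reg 74`: the registers `69`, `70`, `71`, `72` describe the tables; the symbol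
is in register `73` and the result in register `75`. -/
def lfStep : Prog :=
  (assign 80 (reg 69) ;; assign 81 (reg 72) ;; assign 82 (reg 74 + 1) ;; assign 83 0) ;;
  search ;;
  assign 73 (load (reg 69 + 2 * (reg 84 - 1) + 1)) ;;
  rankStep

theorem runs_lfStep {E : Env} {s : NatState} {Q : NatState → Prop} {B : List ℕ}
    {l : List (ℕ × ℕ)} (hds : StringDS s.mem (s.reg 69) (s.reg 70) (s.reg 71) B l)
    (hK : s.reg 72 = (runStarts B).length) (hi : s.reg 74 < B.length)
    (hN : s.reg 69 + 2 * (runStarts B).length < E.N)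
    (hN' : s.reg 70 + 2 * (runStarts B).length ≤ E.N)
    (hN'' : s.reg 71 + 2 * (runStarts B).length < E.N) (hM : 4 * E.N + 4 * B.length + 10 ≤ E.M)
    (hQ : ∀ s', s'.mem = s.mem → (∀ x < 73, s'.reg x = s.reg x) →
      s'.reg 73 = B.getD (s.reg 74) 0 → s'.reg 75 = lf B (s.reg 74) →
      s'.clk ≤ s.clk + 2 * (searchCost (runStarts B).length + 100) → Q s') :
    Runs E lfStep s Q := by
  refine Runs.block ?_
  simp [wp]
  split_ands <;> try omega
  refine Runs.seq (runs_search (n := (runStarts B).length)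
    (g := fun k => (runStart B k, B.getD (runStart B k) 0))
    (fun k hk => by simpa using hds.tabA k (by omega)) (by simpa using hK) ?_ (by simp; omega)
    (by omega) ?_)
  · intro j k hjk hk h
    have := runStart_strictMono hjk hk.le
    simp [PLt] at *; omega
  intro s' hm hf hle hcnt hclk
  simp at hcnt hclk hm
  have hf' : ∀ x < 80, s'.reg x = s.reg x := fun x hx => by
    rw [hf x (by omega)]; simp (disch := omega) [Function.update_of_ne]
  obtain ⟨cnt, h84⟩ : ∃ c, s'.reg 84 = c := ⟨_, rfl⟩
  rw [h84] at hle hcnt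
  obtain ⟨k, hk, h1, h2⟩ := exists_run hds.pos hi
  have hc : cnt = k + 1 := by
    have e1 := (hcnt k hk).2 (by simp only [PLt]; omega)
    have e2 : ¬ k + 1 < cnt := fun h => by
      have := (hcnt (k + 1) (by omega)).1 h
      simp only [PLt] at this; omega
    omega
  obtain ⟨hA1, hA2⟩ := hds.tabA k (by omega)
  refine Runs.block ?_
  simp [wp, hf', hm, h84, hc, hA2]
  split_ands <;> try omega
  have hsym : B[runStart B k]?.getD 0 = B.getD (s.reg 74) 0 := by
    rw [getD_eq_of_run h1 h2, List.getD_eq_getElem?_getD]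
  refine runs_rankStep (g := lf B (s.reg 74)) (by simpa [hf', hm] using hds.ds) (by simp [hf', hK])
    (by simp [hf']; omega) (lf_lt hi).le ?_ (by simpa [hf'] using hN') (by simpa [hf'] using hN'')
    hM fun s'' k1 k2 k3 k4 => ?_
  · intro q hq
    simp only [Function.update_self, hsym]
    rw [Function.update_of_ne (by omega), hf' 74 (by omega)]
    exact lt_rankMap_iff hq
  · simp at k1 k4
    refine hQ s'' k1 (fun x hx => ?_) ?_ k3 (by omega)
    · rw [k2 x (by omega)]; simp (disch := omega) [Function.update_of_ne, hf']
    · rw [k2 73 (by omega)]; simp only [Function.update_self, hsym]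

end WordRAM

/-! ## Construction of the tables of a string -/

namespace WordRAM

open WordRAM.Expr WordRAM.Prog Bwt

/-- Moving a table of `reg 62` pairs from `reg 60` to the higher address `reg 61`, with the first
components decreased by one. -/
def moveUp : Prog :=
  loop (reg 62)
    (assign 62 (reg 62 - 1) ;;
     store (reg 61 + 2 * reg 62) (load (reg 60 + 2 * reg 62) - 1) ;;
     store (reg 61 + 2 * reg 62 + 1) (load (reg 60 + 2 * reg 62 + 1)))

/-- Copying from the last pair to the first allows overlapping ranges, as the target is at least one
pair higher. The decrement converts the 1-based positions of the input. -/
theorem runs_moveUp {E : Env} {s₀ : NatState} {Q : NatState → Prop} {n : ℕ} {g : ℕ → ℕ × ℕ}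
    (ht : Table s₀.mem (s₀.reg 60) n fun k => ((g k).1 + 1, (g k).2)) (hn : s₀.reg 62 = n)
    (hd : s₀.reg 60 + 2 ≤ s₀.reg 61) (hN : s₀.reg 61 + 2 * n ≤ E.N) (hM : E.N + 10 ≤ E.M)
    (hQ : ∀ s', Table s'.mem (s₀.reg 61) n g →
      (∀ x, x < s₀.reg 61 ∨ s₀.reg 61 + 2 * n ≤ x → s'.mem x = s₀.mem x) →
      (∀ x < 60, s'.reg x = s₀.reg x) → s'.clk ≤ s₀.clk + 40 * n + 2 → Q s') :
    Runs E moveUp s₀ Q := by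
  refine Runs.loop_of_invariant (fun k s => k ≤ n ∧ s.reg 62 = k ∧ s.reg 60 = s₀.reg 60 ∧
      s.reg 61 = s₀.reg 61 ∧ (∀ x < 60, s.reg x = s₀.reg x) ∧
      (∀ j < n, k ≤ j → s.mem (s₀.reg 61 + 2 * j) = (g j).1 ∧
        s.mem (s₀.reg 61 + 2 * j + 1) = (g j).2) ∧
      (∀ x, x < s₀.reg 61 + 2 * k ∨ s₀.reg 61 + 2 * n ≤ x → s.mem x = s₀.mem x) ∧
      s.clk + 40 * k ≤ s₀.clk + 40 * n) ?_ ?_ n ?_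
  · rintro k s ⟨h1, h2, h3, h4, h5, h6, h7, h8⟩
    refine ⟨by simp, by simp [h2], Runs.of_wp ?_⟩
    obtain ⟨e1, e2⟩ := ht k (by omega)
    simp only [] at e1 e2
    rw [← h7 _ (by omega)] at e1 e2
    simp (disch := omega) [wp, h2, h3, h4, e1, e2, Function.update_of_ne]
    split_ands <;> try omega
    · intro x hx
      simp (disch := omega) [Function.update_of_ne, h5 x hx]
    · intro j hj hkj
      rcases Nat.eq_or_lt_of_le hkj with rfl | hlt
      · simp
      · obtain ⟨e3, e4⟩ := h6 j hj hlt
        simp (disch := omega) [Function.update_of_ne, e3, e4]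
    · intro x hx
      rw [Function.update_of_ne (by omega), Function.update_of_ne (by omega)]
      exact h7 x (by omega)
  · rintro s ⟨h1, h2, h3, h4, h5, h6, h7, h8⟩
    refine ⟨by simp, by simp [h2], hQ _ (fun j hj => h6 j hj (by omega)) h7 h5 ?_⟩
    simp; omega
  · exact ⟨le_rfl, hn, rfl, rfl, fun _ _ => rfl, fun j hj h => absurd h (by omega),
      fun _ _ => rfl, le_rfl⟩

/-- Copying the table at `reg 60` with `reg 63` entries to `reg 61` with the components
exchanged. -/
def swapLoop : Prog :=
  loop (lt (reg 65) (reg 63))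
    (store (reg 61 + 2 * reg 65) (load (reg 60 + 2 * reg 65 + 1)) ;;
     store (reg 61 + 2 * reg 65 + 1) (load (reg 60 + 2 * reg 65)) ;;
     assign 65 (reg 65 + 1))

theorem runs_swapLoop {E : Env} {s₀ : NatState} {Q : NatState → Prop} {n : ℕ} {g : ℕ → ℕ × ℕ}
    (ht : Table s₀.mem (s₀.reg 60) n g) (hn : s₀.reg 63 = n) (h0 : s₀.reg 65 = 0)
    (hd : s₀.reg 60 + 2 * n ≤ s₀.reg 61) (hN : s₀.reg 61 + 2 * n ≤ E.N) (hM : E.N + 10 ≤ E.M)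
    (hQ : ∀ s', Table s'.mem (s₀.reg 61) n (fun k => ((g k).2, (g k).1)) →
      (∀ x, x < s₀.reg 61 ∨ s₀.reg 61 + 2 * n ≤ x → s'.mem x = s₀.mem x) →
      (∀ x < 65, s'.reg x = s₀.reg x) → s'.clk ≤ s₀.clk + 40 * n + 4 → Q s') :
    Runs E swapLoop s₀ Q := by
  refine Runs.loop_of_invariant (fun k s => k ≤ n ∧ s.reg 65 = n - k ∧
      (∀ x < 65, s.reg x = s₀.reg x) ∧
      Table s.mem (s₀.reg 61) (n - k) (fun k => ((g k).2, (g k).1)) ∧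
      (∀ x, x < s₀.reg 61 ∨ s₀.reg 61 + 2 * n ≤ x → s.mem x = s₀.mem x) ∧
      s.clk + 40 * k ≤ s₀.clk + 40 * n) ?_ ?_ n ?_
  · rintro k s ⟨h1, h2, h3, h4, h5, h6⟩
    refine ⟨by simp, by simp [h2, h3, hn]; omega, Runs.of_wp ?_⟩
    obtain ⟨e1, e2⟩ := ht (n - (k + 1)) (by omega)
    rw [← h5 _ (by omega)] at e1 e2
    simp (disch := omega) [wp, h2, h3, e1, e2, Function.update_of_ne]
    split_ands <;> try omega
    · intro x hx
      simp (disch := omega) [Function.update_of_ne, h3 x hx]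
    · intro j hj
      rcases Nat.lt_or_ge j (n - (k + 1)) with hlt | hge
      · obtain ⟨e3, e4⟩ := h4 j hlt
        simp (disch := omega) [Function.update_of_ne, e3, e4]
      · obtain rfl : j = n - (k + 1) := by omega
        simp
    · intro x hx
      rw [Function.update_of_ne (by omega), Function.update_of_ne (by omega)]
      exact h5 x hx
  · rintro s ⟨h1, h2, h3, h4, h5, h6⟩
    refine ⟨by simp, by simp [h2, h3, hn], hQ _ h4 h5 h3 ?_⟩
    simp; omega
  · exact ⟨le_rfl, by omega, fun _ _ => rfl, fun j hj => by omega, fun _ _ => rfl, le_rfl⟩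

/-- Computing the images of the sorted runs: the registers `60`, `61`, `62` hold the addresses of
the tables, register `63` the number of runs. -/
def imageLoop : Prog :=
  loop (lt (reg 65) (reg 63))
    ((assign 80 (reg 60) ;; assign 81 (reg 63) ;; assign 82 (load (reg 61 + 2 * reg 65 + 1) + 1) ;;
      assign 83 0) ;;
     search ;;
     (store (reg 62 + 2 * reg 65) (reg 66) ;;
      store (reg 62 + 2 * reg 65 + 1) (load (reg 61 + 2 * reg 65 + 1)) ;;
      assign 66 (reg 66 + (load (reg 60 + 2 * reg 84) - load (reg 61 + 2 * reg 65 + 1))) ;;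
      assign 65 (reg 65 + 1)))

/-- Register `66` accumulates the run lengths in sorted order, which by `runImage_succ` gives the
images. The end of a run is found by searching its start among the unsorted runs and taking the next
entry; for the last run this is the sentinel. -/
theorem runs_imageLoop {E : Env} {s₀ : NatState} {Q : NatState → Prop} {B : List ℕ}
    {l : List (ℕ × ℕ)} (hB : 0 < B.length) (hl : SortedRuns B l)
    (hA : Table s₀.mem (s₀.reg 60) ((runStarts B).length + 1)
      fun k => (runStart B k, B.getD (runStart B k) 0))
    (ht : Table s₀.mem (s₀.reg 61) (runStarts B).length fun k => l.getD k (0, 0))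
    (hr : s₀.reg 63 = (runStarts B).length) (h65 : s₀.reg 65 = 0) (h66 : s₀.reg 66 = 0)
    (hAB : s₀.reg 60 + 2 * ((runStarts B).length + 1) ≤ s₀.reg 61)
    (hBF : s₀.reg 61 + 2 * (runStarts B).length ≤ s₀.reg 62)
    (hN : s₀.reg 62 + 2 * (runStarts B).length ≤ E.N) (hM : 4 * E.N + 4 * B.length + 10 ≤ E.M)
    (hQ : ∀ s', Table s'.mem (s₀.reg 62) (runStarts B).length
        (fun k => (runImage B l k, (l.getD k (0, 0)).2)) →
      (∀ x, x < s₀.reg 62 ∨ s₀.reg 62 + 2 * (runStarts B).length ≤ x → s'.mem x = s₀.mem x) →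
      (∀ x < 65, s'.reg x = s₀.reg x) → s'.reg 66 = B.length →
      s'.clk ≤ s₀.clk + (runStarts B).length * (searchCost (runStarts B).length + 100) + 4 → Q s') :
    Runs E imageLoop s₀ Q := by
  set r := (runStarts B).length with hrdef
  set T := searchCost r + 100 with hT
  refine Runs.loop_of_invariant (fun k s => k ≤ r ∧ s.reg 65 = r - k ∧
      s.reg 66 = runImage B l (r - k) ∧ (∀ x < 65, s.reg x = s₀.reg x) ∧
      Table s.mem (s₀.reg 62) (r - k) (fun k => (runImage B l k, (l.getD k (0, 0)).2)) ∧
      (∀ x, x < s₀.reg 62 ∨ s₀.reg 62 + 2 * r ≤ x → s.mem x = s₀.mem x) ∧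
      s.clk + k * T ≤ s₀.clk + r * T) ?_ ?_ r ?_
  · rintro k s ⟨h1, h2, h3, h4, h5, h6, h7⟩
    refine ⟨by simp, by simp [h2, h4, hr]; omega, Runs.block ?_⟩
    obtain ⟨i, hi, he⟩ := hl.exists_run (j := r - (k + 1)) (by omega)
    have e2 := (ht (r - (k + 1)) (by omega)).2
    beta_reduce at e2
    rw [← h6 _ (by omega), he] at e2
    have e2 : s.mem (s₀.reg 61 + 2 * (r - (k + 1)) + 1) = runStart B i := e2
    have hlt := runStart_lt hi
    simp [wp, h2, h4, hr, e2]
    split_ands <;> try omega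
    have hA' : Table s.mem (s₀.reg 60) (r + 1)
        fun k => (runStart B k, B.getD (runStart B k) 0) := hA.congr fun a _ _ => h6 a (by omega)
    refine Runs.seq (runs_search (n := r) (g := fun k => (runStart B k, B.getD (runStart B k) 0))
      (fun k hk => by simpa [h4] using hA' k (by omega)) (by simp) ?_ (by simp; omega)
      (by omega) ?_)
    · intro a b hab hb h
      have := runStart_strictMono hab hb.le
      simp [PLt] at *; omega
    intro s' hm hf hle hcnt hclk
    simp at hcnt hclk hm
    have hf' : ∀ x < 80, s'.reg x = s.reg x := fun x hx => by
      rw [hf x (by omega)]; simp (disch := omega) [Function.update_of_ne]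
    have h84 : s'.reg 84 = i + 1 := by
      have c1 := (hcnt i hi).2 (by simp [PLt])
      have c2 : ¬ i + 1 < s'.reg 84 := fun h => by
        have := (hcnt (i + 1) (by omega)).1 h
        have := runStart_strictMono (B := B) (Nat.lt_succ_self i) (by omega)
        simp only [PLt, Nat.succ_eq_add_one] at *; omega
      omega
    have hnext := hl.runImage_succ hB (j := r - (k + 1)) (by omega) hi he
    rw [show r - (k + 1) + 1 = r - k by omega] at hnext
    have hA1 := (hA' (i + 1) (by omega)).1
    have hmono := runStart_strictMono (B := B) (Nat.lt_succ_self i) (by omega)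
    have hFn : runImage B l (r - k) ≤ B.length := by
      have := (hl.pieces hB).mono (r - k) r (by omega) le_rfl
      rwa [(hl.pieces hB).last] at this
    simp only [Nat.succ_eq_add_one] at hmono
    refine Runs.of_wp ?_
    rw [add_mul] at h7
    simp (disch := omega) [wp, hf', h2, h3, h4, h84, hm, e2, Function.update_of_ne, hA1]
    split_ands <;> try omega
    · intro x hx
      simp (disch := omega) [Function.update_of_ne, hf', h4 x hx]
    · intro j hj
      rcases Nat.lt_or_ge j (r - (k + 1)) with hlt | hge
      · obtain ⟨e3, e4⟩ := h5 j hlt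
        simp (disch := omega) [Function.update_of_ne, e3]
        simpa using e4
      · obtain rfl : j = r - (k + 1) := by omega
        rw [List.getD_eq_getElem?_getD] at he
        simp (disch := omega) [Function.update_of_ne, he, runPair]
    · intro x hx
      rw [Function.update_of_ne (by omega), Function.update_of_ne (by omega)]
      exact h6 x hx
  · rintro s ⟨h1, h2, h3, h4, h5, h6, h7⟩
    refine ⟨by simp, by simp [h2, h4, hr], hQ _ h5 h6 h4 ?_ ?_⟩
    · simp [h3, runImage, hl.length, ← hrdef]
    · simp; omega
  · refine ⟨le_rfl, by omega, ?_, fun _ _ => rfl, fun j hj => by omega, fun _ _ => rfl, le_rfl⟩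
    rw [h66, Nat.sub_self, hl.runImage_zero hB]

/-- Construction of the tables of a string from its runs: register `60` holds the address of the
table of the runs, the registers `61`, `62` the addresses of the results, register `63` the number
of runs; register `64` points to free memory. -/
def indexString : Prog :=
  assign 65 0 ;; swapLoop ;;
  (assign 80 (reg 61) ;; assign 81 (reg 63) ;; assign 82 (reg 64)) ;; sort ;;
  (assign 65 0 ;; assign 66 0) ;; imageLoop ;;
  store (reg 62 + 2 * reg 63) (reg 66)

/-- A bound on the time of sorting. -/
def sortCost (n : ℕ) : ℕ := (Nat.log 2 n + 1) * (200 * n + 40) + 20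

theorem runs_indexString {E : Env} {s₀ : NatState} {Q : NatState → Prop} {B : List ℕ}
    (hB : 0 < B.length)
    (hA : Table s₀.mem (s₀.reg 60) ((runStarts B).length + 1)
      fun k => (runStart B k, B.getD (runStart B k) 0))
    (hr : s₀.reg 63 = (runStarts B).length)
    (hAB : s₀.reg 60 + 2 * ((runStarts B).length + 1) ≤ s₀.reg 61)
    (hBF : s₀.reg 61 + 2 * (runStarts B).length ≤ s₀.reg 62)
    (hFX : s₀.reg 62 + 2 * (runStarts B).length < s₀.reg 64)
    (hN : s₀.reg 64 + 2 * (runStarts B).length ≤ E.N) (hM : 4 * E.N + 4 * B.length + 10 ≤ E.M)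
    (hQ : ∀ s' l, StringDS s'.mem (s₀.reg 60) (s₀.reg 61) (s₀.reg 62) B l →
      (∀ x, x < s₀.reg 61 ∨ s₀.reg 62 + 2 * (runStarts B).length < x ∧ x < s₀.reg 64 →
        s'.mem x = s₀.mem x) →
      (∀ x < 65, s'.reg x = s₀.reg x) →
      s'.clk ≤ s₀.clk + sortCost (runStarts B).length +
        (runStarts B).length * (searchCost (runStarts B).length + 140) + 50 → Q s') :
    Runs E indexString s₀ Q := by
  refine Runs.block ?_
  simp [wp]
  split_ands <;> try omega
  refine Runs.seq (runs_swapLoop (n := (runStarts B).length)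
    (g := fun k => (runStart B k, B.getD (runStart B k) 0))
    (fun k hk => by simpa using hA k (by omega)) (by simpa using hr) (by simp) (by simp; omega)
    (by simp; omega) (by omega) fun s₁ h1 h2 h3 h4 => ?_)
  simp only [] at h1 h2 h4
  rw [Function.update_of_ne (by omega)] at h1 h2
  have h3 : ∀ x < 65, s₁.reg x = s₀.reg x := fun x hx => by
    rw [h3 x hx]; simp (disch := omega) [Function.update_of_ne]
  refine Runs.block ?_
  simp [wp, h3]
  refine Runs.seq (runs_sort (n := (runStarts B).length) (g := runPair B) (by omega)
    h1 (by simpa using hr) (by simp; omega) (by simp; omega)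
    fun s₂ l k1 k2 k3 k4 k5 k6 => ?_)
  simp at k3 k4 k6
  have k5 : ∀ x < 65, s₂.reg x = s₀.reg x := fun x hx => by
    rw [k5 x (by omega)]; simp (disch := omega) [Function.update_of_ne, h3 x hx]
  have hl : SortedRuns B l := ⟨k1, k2⟩
  have m2 : ∀ x, x < s₀.reg 61 ∨ s₀.reg 61 + 2 * (runStarts B).length ≤ x ∧ x < s₀.reg 64 →
      s₂.mem x = s₀.mem x := fun x hx => by
    rw [k4 x hx, h2 x (by omega)]
  refine Runs.block ?_
  simp [wp]
  split_ands <;> try omega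
  refine Runs.seq (runs_imageLoop (l := l) hB hl ?_ ?_ (by simpa [k5] using hr) (by simp) (by simp)
    (by simpa [k5] using hAB) (by simpa [k5] using hBF) (by simp [k5]; omega) hM
    fun s₃ j1 j2 j3 j4 j5 => ?_)
  · simp [k5]
    simpa using hA.congr fun a _ _ => m2 a (by omega)
  · simpa [k5] using k3
  simp [k5] at j1 j2 j5
  have j3 : ∀ x < 65, s₃.reg x = s₀.reg x := fun x hx => by
    rw [j3 x hx]; simp (disch := omega) [Function.update_of_ne, k5 x hx]
  refine Runs.of_wp ?_
  simp [wp, j3, j4, hr]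
  split_ands <;> try omega
  have m3 : ∀ x, x < s₀.reg 62 + 2 * (runStarts B).length →
      Function.update s₃.mem (s₀.reg 62 + 2 * (runStarts B).length) B.length x = s₃.mem x :=
    fun x hx => Function.update_of_ne (by omega) _ _
  refine hQ _ l ⟨hB, hl, ?_, hl.pieces hB, fun k hk => ?_, fun k hk => ?_, ?_⟩ (fun x hx => ?_) j3 ?_
  · exact hA.congr fun a _ _ => by
      simp only
      rw [m3 a (by omega), j2 a (by omega), m2 a (by omega)]
  · have := k3 k hk
    simp only
    have e := hl.psi_runImage hk
    rw [m3 _ (by omega), m3 _ (by omega), j2 _ (by omega), j2 _ (by omega),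
      show fstSym B (runImage B l k) = (l.getD k (0, 0)).1 from congrArg Prod.fst e,
      show psi B (runImage B l k) = (l.getD k (0, 0)).2 from congrArg Prod.snd e]
    simpa using this
  · have := j1 k hk
    have e : psi B (runImage B l k) = (l.getD k (0, 0)).2 := congrArg Prod.snd (hl.psi_runImage hk)
    simp only
    rw [m3 _ (by omega), m3 _ (by omega), e]
    simpa using this
  · simp
  · simp only
    rw [Function.update_of_ne (by omega), j2 x (by omega), m2 x (by omega)]
  · simp only [sortCost]
    have : (runStarts B).length * (searchCost (runStarts B).length + 140) =
      (runStarts B).length * (searchCost (runStarts B).length + 100) +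
        40 * (runStarts B).length := by ring
    omega

end WordRAM

/-! ## Sorted orbits of the breakpoints -/

namespace WordRAM

open WordRAM.Expr WordRAM.Prog Bwt

/-- A program that replaces a number below `n` in register `74` by its image under `h` in register
`75`, given the memory below `D` and the registers `69` to `72` of `s₀`. -/
def IsStep (E : Env) (step : Prog) (s₀ : NatState) (D n : ℕ) (h : ℕ → ℕ) (T : ℕ) : Prop :=
  ∀ s : NatState, (∀ a < D, s.mem a = s₀.mem a) → (∀ x, 69 ≤ x → x < 73 → s.reg x = s₀.reg x) →
    s.reg 74 < n → ∀ Q : NatState → Prop, (∀ s', s'.mem = s.mem → (∀ x < 73, s'.reg x = s.reg x) →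
      s'.reg 75 = h (s.reg 74) → s'.clk ≤ s.clk + T → Q s') → Runs E step s Q

/-- The images under the first `reg 62` iterates of `step` of the first components of the table at
`reg 60` with `reg 61` entries, stored from `reg 63` on. -/
def orbitLoop (step : Prog) : Prog :=
  loop (lt (reg 64) (reg 61 * reg 62))
    ((ite (eq (reg 62 * (reg 64 / reg 62)) (reg 64))
        (assign 74 (load (reg 60 + 2 * (reg 64 / reg 62)))) skip ;;
      store (reg 63 + 2 * reg 64) (reg 74) ;;
      store (reg 63 + 2 * reg 64 + 1) 0) ;;
     step ;;
     (assign 74 (reg 75) ;; assign 64 (reg 64 + 1)))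

/-- Register `74` carries the next iterate. At indices divisible by `τ` a new source is loaded, so
the invariant claims nothing about the register there. The step needs only memory below the output
area. -/
theorem runs_orbitLoop {E : Env} {step : Prog} {s₀ : NatState} {Q : NatState → Prop}
    {n K τ T : ℕ} {h src : ℕ → ℕ} (hτ : 0 < τ) (hsrc : ∀ k < K, src k < n) (hh : ∀ x < n, h x < n)
    (hstep : IsStep E step s₀ (s₀.reg 63) n h T)
    (ht : ∀ k < K, s₀.mem (s₀.reg 60 + 2 * k) = src k) (hK : s₀.reg 61 = K) (h62 : s₀.reg 62 = τ)
    (h64 : s₀.reg 64 = 0) (hd : s₀.reg 60 + 2 * K ≤ s₀.reg 63)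
    (hN : s₀.reg 63 + 2 * (K * τ) ≤ E.N) (hM : 4 * E.N + 10 ≤ E.M)
    (hQ : ∀ s', Table s'.mem (s₀.reg 63) (K * τ) (fun m => (h^[m % τ] (src (m / τ)), 0)) →
      (∀ x, x < s₀.reg 63 ∨ s₀.reg 63 + 2 * (K * τ) ≤ x → s'.mem x = s₀.mem x) →
      (∀ x < 64, s'.reg x = s₀.reg x) → s'.clk ≤ s₀.clk + K * τ * (T + 100) + 10 → Q s') :
    Runs E (orbitLoop step) s₀ Q := by
  obtain ⟨J, hJ⟩ : ∃ J, K * τ = J := ⟨_, rfl⟩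
  rw [hJ] at hN hQ
  refine Runs.loop_of_invariant (fun k s => k ≤ J ∧ s.reg 64 = J - k ∧
      ((J - k) % τ ≠ 0 → s.reg 74 = h^[(J - k) % τ] (src ((J - k) / τ))) ∧
      (∀ x < 64, s.reg x = s₀.reg x) ∧ (∀ x, 69 ≤ x → x < 73 → s.reg x = s₀.reg x) ∧
      Table s.mem (s₀.reg 63) (J - k) (fun m => (h^[m % τ] (src (m / τ)), 0)) ∧
      (∀ x, x < s₀.reg 63 ∨ s₀.reg 63 + 2 * J ≤ x → s.mem x = s₀.mem x) ∧
      s.clk + k * (T + 100) ≤ s₀.clk + J * (T + 100)) ?_ ?_ J ?_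
  · rintro k s ⟨h1, h2, h3, h4, h5, h6, h7, h8⟩
    refine ⟨by simp [h4, hK, h62, hJ]; omega, by simp [h2, h4, hK, h62, hJ]; omega, Runs.block ?_⟩
    obtain ⟨m, hm⟩ : ∃ m, m = J - (k + 1) := ⟨_, rfl⟩
    rw [← hm] at h2 h3 h6
    have hmk : J - k = m + 1 := by omega
    have hdiv : m / τ < K := Nat.div_lt_of_lt_mul (by rw [mul_comm, hJ]; omega)
    have hle : m / τ ≤ m := Nat.div_le_self _ _
    have hmul : τ * (m / τ) ≤ m := Nat.mul_div_le _ _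
    have hx : h^[m % τ] (src (m / τ)) < n := by
      have : ∀ t x, x < n → h^[t] x < n := by
        intro t
        induction t with
        | zero => exact fun x hx => hx
        | succ t ih => exact fun x hx => ih _ (hh x hx)
      exact this _ _ (hsrc _ hdiv)
    have hmem := ht (m / τ) hdiv
    rw [← h7 _ (by omega)] at hmem
    have key : ∀ s' : NatState, s'.reg 74 = h^[m % τ] (src (m / τ)) →
        (∀ x ≠ 74, s'.reg x = s.reg x) →
        s'.mem = Function.update (Function.update s.mem (s₀.reg 63 + 2 * m)
          (h^[m % τ] (src (m / τ)))) (s₀.reg 63 + 2 * m + 1) 0 →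
        s'.clk ≤ s.clk + 60 → Runs E (step ;; assign 74 (reg 75) ;; assign 64 (reg 64 + 1)) s'
          fun s => k ≤ J ∧ s.reg 64 = J - k ∧
      ((J - k) % τ ≠ 0 → s.reg 74 = h^[(J - k) % τ] (src ((J - k) / τ))) ∧
      (∀ x < 64, s.reg x = s₀.reg x) ∧ (∀ x, 69 ≤ x → x < 73 → s.reg x = s₀.reg x) ∧
      Table s.mem (s₀.reg 63) (J - k) (fun m => (h^[m % τ] (src (m / τ)), 0)) ∧
      (∀ x, x < s₀.reg 63 ∨ s₀.reg 63 + 2 * J ≤ x → s.mem x = s₀.mem x) ∧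
      s.clk + k * (T + 100) ≤ s₀.clk + J * (T + 100) := by
      intro s' k1 k2 k3 k4
      have hmem' : ∀ x, x < s₀.reg 63 + 2 * m ∨ s₀.reg 63 + 2 * m + 2 ≤ x →
          s'.mem x = s.mem x := fun x hx => by
        rw [k3, Function.update_of_ne (by omega), Function.update_of_ne (by omega)]
      refine Runs.seq (hstep s' (fun a ha => ?_) (fun x hx hx' => ?_) (by rw [k1]; exact hx) _
        fun s'' j1 j2 j3 j4 => Runs.of_wp ?_)
      · rw [hmem' a (by omega), h7 a (by omega)]
      · rw [k2 x (by omega), h5 x hx hx']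
      simp [wp, j2, k2, h2, hmk, j3, k1, j1]
      split_ands <;> try omega
      · intro hne
        have e : (m + 1) % τ = m % τ + 1 ∧ (m + 1) / τ = m / τ := by
          have := Nat.div_add_mod m τ
          have hlt := Nat.mod_lt m hτ
          rcases Nat.lt_or_ge (m % τ + 1) τ with hc | hc
          · have e1 : m + 1 = (m % τ + 1) + τ * (m / τ) := by omega
            constructor
            · rw [e1, Nat.add_mul_mod_self_left, Nat.mod_eq_of_lt hc]
            · rw [e1, Nat.add_mul_div_left _ _ hτ, Nat.div_eq_of_lt hc, zero_add]
          · exfalso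
            apply hne
            rw [show m + 1 = τ * (m / τ) + τ by omega]
            simp
        rw [e.1, e.2, Function.iterate_succ_apply']
      · intro x hx
        simp (disch := omega) [Function.update_of_ne, j2, k2, h4]
      · intro x hx hx'
        simp (disch := omega) [Function.update_of_ne, j2, k2, h5]
      · intro j hj
        rcases Nat.lt_or_ge j m with hlt | hge
        · rw [hmem' _ (by omega), hmem' _ (by omega)]
          exact h6 j hlt
        · obtain rfl : j = m := by omega
          simp [k3]
      · intro x hx
        rw [hmem' x (by omega), h7 x hx]
      · rw [add_mul] at h8
        omega
    simp [wp, h2, h4, h62]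
    split_ands <;> try omega
    · intro he
      have hmod : m % τ = 0 := by
        have := Nat.div_add_mod m τ; omega
      split_ands <;> try omega
      refine key _ ?_ ?_ ?_ ?_
      · simp [hmem, hmod]
      · intro x hx; simp [Function.update_of_ne hx]
      · simp [hmem, hmod]
      · simp
    · intro he
      have hmod : m % τ ≠ 0 := by
        have := Nat.div_add_mod m τ; omega
      split_ands <;> try omega
      refine key _ ?_ ?_ ?_ ?_
      · simp [h3 hmod]
      · intro x hx; simp
      · simp [h3 hmod]
      · simp
  · rintro s ⟨h1, h2, h3, h4, h5, h6, h7, h8⟩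
    refine ⟨by simp [h4, hK, h62, hJ]; omega, by simp [h2, h4, hK, h62, hJ], hQ _ h6 h7 h4 ?_⟩
    simp; omega
  · exact ⟨le_rfl, by omega, fun h => by simp at h, fun _ _ => rfl, fun _ _ _ => rfl,
      fun j hj => by omega, fun _ _ => rfl, le_rfl⟩

/-- Sorting the orbits; register `59` points to free memory. -/
def sortOrbits (step : Prog) : Prog :=
  assign 64 0 ;; orbitLoop step ;;
  (assign 80 (reg 63) ;; assign 81 (reg 61 * reg 62) ;; assign 82 (reg 59)) ;; sort

/-- A bound on the time of `sortOrbits`. -/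
def orbitCost (J T : ℕ) : ℕ := J * (T + 100) + sortCost J + 30

theorem runs_sortOrbits {E : Env} {step : Prog} {s₀ : NatState} {Q : NatState → Prop}
    {n K τ T : ℕ} {h src : ℕ → ℕ} (hτ : 0 < τ) (hK0 : 0 < K) (h0 : src 0 = 0)
    (hsrc : ∀ k < K, src k < n) (hh : ∀ x < n, h x < n)
    (hstep : IsStep E step s₀ (s₀.reg 63) n h T)
    (ht : ∀ k < K, s₀.mem (s₀.reg 60 + 2 * k) = src k) (hK : s₀.reg 61 = K) (h62 : s₀.reg 62 = τ)
    (hd : s₀.reg 60 + 2 * K ≤ s₀.reg 63) (hX : s₀.reg 63 + 2 * (K * τ) ≤ s₀.reg 59)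
    (hN : s₀.reg 59 + 2 * (K * τ) ≤ E.N) (hM : 4 * E.N + 10 ≤ E.M)
    (hQ : ∀ s' F, SortedPoints n (K * τ) τ h {x | ∃ k < K, x = src k} F →
      (∀ k < K * τ, s'.mem (s₀.reg 63 + 2 * k) = F k) →
      (∀ x, x < s₀.reg 63 ∨ s₀.reg 63 + 2 * (K * τ) ≤ x ∧ x < s₀.reg 59 →
        s'.mem x = s₀.mem x) →
      (∀ x < 64, s'.reg x = s₀.reg x) → s'.clk ≤ s₀.clk + orbitCost (K * τ) T → Q s') :
    Runs E (sortOrbits step) s₀ Q := by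
  refine Runs.block ?_
  simp [wp]
  split_ands <;> try omega
  refine Runs.seq (runs_orbitLoop (n := n) (K := K) (τ := τ) (T := T) (h := h) (src := src) hτ hsrc
    hh ?_ (by simpa using ht) (by simpa using hK) (by simpa using h62) (by simp) (by simpa using hd)
    (by simp; omega) hM fun s₁ h1 h2 h3 h4 => ?_)
  · intro s k1 k2 k3
    refine hstep s (by simpa using k1) (fun x hx hx' => ?_) k3
    rw [k2 x hx hx']; simp (disch := omega) [Function.update_of_ne]
  simp at h2 h4
  simp only [] at h1
  rw [Function.update_of_ne (by omega)] at h1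
  have h3 : ∀ x < 64, s₁.reg x = s₀.reg x := fun x hx => by
    rw [h3 x hx]; simp (disch := omega) [Function.update_of_ne]
  refine Runs.block ?_
  simp [wp, h3, hK, h62]
  split_ands <;> try omega
  refine runs_sort (n := K * τ) (g := fun m => (h^[m % τ] (src (m / τ)), 0)) (by omega)
    (by simpa using h1) (by simp) (by simpa using hX) (by simpa using hN)
    fun s₂ l k1 k2 k3 k4 k5 k6 => ?_
  simp at k4 k6
  refine hQ s₂ _ (sortedPoints_of_perm hτ hK0 h0 hsrc hh k1 k2) (fun k hk => ?_) (fun x hx => ?_)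
    (fun x hx => ?_) ?_
  · have := (k3 k hk).1
    have hlen : l.length = K * τ := by rw [k1.length_eq]; simp
    rw [pointFun, if_pos (by omega)]
    simpa using this
  · rw [k4 x hx, h2 x (by omega)]
  · rw [k5 x (by omega)]; simp (disch := omega) [Function.update_of_ne, h3]
  · simp only [orbitCost, sortCost]; omega

end WordRAM

/-! ## Composite steps -/

namespace WordRAM

open WordRAM.Expr WordRAM.Prog Bwt

/-- `reg 48` steps of the LF-mapping from `reg 49`, with the interval of the ranks of the traversed
string in the registers `50`, `51`. -/
def walk : Prog :=
  (assign 50 0 ;; assign 51 (reg 47) ;; assign 52 (reg 48)) ;;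
  loop (reg 52)
    ((assign 69 (reg 40) ;; assign 70 (reg 41) ;; assign 71 (reg 42) ;; assign 72 (reg 43) ;;
      assign 74 (reg 49)) ;;
     lfStep ;;
     (assign 49 (reg 75) ;; assign 70 (reg 44) ;; assign 71 (reg 45) ;; assign 72 (reg 46) ;;
      assign 74 (reg 50)) ;;
     rankStep ;;
     (assign 50 (reg 75) ;; assign 74 (reg 51)) ;;
     rankStep ;;
     (assign 51 (reg 75) ;; assign 52 (reg 52 - 1)))

/-- A bound on the time of `walk`. -/
def walkCost (r r' τ : ℕ) : ℕ := τ * (2 * searchCost r + 2 * searchCost r' + 500) + 20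

/-- The tables of a string with all their addresses below `N`. -/
structure StringDS.Below (N aA aB aF : ℕ) (B : List ℕ) : Prop where
  runs : aA + 2 * (runStarts B).length + 2 ≤ N
  sorted : aB + 2 * (runStarts B).length ≤ N
  images : aF + 2 * (runStarts B).length < N

theorem StringDS.congr {mem mem' : ℕ → ℕ} {aA aB aF N : ℕ} {B : List ℕ} {l : List (ℕ × ℕ)}
    (h : StringDS mem aA aB aF B l) (hb : StringDS.Below N aA aB aF B)
    (hm : ∀ a < N, mem' a = mem a) : StringDS mem' aA aB aF B l :=
  ⟨h.pos, h.sorted, h.tabA.congr fun a _ _ => hm a (by have := hb.runs; omega),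
    h.ds.congr (fun a _ _ => hm a (by have := hb.sorted; omega))
      fun a _ _ => hm a (by have := hb.images; omega)⟩

/-- Each symbol that LF reads in `B` is prepended at once in `B'` to both ends of an interval that
starts as everything; the sum of its final ends is the name of the context. -/
theorem runs_walk {E : Env} {s₀ : NatState} {Q : NatState → Prop} {B B' : List ℕ}
    {l l' : List (ℕ × ℕ)} {aA' τ i : ℕ}
    (hds : StringDS s₀.mem (s₀.reg 40) (s₀.reg 41) (s₀.reg 42) B l)
    (hds' : StringDS s₀.mem aA' (s₀.reg 44) (s₀.reg 45) B' l')
    (h43 : s₀.reg 43 = (runStarts B).length) (h46 : s₀.reg 46 = (runStarts B').length)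
    (h47 : s₀.reg 47 = B'.length) (h48 : s₀.reg 48 = τ) (h49 : s₀.reg 49 = i) (hi : i < B.length)
    (hb : StringDS.Below E.N (s₀.reg 40) (s₀.reg 41) (s₀.reg 42) B)
    (hb' : StringDS.Below E.N aA' (s₀.reg 44) (s₀.reg 45) B')
    (hM : 4 * E.N + 4 * B.length + 4 * B'.length + 10 ≤ E.M)
    (hQ : ∀ s', s'.mem = s₀.mem → (∀ x < 49, s'.reg x = s₀.reg x) →
      s'.reg 49 = (lf B)^[τ] i → s'.reg 50 = rankList B' (context B τ i) 0 →
      s'.reg 51 = rankList B' (context B τ i) B'.length →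
      s'.clk ≤ s₀.clk + walkCost (runStarts B).length (runStarts B').length τ → Q s') :
    Runs E walk s₀ Q := by
  refine Runs.block ?_
  simp [wp]
  split_ands <;> try omega
  obtain ⟨hb1, hb2, hb3⟩ := hb
  obtain ⟨hb1', hb2', hb3'⟩ := hb'
  unfold walkCost at hQ
  set r := (runStarts B).length with hr
  set r' := (runStarts B').length with hr'
  set T := 2 * searchCost r + 2 * searchCost r' + 500 with hT
  clear_value T
  refine Runs.loop_of_invariant (fun k s => k ≤ τ ∧ s.reg 52 = k ∧ s.mem = s₀.mem ∧
      (∀ x < 49, s.reg x = s₀.reg x) ∧ s.reg 49 = (lf B)^[τ - k] i ∧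
      s.reg 50 = rankList B' (context B (τ - k) i) 0 ∧
      s.reg 51 = rankList B' (context B (τ - k) i) B'.length ∧
      s.clk + k * T ≤ s₀.clk + τ * T + 10) ?_ ?_ τ ?_
  · rintro k s ⟨h1, h2, h3, h4, h5, h6, h7, h8⟩
    rw [add_mul] at h8
    refine ⟨by simp, by simp [h2], Runs.block ?_⟩
    obtain ⟨t, ht⟩ : ∃ t, τ - (k + 1) = t := ⟨_, rfl⟩
    rw [ht] at h5 h6 h7
    rw [show τ - k = t + 1 by omega]
    have hlt := lf_iterate_lt hi t
    simp [wp, h4]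
    refine Runs.seq (runs_lfStep (B := B) (l := l) (by simpa [h3] using hds) (by simpa using h43)
      (by simpa [h5] using hlt) (by simp; omega) (by simpa using hb2) (by simpa using hb3)
      (by omega) fun s₁ k1 k2 k3 k4 k5 => ?_)
    simp [h5] at k1 k4 k5
    simp only [Function.update_self, h5] at k3
    rw [← hr] at k5
    have k2 : ∀ x < 69, s₁.reg x = s.reg x := fun x hx => by
      rw [k2 x (by omega)]; simp (disch := omega) [Function.update_of_ne]
    refine Runs.block ?_
    simp [wp, k2, h4]
    refine Runs.seq (runs_rankStep (n := B'.length) (K := r') (key := fstSym B') (f := psi B')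
      (F := runImage B' l') (g := rankList B' (context B (t + 1) i) 0)
      (by simpa [k1, h3] using hds'.ds) (by simpa using h46)
      (by simpa [h6] using rankList_le (Nat.zero_le _)) (rankList_le (Nat.zero_le _)) ?_
      (by simpa using hb2') (by simpa using hb3') (by omega) fun s₂ j1 j2 j3 j4 => ?_)
    · intro q hq
      simp only [Function.update_self]
      rw [Function.update_of_ne (by omega), Function.update_of_ne (by omega),
        Function.update_of_ne (by omega), Function.update_of_ne (by omega),
        Function.update_of_ne (by omega), k3, h6]
      exact lt_rankMap_iff hq
    have j73 : s₂.reg 73 = B.getD ((lf B)^[t] i) 0 := by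
      rw [j2 73 (by omega)]; simp [-List.getD_eq_getElem?_getD, k3]
    have j49 : s₂.reg 49 = (lf B)^[t + 1] i := by
      rw [j2 49 (by omega), Function.iterate_succ_apply']; simp [k4]
    have j44 : s₂.reg 70 = s₀.reg 44 := by rw [j2 _ (by omega)]; simp
    have j45 : s₂.reg 71 = s₀.reg 45 := by rw [j2 _ (by omega)]; simp
    have j46 : s₂.reg 72 = s₀.reg 46 := by rw [j2 _ (by omega)]; simp
    have j2 : ∀ x < 69, x ≠ 49 → s₂.reg x = s.reg x := fun x hx hx' => by
      rw [j2 x (by omega)]; simp (disch := omega) [Function.update_of_ne, k2]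
    simp at j1 j4
    refine Runs.block ?_
    simp [wp, j2]
    refine Runs.seq (runs_rankStep (n := B'.length) (K := r') (key := fstSym B') (f := psi B')
      (F := runImage B' l') (g := rankList B' (context B (t + 1) i) B'.length)
      (by simpa [j1, k1, h3, j44, j45] using hds'.ds) (by simpa [j46] using h46)
      (by simpa [h7] using rankList_le le_rfl) (rankList_le le_rfl) ?_
      (by simpa [j44] using hb2') (by simpa [j45] using hb3') (by omega) fun s₃ i1 i2 i3 i4 => ?_)
    · intro q hq
      simp only [Function.update_self]
      rw [Function.update_of_ne (by omega), Function.update_of_ne (by omega), j73, h7]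
      exact lt_rankMap_iff hq
    have i50 : s₃.reg 50 = rankList B' (context B (t + 1) i) 0 := by
      rw [i2 50 (by omega)]; simp [j3]
    have i49 : s₃.reg 49 = (lf B)^[t + 1] i := by
      rw [i2 49 (by omega)]; simp [j49]
    have i2 : ∀ x < 69, x ≠ 49 → x ≠ 50 → s₃.reg x = s.reg x := fun x hx hx' hx'' => by
      rw [i2 x (by omega)]; simp (disch := omega) [Function.update_of_ne, j2]
    simp at i1 i4
    refine Runs.of_wp ?_
    simp (disch := omega) [wp, i2, h2, i49, i50, i3, i1, j1, k1, h3]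
    split_ands <;> try omega
    intro x hx
    simp (disch := omega) [Function.update_of_ne, i2, h4]
  · rintro s ⟨h1, h2, h3, h4, h5, h6, h7, h8⟩
    refine ⟨by simp, by simp [h2], hQ _ h3 h4 h5 h6 h7 ?_⟩
    rw [NatState.tick_clk, time_reg]; omega
  · refine ⟨le_rfl, by simp [h48], rfl, fun x hx => ?_, by simp [h49], ?_, ?_, ?_⟩
    · simp (disch := omega) [Function.update_of_ne]
    · simp [context, rankList]
    · simp [context, rankList, h47]
    · dsimp only; omega

/-- The end points and names of the composite steps from the points in the table at `reg 30` with
`reg 31` entries, stored at `reg 32`. -/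
def walkLoop : Prog :=
  loop (lt (reg 33) (reg 31))
    (assign 49 (load (reg 30 + 2 * reg 33)) ;; walk ;;
     (store (reg 32 + 2 * reg 33) (reg 49) ;; store (reg 32 + 2 * reg 33 + 1) (reg 50 + reg 51) ;;
      assign 33 (reg 33 + 1)))

theorem runs_walkLoop {E : Env} {s₀ : NatState} {Q : NatState → Prop} {B B' : List ℕ}
    {l l' : List (ℕ × ℕ)} {aA' τ J D : ℕ} {F : ℕ → ℕ}
    (hds : StringDS s₀.mem (s₀.reg 40) (s₀.reg 41) (s₀.reg 42) B l)
    (hds' : StringDS s₀.mem aA' (s₀.reg 44) (s₀.reg 45) B' l')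
    (h43 : s₀.reg 43 = (runStarts B).length) (h46 : s₀.reg 46 = (runStarts B').length)
    (h47 : s₀.reg 47 = B'.length) (h48 : s₀.reg 48 = τ) (h31 : s₀.reg 31 = J)
    (h33 : s₀.reg 33 = 0) (hF : ∀ k < J, F k < B.length)
    (ht : ∀ k < J, s₀.mem (s₀.reg 30 + 2 * k) = F k)
    (hb : StringDS.Below D (s₀.reg 40) (s₀.reg 41) (s₀.reg 42) B)
    (hb' : StringDS.Below D aA' (s₀.reg 44) (s₀.reg 45) B')
    (hD : D ≤ s₀.reg 30) (hd : s₀.reg 30 + 2 * J ≤ s₀.reg 32) (hN : s₀.reg 32 + 2 * J ≤ E.N)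
    (hM : 4 * E.N + 4 * B.length + 4 * B'.length + 10 ≤ E.M)
    (hQ : ∀ s', Table s'.mem (s₀.reg 32) J
        (fun k => ((lf B)^[τ] (F k), name B' (context B τ (F k)))) →
      (∀ x, x < s₀.reg 32 ∨ s₀.reg 32 + 2 * J ≤ x → s'.mem x = s₀.mem x) →
      (∀ x < 33, s'.reg x = s₀.reg x) →
      s'.clk ≤ s₀.clk + J * (walkCost (runStarts B).length (runStarts B').length τ + 50) + 10 →
      Q s') :
    Runs E walkLoop s₀ Q := by
  obtain ⟨hb1, hb2, hb3⟩ := hb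
  obtain ⟨hb1', hb2', hb3'⟩ := hb'
  set T := walkCost (runStarts B).length (runStarts B').length τ + 50 with hT
  refine Runs.loop_of_invariant (fun k s => k ≤ J ∧ s.reg 33 = J - k ∧
      (∀ x < 49, x ≠ 33 → s.reg x = s₀.reg x) ∧
      Table s.mem (s₀.reg 32) (J - k)
        (fun k => ((lf B)^[τ] (F k), name B' (context B τ (F k)))) ∧
      (∀ x, x < s₀.reg 32 ∨ s₀.reg 32 + 2 * J ≤ x → s.mem x = s₀.mem x) ∧
      s.clk + k * T ≤ s₀.clk + J * T) ?_ ?_ J ?_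
  · rintro k s ⟨h1, h2, h3, h4, h5, h6⟩
    rw [add_mul] at h6
    refine ⟨by simp, by simp [h2, h3, h31]; omega, Runs.block ?_⟩
    obtain ⟨m, hm⟩ : ∃ m, J - (k + 1) = m := ⟨_, rfl⟩
    rw [hm] at h2 h4
    rw [show J - k = m + 1 by omega]
    have hmem := ht m (by omega)
    rw [← h5 _ (by omega)] at hmem
    simp [wp, h2, h3, hmem]
    split_ands <;> try omega
    refine Runs.seq (runs_walk (B := B) (B' := B') (l := l) (l' := l') (aA' := aA') (τ := τ)
      (i := F m) ?_ ?_ (by simpa [h3] using h43) (by simpa [h3] using h46) (by simpa [h3] using h47)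
      (by simpa [h3] using h48) (by simp) (hF m (by omega)) ?_ ?_ hM
      fun s' k1 k2 k3 k4 k5 k6 => ?_)
    · simpa [h3] using hds.congr ⟨hb1, hb2, hb3⟩ fun a ha => h5 a (by omega)
    · simpa [h3] using hds'.congr ⟨hb1', hb2', hb3'⟩ fun a ha => h5 a (by omega)
    · constructor <;> simp [h3] <;> omega
    · exact ⟨by omega, by simp [h3]; omega, by simp [h3]; omega⟩
    simp at k1 k6
    have k2 : ∀ x < 49, s'.reg x = s.reg x := fun x hx => by
      rw [k2 x (by omega)]; simp (disch := omega) [Function.update_of_ne]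
    have n1 : rankList B' (context B τ (F m)) 0 ≤ B'.length := rankList_le (Nat.zero_le _)
    have n2 : rankList B' (context B τ (F m)) B'.length ≤ B'.length := rankList_le le_rfl
    refine Runs.of_wp ?_
    simp [wp, k2, h2, h3, k3, k4, k5, k1]
    split_ands <;> try omega
    · intro x hx hx'
      simp (disch := omega) [Function.update_of_ne, k2, h3 x hx hx']
    · intro j hj
      rcases Nat.lt_or_ge j m with hlt | hge
      · obtain ⟨e3, e4⟩ := h4 j hlt
        simp (disch := omega) [Function.update_of_ne, e3, e4]
      · obtain rfl : j = m := by omega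
        simp [name]
    · intro x hx
      rw [Function.update_of_ne (by omega), Function.update_of_ne (by omega)]
      exact h5 x hx
  · rintro s ⟨h1, h2, h3, h4, h5, h6⟩
    refine ⟨by simp, by simp [h2, h3, h31], hQ _ h4 h5 (fun x hx => h3 x (by omega) (by omega)) ?_⟩
    simp; omega
  · exact ⟨le_rfl, by omega, fun _ _ _ => rfl, fun j hj => by omega, fun _ _ => rfl, le_rfl⟩

end WordRAM

/-! ## The table of the composite rank -/

namespace WordRAM

open WordRAM.Expr WordRAM.Prog Bwt

/-- Iterating the inverse LF-mapping `reg 34` times from `reg 74`. -/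
def psiLoop : Prog :=
  loop (reg 34) (psiStep ;; (assign 74 (reg 75) ;; assign 34 (reg 34 - 1)))

theorem runs_psiLoop {E : Env} {s₀ : NatState} {Q : NatState → Prop} {B : List ℕ}
    {l : List (ℕ × ℕ)} {aA aB τ : ℕ} (hds : StringDS s₀.mem aA aB (s₀.reg 71) B l)
    (h72 : s₀.reg 72 = (runStarts B).length) (h34 : s₀.reg 34 = τ) (hi : s₀.reg 74 < B.length)
    (hN : s₀.reg 71 + 2 * (runStarts B).length < E.N) (hM : 4 * E.N + 4 * B.length + 10 ≤ E.M)
    (hQ : ∀ s', s'.mem = s₀.mem → (∀ x < 74, x ≠ 34 → s'.reg x = s₀.reg x) →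
      s'.reg 74 = (psi B)^[τ] (s₀.reg 74) →
      s'.clk ≤ s₀.clk + τ * (searchCost (runStarts B).length + 110) + 10 → Q s') :
    Runs E psiLoop s₀ Q := by
  set T := searchCost (runStarts B).length + 110 with hT
  clear_value T
  refine Runs.loop_of_invariant (fun k s => k ≤ τ ∧ s.reg 34 = k ∧ s.mem = s₀.mem ∧
      (∀ x < 74, x ≠ 34 → s.reg x = s₀.reg x) ∧ s.reg 74 = (psi B)^[τ - k] (s₀.reg 74) ∧
      s.clk + k * T ≤ s₀.clk + τ * T) ?_ ?_ τ ?_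
  · rintro k s ⟨h1, h2, h3, h4, h5, h6⟩
    rw [add_mul] at h6
    have hlt := psi_iterate_lt hi (τ - (k + 1))
    rw [← h5] at hlt
    refine ⟨by simp, by simp [h2], Runs.seq (runs_psiStep (n := B.length)
      (K := (runStarts B).length) (aB := aB) (key := fstSym B) (f := psi B) (F := runImage B l)
      (by simpa [h3, h4] using hds.ds) (by simpa [h4] using h72) (by simpa using hlt)
      (by simpa using psi_lt hlt) (by simpa [h4] using hN) (by omega)
      fun s' k1 k2 k3 k4 => Runs.of_wp ?_)⟩
    simp at k1 k3 k4
    simp [wp, k2, h2, k1, h3, k3, h5]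
    rw [← Function.iterate_succ_apply' (psi B), show (τ - (k + 1)).succ = τ - k by omega]
    refine ⟨by omega, by omega, fun x hx hx' => ?_, rfl, by omega⟩
    simp (disch := omega) [Function.update_of_ne, k2, h4]
  · rintro s ⟨h1, h2, h3, h4, h5, h6⟩
    refine ⟨by simp, by simp [h2], hQ _ h3 h4 h5 ?_⟩
    rw [NatState.tick_clk, time_reg]; omega
  · exact ⟨le_rfl, h34, rfl, fun _ _ _ => rfl, by simp, le_rfl⟩

/-- The tables of the composite rank: the points at `reg 30`, `reg 31` in number, are completed by
their preimages, and the pairs of names and preimages are stored at `reg 32`. -/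
def preimageLoop : Prog :=
  loop (lt (reg 33) (reg 31))
    ((assign 71 (reg 45) ;; assign 72 (reg 46) ;; assign 74 (load (reg 30 + 2 * reg 33)) ;;
      assign 34 (reg 48)) ;; psiLoop ;;
     (assign 35 (reg 74) ;; assign 49 (reg 74)) ;; walk ;;
     (store (reg 30 + 2 * reg 33 + 1) (reg 35) ;; store (reg 32 + 2 * reg 33) (reg 50 + reg 51) ;;
      store (reg 32 + 2 * reg 33 + 1) (reg 35) ;; assign 33 (reg 33 + 1))) ;;
  store (reg 30 + 2 * reg 31) (reg 47)

/-- A bound on the time of one iteration of `preimageLoop`. -/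
def preimageCost (r τ : ℕ) : ℕ := walkCost r r τ + τ * (searchCost r + 110) + 200

/-- For the name of the label of a point, iterate `psi` first and then walk back: by
`context_psi_iterate` the walk reads the label. Here `walk` uses the same string in both of its
roles. -/
theorem runs_preimageLoop {E : Env} {s₀ : NatState} {Q : NatState → Prop} {B : List ℕ}
    {l : List (ℕ × ℕ)} {τ J D : ℕ} {F : ℕ → ℕ}
    (hds : StringDS s₀.mem (s₀.reg 40) (s₀.reg 44) (s₀.reg 45) B l)
    (h41 : s₀.reg 41 = s₀.reg 44) (h42 : s₀.reg 42 = s₀.reg 45)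
    (h43 : s₀.reg 43 = (runStarts B).length) (h46 : s₀.reg 46 = (runStarts B).length)
    (h47 : s₀.reg 47 = B.length) (h48 : s₀.reg 48 = τ) (h31 : s₀.reg 31 = J)
    (h33 : s₀.reg 33 = 0)
    (hF : SortedPoints B.length J τ (lf B) {x | ∃ k < (runStarts B).length, x = runImage B l k} F)
    (ht : ∀ k < J, s₀.mem (s₀.reg 30 + 2 * k) = F k)
    (hb : StringDS.Below D (s₀.reg 40) (s₀.reg 44) (s₀.reg 45) B)
    (hD : D ≤ s₀.reg 32) (hd : s₀.reg 32 + 2 * J ≤ s₀.reg 30) (hN : s₀.reg 30 + 2 * J < E.N)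
    (hM : 4 * E.N + 8 * B.length + 10 ≤ E.M)
    (hQ : ∀ s', RankDS s'.mem (s₀.reg 32) (s₀.reg 30) B.length J
        (fun q => name B (label B τ q)) (psi B)^[τ] F →
      (∀ x, x < s₀.reg 32 → s'.mem x = s₀.mem x) →
      (∀ x < 33, s'.reg x = s₀.reg x) →
      s'.clk ≤ s₀.clk + J * preimageCost (runStarts B).length τ + 20 → Q s') :
    Runs E preimageLoop s₀ Q := by
  obtain ⟨hb1, hb2, hb3⟩ := hb
  set T := preimageCost (runStarts B).length τ with hT
  rw [preimageCost] at hT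
  clear_value T
  refine Runs.seq (Runs.loop_of_invariant (fun k s => k ≤ J ∧ s.reg 33 = J - k ∧
      (∀ x < 49, x < 33 ∨ 36 ≤ x → s.reg x = s₀.reg x) ∧
      Table s.mem (s₀.reg 32) (J - k)
        (fun k => (name B (label B τ (F k)), (psi B)^[τ] (F k))) ∧
      Table s.mem (s₀.reg 30) (J - k) (fun k => (F k, (psi B)^[τ] (F k))) ∧
      (∀ x, x < s₀.reg 32 ∨ s₀.reg 30 + 2 * (J - k) ≤ x → s.mem x = s₀.mem x) ∧
      s.clk + k * T ≤ s₀.clk + J * T) ?_ ?_ J ?_)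
  · rintro k s ⟨h1, h2, h3, h4, h5, h6, h7⟩
    rw [add_mul] at h7
    refine ⟨by simp, by simp [h2, h3, h31]; omega, Runs.block ?_⟩
    obtain ⟨m, hm⟩ : ∃ m, J - (k + 1) = m := ⟨_, rfl⟩
    rw [hm] at h2 h4 h5 h6
    rw [show J - k = m + 1 by omega]
    have hmem := ht m (by omega)
    rw [← h6 _ (by omega)] at hmem
    have hFm := hF.lt m (by omega)
    have hds₁ : StringDS s.mem (s₀.reg 40) (s₀.reg 44) (s₀.reg 45) B l :=
      hds.congr ⟨hb1, hb2, hb3⟩ fun a ha => h6 a (by omega)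
    simp [wp, h2, h3, hmem]
    split_ands <;> try omega
    refine Runs.seq (runs_psiLoop (B := B) (l := l) (aA := s₀.reg 40) (aB := s₀.reg 44) (τ := τ)
      (by simpa using hds₁) (by simpa using h46) (by simpa using h48) (by simpa using hFm)
      (by simp; omega) (by omega) fun s₁ k1 k2 k3 k4 => ?_)
    simp at k1 k3 k4
    have k2 : ∀ x < 69, x ≠ 34 → s₁.reg x = s.reg x := fun x hx hx' => by
      rw [k2 x (by omega) hx']; simp (disch := omega) [Function.update_of_ne]
    have hp := psi_iterate_lt hFm τ
    refine Runs.block ?_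
    simp [wp, k3]
    refine Runs.seq (runs_walk (B := B) (B' := B) (l := l) (l' := l) (aA' := s₀.reg 40) (τ := τ)
      (i := (psi B)^[τ] (F m)) ?_ ?_ (by simpa [k2, h3] using h43) (by simpa [k2, h3] using h46)
      (by simpa [k2, h3] using h47) (by simpa [k2, h3] using h48) (by simp) hp ?_ ?_ (by omega)
      fun s₂ j1 j2 j3 j4 j5 j6 => ?_)
    · simpa [k1, k2, h3, h41, h42] using hds₁
    · simpa [k1, k2, h3] using hds₁
    · exact ⟨by simp [k2, h3]; omega, by simp [k2, h3, h41]; omega, by simp [k2, h3, h42]; omega⟩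
    · exact ⟨by omega, by simp [k2, h3]; omega, by simp [k2, h3]; omega⟩
    simp at j1 j6
    rw [context_psi_iterate hFm] at j4 j5
    have j35 : s₂.reg 35 = (psi B)^[τ] (F m) := by rw [j2 35 (by omega)]; simp
    have j2 : ∀ x < 49, x < 34 ∨ 36 ≤ x → s₂.reg x = s.reg x := fun x hx hx' => by
      rw [j2 x (by omega)]; simp (disch := omega) [Function.update_of_ne, k2]
    have n1 : rankList B (label B τ (F m)) 0 ≤ B.length := rankList_le (Nat.zero_le _)
    have n2 : rankList B (label B τ (F m)) B.length ≤ B.length := rankList_le le_rfl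
    refine Runs.of_wp ?_
    simp [wp, j2, h2, h3, j4, j5, j1, k1, j35]
    split_ands <;> try omega
    · intro x hx hx'
      simp (disch := omega) [Function.update_of_ne, j2, h3]
    · intro j hj
      rcases Nat.lt_or_ge j m with hlt | hge
      · obtain ⟨e3, e4⟩ := h4 j hlt
        simp (disch := omega) [Function.update_of_ne, e3, e4]
      · obtain rfl : j = m := by omega
        simp [name]
    · intro j hj
      rcases Nat.lt_or_ge j m with hlt | hge
      · obtain ⟨e3, e4⟩ := h5 j hlt
        simp (disch := omega) [Function.update_of_ne, e3, e4]
      · obtain rfl : j = m := by omega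
        simp (disch := omega) [Function.update_of_ne, hmem]
    · intro x hx
      rw [Function.update_of_ne (by omega), Function.update_of_ne (by omega),
        Function.update_of_ne (by omega)]
      exact h6 x (by omega)
  · rintro s ⟨h1, h2, h3, h4, h5, h6, h7⟩
    refine ⟨by simp, by simp [h2, h3, h31], Runs.of_wp ?_⟩
    simp [wp, h3, h31]
    split_ands <;> try omega
    simp at h4 h5
    refine hQ _ ⟨hds.sorted.iterated_pieces hds.pos hF, ?_, ?_, ?_⟩ (fun x hx => ?_)
      (fun x hx => h3 x (by omega) (by omega)) ?_
    · exact h4.congr fun a _ _ => Function.update_of_ne (by omega) _ _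
    · exact h5.congr fun a _ _ => Function.update_of_ne (by omega) _ _
    · simp [h47]
    · simp only
      rw [Function.update_of_ne (by omega), h6 x (by omega)]
    · dsimp only; omega
  · exact ⟨le_rfl, by omega, fun _ _ _ => rfl, fun j hj => by omega, fun j hj => by omega,
      fun _ _ => rfl, le_rfl⟩

end WordRAM

/-! ## The samples -/

namespace WordRAM

open WordRAM.Expr WordRAM.Prog Bwt

/-- One sample for each of `reg 36` composite steps, stored from `reg 37` on and sorted; register
`29` points to free memory. -/
def sampleLoop : Prog :=
  (assign 38 0 ;; assign 39 0 ;; assign 40 0 ;; store (reg 37) 0 ;; store (reg 37 + 1) 0) ;;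
  loop (lt (reg 38) (reg 36))
    ((assign 80 (reg 30) ;; assign 81 (reg 31) ;; assign 82 (reg 39 + 1) ;; assign 83 0) ;;
     search ;;
     (assign 39 (load (reg 32 + 2 * (reg 84 - 1)) +
        (reg 39 - load (reg 30 + 2 * (reg 84 - 1)))) ;;
      assign 73 (load (reg 32 + 2 * (reg 84 - 1) + 1)) ;;
      assign 70 (reg 33) ;; assign 71 (reg 34) ;; assign 72 (reg 35) ;; assign 74 (reg 40)) ;;
     rankStep ;;
     (assign 40 (reg 75) ;; assign 38 (reg 38 + 1) ;; store (reg 37 + 2 * reg 38) (reg 39) ;;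
      store (reg 37 + 2 * reg 38 + 1) (reg 40))) ;;
  (assign 80 (reg 37) ;; assign 81 (reg 36 + 1) ;; assign 82 (reg 29)) ;;
  sort

/-- A bound on the time of `sampleLoop`. -/
def sampleCost (J J' q : ℕ) : ℕ :=
  q * (searchCost J + searchCost J' + 300) + sortCost (q + 1) + 60

/-- A block step takes two searches: one among the break points of `S`, which gives the next rank
and the name of the block, and one `rankStep` in the tables of names of `S'`, justified by
`lt_rankList_iff`. -/
theorem runs_sampleLoop {E : Env} {s₀ : NatState} {Q : NatState → Prop} {B B' : List ℕ}
    {τ J J' q : ℕ} {F F' X Y : ℕ → ℕ}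
    (hF : SortedPoints B.length J τ (psi B) {x | ∃ k < (runStarts B).length, x = runStart B k} F)
    (ht : ∀ k < J, s₀.mem (s₀.reg 30 + 2 * k) = F k)
    (hE : Table s₀.mem (s₀.reg 32) J fun k => ((lf B)^[τ] (F k), name B' (context B τ (F k))))
    (hds : RankDS s₀.mem (s₀.reg 33) (s₀.reg 34) B'.length J'
      (fun q => name B' (label B' τ q)) (psi B')^[τ] F')
    (h31 : s₀.reg 31 = J) (h35 : s₀.reg 35 = J') (h36 : s₀.reg 36 = q)
    (hX0 : X 0 = 0) (hY0 : Y 0 = 0) (hX : ∀ k < q, (lf B)^[τ] (X k) = X (k + 1))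
    (hY : ∀ k < q, rankList B' (context B τ (X k)) (Y k) = Y (k + 1))
    (hXlt : ∀ k ≤ q, X k < B.length) (hYle : ∀ k ≤ q, Y k ≤ B'.length)
    (hd : s₀.reg 37 + 2 * (q + 1) ≤ s₀.reg 30) (hd₁ : s₀.reg 30 + 2 * J ≤ s₀.reg 32)
    (hd₂ : s₀.reg 32 + 2 * J ≤ s₀.reg 33) (hd₃ : s₀.reg 33 + 2 * J' ≤ s₀.reg 34)
    (hd₄ : s₀.reg 34 + 2 * J' < s₀.reg 29) (hN : s₀.reg 29 + 2 * (q + 1) ≤ E.N)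
    (hM : 4 * E.N + 4 * B.length + 4 * B'.length + 10 ≤ E.M)
    (hQ : ∀ (s' : NatState) (l : List (ℕ × ℕ)),
      l.Perm ((List.range (q + 1)).map fun k => (X k, Y k)) → l.Pairwise PLe →
      Table s'.mem (s₀.reg 37) (q + 1) (fun k => l.getD k (0, 0)) →
      (∀ x, x < s₀.reg 37 → s'.mem x = s₀.mem x) →
      (∀ x < 38, s'.reg x = s₀.reg x) → s'.clk ≤ s₀.clk + sampleCost J J' q → Q s') :
    Runs E sampleLoop s₀ Q := by
  refine Runs.block ?_
  simp [wp]
  split_ands <;> try omega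
  unfold sampleCost sortCost at hQ
  set T := searchCost J + searchCost J' + 300 with hT
  clear_value T
  refine Runs.seq (Runs.loop_of_invariant (fun k s => k ≤ q ∧ s.reg 38 = q - k ∧
      s.reg 39 = X (q - k) ∧ s.reg 40 = Y (q - k) ∧ (∀ x < 38, s.reg x = s₀.reg x) ∧
      Table s.mem (s₀.reg 37) (q - k + 1) (fun k => (X k, Y k)) ∧
      (∀ x, x < s₀.reg 37 ∨ s₀.reg 37 + 2 * (q + 1) ≤ x → s.mem x = s₀.mem x) ∧
      s.clk + k * T ≤ s₀.clk + q * T + 20) ?_ ?_ q ?_)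
  · rintro k s ⟨h1, h2, h3, h4, h5, h6, h7, h8⟩
    rw [add_mul] at h8
    refine ⟨by simp, by simp [h2, h5, h36]; omega, Runs.block ?_⟩
    obtain ⟨m, hm⟩ : ∃ m, q - (k + 1) = m := ⟨_, rfl⟩
    rw [hm] at h2 h3 h4 h6
    rw [show q - k = m + 1 by omega]
    have hXm := hXlt m (by omega)
    have hXm' := hXlt (m + 1) (by omega)
    have hXs := hX m (by omega)
    have hYm := hYle m (by omega)
    have hYs := hY m (by omega)
    simp [wp, h5, h3]
    split_ands <;> try omega
    -- Nothing is known about the second components of this table; the wanted pair `(X m + 1, 0)`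
    -- makes them irrelevant.
    refine Runs.seq (runs_search (n := J)
      (g := fun k => (F k, s.mem (s₀.reg 30 + 2 * k + 1))) (fun j hj => ⟨?_, by simp⟩)
      (by simpa using h31) ?_ (by simp; omega) (by omega) fun s₁ k1 k2 k3 k4 k5 => ?_)
    · simp [h7 _ (.inr (show s₀.reg 37 + 2 * (q + 1) ≤ s₀.reg 30 + 2 * j by omega)), ht j hj]
    · intro i j hij hj h
      have := hF.mono i j hij.le hj.le
      simp [PLt] at *; omega
    simp at k1 k4 k5
    have k2 : ∀ x < 69, s₁.reg x = s.reg x := fun x hx => by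
      rw [k2 x (by omega)]; simp (disch := omega) [Function.update_of_ne]
    obtain ⟨c, hc, c1, c2⟩ := exists_between hF.zero hF.last hXm
    have h84 : s₁.reg 84 = c + 1 := by
      have e1 := (k4 c hc).2 (by simp only [PLt]; omega)
      have e2 : ¬ c + 1 < s₁.reg 84 := fun h => by
        have := (k4 (c + 1) (by omega)).1 h
        simp only [PLt] at this; omega
      omega
    obtain ⟨t1, t2⟩ := context_translate hF hc c1 c2
    obtain ⟨e1, e2⟩ := hE c hc
    have e0 := ht c hc
    rw [← h7 _ (by omega)] at e0 e1 e2
    simp only [← t2] at e2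
    rw [hXs] at t1
    have hFc := lf_iterate_lt (hF.lt c hc) τ
    refine Runs.block ?_
    simp [wp, k2, h5, h84, k1, e0, e1, e2, h3, h4]
    split_ands <;> try omega
    rw [← t1]
    refine Runs.seq (runs_rankStep (n := B'.length) (K := J')
      (key := fun q => name B' (label B' τ q)) (f := (psi B')^[τ])
      (F := F') (g := Y (m + 1)) ?_ (by simpa using h35) (by simpa using hYm)
      (hYle _ (by omega)) ?_ (by simp; omega) (by simp; omega) (by omega)
      fun s₂ j1 j2 j3 j4 => ?_)
    · simpa using hds.congr (fun a _ _ => h7 a (by omega)) fun a _ _ => h7 a (by omega)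
    · intro p hp
      have := lt_rankList_iff (X := context B τ (X m)) hYm hp
      rw [context_length, hYs] at this
      simpa using this
    simp at j1 j4
    have j39 : s₂.reg 39 = X (m + 1) := by rw [j2 39 (by omega)]; simp
    have j2 : ∀ x < 69, x ≠ 39 → s₂.reg x = s.reg x := fun x hx hx' => by
      rw [j2 x (by omega)]; simp (disch := omega) [Function.update_of_ne, k2]
    refine Runs.of_wp ?_
    simp [wp, j2, j3, j39, h2, h5, j1]
    split_ands <;> try omega
    · intro x hx
      simp (disch := omega) [Function.update_of_ne, j2, h5]
    · intro j hj
      rcases Nat.lt_or_ge j (m + 1) with hlt | hge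
      · obtain ⟨e3, e4⟩ := h6 j hlt
        simp (disch := omega) [Function.update_of_ne, e3, e4]
      · obtain rfl : j = m + 1 := by omega
        simp
    · intro x hx
      rw [Function.update_of_ne (by omega), Function.update_of_ne (by omega)]
      exact h7 x hx
  · rintro s ⟨h1, h2, h3, h4, h5, h6, h7, h8⟩
    refine ⟨by simp, by simp [h2, h5, h36], Runs.block ?_⟩
    simp [wp, h5, h36]
    split_ands <;> try omega
    refine runs_sort (n := q + 1) (g := fun k => (X k, Y k)) (by omega)
      (by simpa using h6) (by simp) (by simp; omega) (by simpa using hN)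
      fun s₂ l k1 k2 k3 k4 k5 k6 => ?_
    simp at k4 k6
    simp only [] at k3
    refine hQ s₂ l k1 k2 ?_ (fun x hx => ?_) (fun x hx => ?_) ?_
    · simpa using k3
    · rw [k4 x (by omega), h7 x (by omega)]
    · rw [k5 x (by omega)]; simp (disch := omega) [Function.update_of_ne, h5]
    · omega
  · refine ⟨le_rfl, by simp, by simp [hX0], by simp [hY0], fun x hx => ?_, fun j hj => ?_,
      fun x hx => ?_, ?_⟩
    · simp (disch := omega) [Function.update_of_ne]
    · obtain rfl : j = 0 := by omega
      simp [hX0, hY0]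
    · simp only
      rw [Function.update_of_ne (by omega), Function.update_of_ne (by omega)]
    · dsimp only; omega

end WordRAM

/-! ## Construction of the data structure -/

namespace WordRAM

open WordRAM.Expr WordRAM.Prog Bwt

/-- The contents of the registers during the construction: the parameters, the number of composite
steps, the addresses of the tables, and the sizes of the auxiliary tables. -/
def layout (τ m m' r r' q : ℕ) : ℕ → ℕ
  | 0 => τ
  | 1 => m
  | 2 => m'
  | 3 => r
  | 4 => r'
  | 5 => q
  | 6 => 8
  | 7 => 10 + 2 * r
  | 8 => 12 + 2 * r + 2 * r'
  | 9 => 14 + 4 * r + 2 * r'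
  | 10 => 16 + 6 * r + 2 * r'
  | 11 => 18 + 6 * r + 4 * r'
  | 12 => 20 + 6 * r + 6 * r'
  | 13 => 22 + 6 * r + 6 * r' + 2 * q
  | 14 => 22 + 6 * r + 6 * r' + 2 * q + 2 * (r * τ)
  | 15 => 22 + 6 * r + 6 * r' + 2 * q + 4 * (r * τ)
  | 16 => 22 + 6 * r + 6 * r' + 2 * q + 4 * (r * τ) + 2 * (r' * τ)
  | 17 => 24 + 6 * r + 6 * r' + 2 * q + 4 * (r * τ) + 4 * (r' * τ)
  | 18 => r * τ
  | 19 => r' * τ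
  | _ => 0

/-- The number of words that the construction uses. -/
def buildSpace (r r' τ q : ℕ) : ℕ :=
  26 + 6 * r + 6 * r' + 4 * q + 6 * (r * τ) + 6 * (r' * τ)

/-- The number of words of the data structure. -/
def dsSpace (r r' q : ℕ) : ℕ := 22 + 6 * r + 6 * r' + 2 * q

/-- Computation of the layout. -/
def setLayout : Prog :=
  -- The number of block steps that fit to the left of the last position.
  assign 5 ((reg 1 - 1) / reg 0) ;; assign 6 8 ;; assign 7 (10 + 2 * reg 3) ;;
  assign 8 (reg 7 + 2 + 2 * reg 4) ;; assign 9 (reg 8 + 2 + 2 * reg 3) ;;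
  assign 10 (reg 9 + 2 + 2 * reg 3) ;; assign 11 (reg 10 + 2 + 2 * reg 4) ;;
  assign 12 (reg 11 + 2 + 2 * reg 4) ;; assign 13 (reg 12 + 2 + 2 * reg 5) ;;
  assign 18 (reg 3 * reg 0) ;; assign 19 (reg 4 * reg 0) ;;
  assign 14 (reg 13 + 2 * reg 18) ;; assign 15 (reg 14 + 2 * reg 18) ;;
  assign 16 (reg 15 + 2 * reg 19) ;; assign 17 (reg 16 + 2 + 2 * reg 19)

theorem runs_setLayout {E : Env} {s₀ : NatState} {Q : NatState → Prop} {τ m m' r r' q : ℕ}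
    (hm : 0 < m) (hq : q = (m - 1) / τ)
    (h0 : s₀.reg 0 = τ) (h1 : s₀.reg 1 = m) (h2 : s₀.reg 2 = m') (h3 : s₀.reg 3 = r)
    (h4 : s₀.reg 4 = r') (hM : buildSpace r r' τ q < E.M)
    (hQ : ∀ s', s'.mem = s₀.mem → (∀ x < 20, s'.reg x = layout τ m m' r r' q x) →
      s'.clk ≤ s₀.clk + 120 → Q s') :
    Runs E setLayout s₀ Q := by
  unfold buildSpace at hM
  refine Runs.of_wp ?_
  simp [setLayout, wp, h0, h1, h3, h4, ← hq]
  split_ands <;> try omega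
  refine hQ _ rfl (fun x hx => ?_) (by dsimp only; omega)
  interval_cases x <;> simp [layout, h0, h1, h2, h3, h4] <;> omega

/-- Moving the input to its place. -/
def relocate : Prog :=
  -- The second string has to move first, since the new place of the first one may overlap the old
  -- place of the second.
  (assign 60 (2 * reg 3) ;; assign 61 (reg 7) ;; assign 62 (reg 4)) ;; moveUp ;;
  (assign 60 0 ;; assign 61 (reg 6) ;; assign 62 (reg 3)) ;; moveUp ;;
  -- The sentinels: a final entry with the length of the string, so that the last run also has a
  -- successor.
  (store (reg 6 + 2 * reg 3) (reg 1) ;; store (reg 6 + 2 * reg 3 + 1) 0 ;;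
   store (reg 7 + 2 * reg 4) (reg 2) ;; store (reg 7 + 2 * reg 4 + 1) 0)

/-- The table of the runs of a string. -/
def RunTable (mem : ℕ → ℕ) (a : ℕ) (B : List ℕ) : Prop :=
  Table mem a ((runStarts B).length + 1) fun k => (runStart B k, B.getD (runStart B k) 0)

theorem runTable_of_table {mem : ℕ → ℕ} {a : ℕ} {B : List ℕ}
    (h : Table mem a (runStarts B).length fun k => (runStart B k, B.getD (runStart B k) 0))
    (h1 : mem (a + 2 * (runStarts B).length) = B.length)
    (h2 : mem (a + 2 * (runStarts B).length + 1) = 0) : RunTable mem a B := fun k hk => by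
  rcases Nat.lt_or_ge k (runStarts B).length with hlt | hge
  · exact h k hlt
  · obtain rfl : k = (runStarts B).length := by omega
    simp only [runStart_length]
    exact ⟨h1, by rw [h2]; simp⟩

theorem runs_relocate {E : Env} {s₀ : NatState} {Q : NatState → Prop} {B B' : List ℕ} {τ q : ℕ}
    (hL : ∀ x < 20, s₀.reg x =
      layout τ B.length B'.length (runStarts B).length (runStarts B').length q x)
    (ht : Table s₀.mem 0 (runStarts B).length
      fun k => (runStart B k + 1, B.getD (runStart B k) 0))
    (ht' : Table s₀.mem (2 * (runStarts B).length) (runStarts B').length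
      fun k => (runStart B' k + 1, B'.getD (runStart B' k) 0))
    (hN : dsSpace (runStarts B).length (runStarts B').length q ≤ E.N) (hM : 4 * E.N + 10 ≤ E.M)
    (hQ : ∀ s', RunTable s'.mem 8 B → RunTable s'.mem (10 + 2 * (runStarts B).length) B' →
      (∀ x < 20, s'.reg x = s₀.reg x) →
      s'.clk ≤ s₀.clk + 40 * (runStarts B).length + 40 * (runStarts B').length + 70 → Q s') :
    Runs E relocate s₀ Q := by
  unfold dsSpace at hN
  generalize hr : (runStarts B).length = r at *
  generalize hr' : (runStarts B').length = r' at *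
  refine Runs.block ?_
  simp [wp, hL, layout]
  split_ands <;> try omega
  refine Runs.seq (runs_moveUp (n := r') (g := fun k => (runStart B' k, B'.getD (runStart B' k) 0))
    (by simpa using ht') (by simp) (by simp; omega) (by simp; omega) (by omega)
    fun s₁ h1 h2 h3 h4 => ?_)
  simp only [] at h1
  simp at h2 h4
  rw [Function.update_of_ne (by omega), Function.update_self] at h1
  have h3 : ∀ x < 20, s₁.reg x = s₀.reg x := fun x hx => by
    rw [h3 x (by omega)]; simp (disch := omega) [Function.update_of_ne]
  refine Runs.block ?_
  simp [wp, h3, hL, layout]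
  split_ands <;> try omega
  refine Runs.seq (runs_moveUp (n := r) (g := fun k => (runStart B k, B.getD (runStart B k) 0))
    ?_ (by simp) (by simp) (by simp; omega) (by omega)
    fun s₂ k1 k2 k3 k4 => ?_)
  · simpa using ht.congr fun a _ _ => h2 a (by omega)
  simp only [] at k1
  simp at k2 k4
  rw [Function.update_of_ne (by omega), Function.update_self] at k1
  have k3 : ∀ x < 20, s₂.reg x = s₀.reg x := fun x hx => by
    rw [k3 x (by omega)]; simp (disch := omega) [Function.update_of_ne, h3]
  refine Runs.of_wp ?_
  simp [wp, k3, hL, layout]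
  split_ands <;> try omega
  refine hQ _ (runTable_of_table ?_ ?_ ?_) (runTable_of_table ?_ ?_ ?_) k3 ?_
  · rw [hr]
    exact k1.congr fun a _ _ => by
      simp only
      rw [Function.update_of_ne (by omega), Function.update_of_ne (by omega),
        Function.update_of_ne (by omega), Function.update_of_ne (by omega)]
  · rw [hr]; simp (disch := omega) [Function.update_of_ne]
  · rw [hr]; simp (disch := omega) [Function.update_of_ne]
  · rw [hr']
    exact h1.congr fun a _ _ => by
      simp only
      rw [Function.update_of_ne (by omega), Function.update_of_ne (by omega),
        Function.update_of_ne (by omega), Function.update_of_ne (by omega), k2 a (by omega)]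
  · rw [hr']; simp (disch := omega) [Function.update_of_ne]
  · rw [hr']; simp
  · dsimp only; omega

/-- Construction of the tables of both strings. -/
def buildStrings : Prog :=
  (assign 60 (reg 6) ;; assign 61 (reg 8) ;; assign 62 (reg 9) ;; assign 63 (reg 3) ;;
   assign 64 (reg 17)) ;; indexString ;;
  (assign 60 (reg 7) ;; assign 61 (reg 10) ;; assign 62 (reg 11) ;; assign 63 (reg 4) ;;
   assign 64 (reg 17)) ;; indexString

/-- The tables of both strings at their places. -/
structure StringTables (mem : ℕ → ℕ) (B B' : List ℕ) (l l' : List (ℕ × ℕ)) : Prop where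
  fst : StringDS mem 8 (12 + 2 * (runStarts B).length + 2 * (runStarts B').length)
    (14 + 4 * (runStarts B).length + 2 * (runStarts B').length) B l
  snd : StringDS mem (10 + 2 * (runStarts B).length)
    (16 + 6 * (runStarts B).length + 2 * (runStarts B').length)
    (18 + 6 * (runStarts B).length + 4 * (runStarts B').length) B' l'

theorem below_fst (B B' : List ℕ) : StringDS.Below
    (20 + 6 * (runStarts B).length + 6 * (runStarts B').length) 8
    (12 + 2 * (runStarts B).length + 2 * (runStarts B').length)
    (14 + 4 * (runStarts B).length + 2 * (runStarts B').length) B :=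
  ⟨by omega, by omega, by omega⟩

theorem below_snd (B B' : List ℕ) : StringDS.Below
    (20 + 6 * (runStarts B).length + 6 * (runStarts B').length) (10 + 2 * (runStarts B).length)
    (16 + 6 * (runStarts B).length + 2 * (runStarts B').length)
    (18 + 6 * (runStarts B).length + 4 * (runStarts B').length) B' :=
  ⟨by omega, by omega, by omega⟩

theorem StringTables.congr {mem mem' : ℕ → ℕ} {B B' : List ℕ} {l l' : List (ℕ × ℕ)}
    (h : StringTables mem B B' l l')
    (hm : ∀ a < 20 + 6 * (runStarts B).length + 6 * (runStarts B').length,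
      8 ≤ a → mem' a = mem a) : StringTables mem' B B' l l' := by
  refine ⟨⟨h.fst.pos, h.fst.sorted, h.fst.tabA.congr ?_, h.fst.ds.congr ?_ ?_⟩,
    ⟨h.snd.pos, h.snd.sorted, h.snd.tabA.congr ?_, h.snd.ds.congr ?_ ?_⟩⟩ <;>
  exact fun a _ _ => hm a (by omega) (by omega)

/-- A bound on the time of `indexString`. -/
def indexCost (r : ℕ) : ℕ := sortCost r + r * (searchCost r + 140) + 70

theorem runs_buildStrings {E : Env} {s₀ : NatState} {Q : NatState → Prop} {B B' : List ℕ}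
    {τ q : ℕ} (hτ : 0 < τ) (hB : 0 < B.length) (hB' : 0 < B'.length)
    (hL : ∀ x < 20, s₀.reg x =
      layout τ B.length B'.length (runStarts B).length (runStarts B').length q x)
    (hA : RunTable s₀.mem 8 B) (hA' : RunTable s₀.mem (10 + 2 * (runStarts B).length) B')
    (hN : buildSpace (runStarts B).length (runStarts B').length τ q ≤ E.N)
    (hM : 4 * E.N + 4 * B.length + 4 * B'.length + 10 ≤ E.M)
    (hQ : ∀ s' l l', StringTables s'.mem B B' l l' → (∀ x < 20, s'.reg x = s₀.reg x) →
      s'.clk ≤ s₀.clk + indexCost (runStarts B).length + indexCost (runStarts B').length → Q s') :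
    Runs E buildStrings s₀ Q := by
  unfold buildSpace at hN
  unfold indexCost at hQ
  have hJ := Nat.le_mul_of_pos_right (runStarts B).length hτ
  have hJ' := Nat.le_mul_of_pos_right (runStarts B').length hτ
  refine Runs.block ?_
  simp [wp, hL, layout]
  refine Runs.seq (runs_indexString hB (by simpa [RunTable] using hA) (by simp) (by simp; omega)
    (by simp; omega) (by simp; omega) (by simp; omega) (by omega) fun s₁ l h1 h2 h3 h4 => ?_)
  simp at h1 h2 h4
  have h3 : ∀ x < 20, s₁.reg x = s₀.reg x := fun x hx => by
    rw [h3 x (by omega)]; simp (disch := omega) [Function.update_of_ne]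
  refine Runs.block ?_
  simp [wp, h3, hL, layout]
  refine runs_indexString hB' ?_ (by simp) (by simp; omega)
    (by simp; omega) (by simp; omega) (by simp; omega) (by omega) fun s₂ l' k1 k2 k3 k4 => ?_
  · have : RunTable s₁.mem (10 + 2 * (runStarts B).length) B' :=
      hA'.congr fun a _ _ => h2 a (by omega)
    simpa [RunTable] using this
  simp at k1 k2 k4
  have hb := below_fst B B'
  refine hQ s₂ l l' ⟨⟨h1.pos, h1.sorted, h1.tabA.congr ?_, h1.ds.congr ?_ ?_⟩, k1⟩
    (fun x hx => ?_) ?_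
  iterate 3 exact fun a _ _ => k2 a (by omega)
  · rw [k3 x (by omega)]; simp (disch := omega) [Function.update_of_ne, h3]
  · omega

end WordRAM

/-! ### The tables of the block steps -/

namespace WordRAM

open WordRAM.Expr WordRAM.Prog Bwt

/-- Construction of the tables of the composite steps. -/
def buildSteps : Prog :=
  (assign 60 (reg 6) ;; assign 61 (reg 3) ;; assign 62 (reg 0) ;; assign 63 (reg 13) ;;
   assign 59 (reg 17) ;; assign 71 (reg 9) ;; assign 72 (reg 3)) ;; sortOrbits psiStep ;;
  (assign 60 (reg 11) ;; assign 61 (reg 4) ;; assign 62 (reg 0) ;; assign 63 (reg 16) ;;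
   assign 59 (reg 17) ;; assign 69 (reg 7) ;; assign 70 (reg 10) ;; assign 71 (reg 11) ;;
   assign 72 (reg 4)) ;; sortOrbits lfStep ;;
  (assign 30 (reg 13) ;; assign 31 (reg 18) ;; assign 32 (reg 14) ;; assign 33 0 ;;
   assign 40 (reg 6) ;; assign 41 (reg 8) ;; assign 42 (reg 9) ;; assign 43 (reg 3) ;;
   assign 44 (reg 10) ;; assign 45 (reg 11) ;; assign 46 (reg 4) ;; assign 47 (reg 2) ;;
   assign 48 (reg 0)) ;; walkLoop ;;
  (assign 30 (reg 16) ;; assign 31 (reg 19) ;; assign 32 (reg 15) ;; assign 33 0 ;;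
   assign 40 (reg 7) ;; assign 41 (reg 10) ;; assign 42 (reg 11) ;; assign 43 (reg 4) ;;
   assign 44 (reg 10) ;; assign 45 (reg 11) ;; assign 46 (reg 4) ;; assign 47 (reg 2) ;;
   assign 48 (reg 0)) ;; preimageLoop

/-- A bound on the time of `buildSteps`. -/
def stepsCost (r r' τ : ℕ) : ℕ :=
  orbitCost (r * τ) (searchCost r + 100) + orbitCost (r' * τ) (2 * (searchCost r' + 100)) +
    r * τ * (walkCost r r' τ + 50) + r' * τ * preimageCost r' τ + 150

/-- The two strings play dual roles. In `S` the map LF is iterated: it breaks at run starts, so its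
iterates break on their orbits under `psi`. In `S'` the map `psi` is iterated: it breaks at the
images of runs, so its iterates break on their orbits under `lf`. -/
theorem runs_buildSteps {E : Env} {s₀ : NatState} {Q : NatState → Prop} {B B' : List ℕ}
    {l l' : List (ℕ × ℕ)} {τ q P : ℕ} (hτ : 0 < τ)
    (hL : ∀ x < 20, s₀.reg x =
      layout τ B.length B'.length (runStarts B).length (runStarts B').length q x)
    (hS : StringTables s₀.mem B B' l l')
    (hP : P = 22 + 6 * (runStarts B).length + 6 * (runStarts B').length + 2 * q)
    (hN : buildSpace (runStarts B).length (runStarts B').length τ q ≤ E.N)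
    (hM : 4 * E.N + 4 * B.length + 8 * B'.length + 10 ≤ E.M)
    (hQ : ∀ s' F F',
      SortedPoints B.length ((runStarts B).length * τ) τ (psi B)
        {x | ∃ k < (runStarts B).length, x = runStart B k} F →
      (∀ k < (runStarts B).length * τ, s'.mem (P + 2 * k) = F k) →
      Table s'.mem (P + 2 * ((runStarts B).length * τ)) ((runStarts B).length * τ)
        (fun k => ((lf B)^[τ] (F k), name B' (context B τ (F k)))) →
      RankDS s'.mem (P + 4 * ((runStarts B).length * τ))
        (P + 4 * ((runStarts B).length * τ) + 2 * ((runStarts B').length * τ)) B'.length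
        ((runStarts B').length * τ) (fun q => name B' (label B' τ q)) (psi B')^[τ] F' →
      StringTables s'.mem B B' l l' → (∀ x < 20, s'.reg x = s₀.reg x) →
      s'.clk ≤ s₀.clk + stepsCost (runStarts B).length (runStarts B').length τ → Q s') :
    Runs E buildSteps s₀ Q := by
  unfold buildSpace at hN
  unfold stepsCost at hQ
  have hB := hS.fst.pos
  have hB' := hS.snd.pos
  have hr0 := runStarts_length_pos hB
  have hr0' := runStarts_length_pos hB'
  generalize hr : (runStarts B).length = r at *
  generalize hr' : (runStarts B').length = r' at *
  generalize hJ : r * τ = J at *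
  generalize hJ' : r' * τ = J' at *
  have hJr : r ≤ J := hJ ▸ Nat.le_mul_of_pos_right r hτ
  have hJr' : r' ≤ J' := hJ' ▸ Nat.le_mul_of_pos_right r' hτ
  have hb := below_fst B B'
  have hb' := below_snd B B'
  obtain ⟨hf, hf'⟩ := hS
  rw [hr, hr'] at hb hb' hf hf'
  have hz := runStart_zero hB
  have hz' := hf'.sorted.runImage_zero hB'
  refine Runs.block ?_
  simp [wp, hL, layout]
  refine Runs.seq (runs_sortOrbits (n := B.length) (K := r) (τ := τ) (T := searchCost r + 100)
    (h := psi B) (src := runStart B) hτ hr0 hz (fun k hk => runStart_lt (hr ▸ hk))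
    (fun x hx => psi_lt hx) ?_ ?_ (by simp) (by simp) (by simp; omega) (by simp [hJ]; omega)
    (by simp [hJ]; omega) (by omega) fun s₁ F h1 h2 h3 h4 h5 => ?_)
  · intro s e1 e2 e3 Q' hQ'
    simp at e1
    have e71 := e2 71 (by omega) (by omega)
    have e72 := e2 72 (by omega) (by omega)
    simp at e71 e72
    have hds : StringDS s.mem 8 (12 + 2 * r + 2 * r') (14 + 4 * r + 2 * r') B l :=
      hf.congr hb fun a ha => e1 a (by omega)
    exact runs_psiStep (by rw [e71]; exact hds.ds) (by rw [e72, hr]) e3 (psi_lt e3)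
      (by rw [e71, hr]; omega) (by omega) fun s' i1 i2 i3 i4 =>
        hQ' s' i1 (fun x hx => i2 x (by omega)) i3 (hr ▸ i4)
  · intro k hk
    simpa using (hf.tabA k (by omega)).1
  rw [hJ] at h1 h2 h3 h5
  simp at h2 h3 h5
  have h4 : ∀ x < 20, s₁.reg x = s₀.reg x := fun x hx => by
    rw [h4 x (by omega)]; simp (disch := omega) [Function.update_of_ne]
  have hf₁ := hf.congr (mem' := s₁.mem) hb fun a ha => h3 a (by omega)
  have hf₁' := hf'.congr (mem' := s₁.mem) hb' fun a ha => h3 a (by omega)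
  refine Runs.block ?_
  simp [wp, h4, hL, layout]
  refine Runs.seq (runs_sortOrbits (n := B'.length) (K := r') (τ := τ)
    (T := 2 * (searchCost r' + 100)) (h := lf B') (src := runImage B' l') hτ hr0' hz'
    (fun k hk => hf'.ds.pieces.lt k (hr' ▸ hk)) (fun x hx => lf_lt hx) ?_ ?_ (by simp) (by simp)
    (by simp; omega) (by simp [hJ, hJ']; omega) (by simp [hJ, hJ']; omega) (by omega)
    fun s₂ F' k1 k2 k3 k4 k5 => ?_)
  · intro s e1 e2 e3 Q' hQ'
    simp [hJ, hJ'] at e1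
    have e69 := e2 69 (by omega) (by omega)
    have e70 := e2 70 (by omega) (by omega)
    have e71 := e2 71 (by omega) (by omega)
    have e72 := e2 72 (by omega) (by omega)
    simp at e69 e70 e71 e72
    have hds := hf₁'.congr (mem' := s.mem) hb' fun a ha => e1 a (by omega)
    exact runs_lfStep (l := l') (by rw [e69, e70, e71]; exact hds) (by rw [e72, hr']) e3
      (by rw [e69, hr']; omega) (by rw [e70, hr']; omega) (by rw [e71, hr']; omega) (by omega)
      fun s' i1 i2 i3 i4 i5 => hQ' s' i1 i2 i4 (hr' ▸ i5)
  · intro k hk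
    simpa using (hf₁'.ds.tabF k (by omega)).1
  rw [hJ'] at k1 k2 k3 k5
  simp [hJ] at k2 k3 k5
  have k4 : ∀ x < 20, s₂.reg x = s₀.reg x := fun x hx => by
    rw [k4 x (by omega)]; simp (disch := omega) [Function.update_of_ne, h4]
  have hf₂ := hf₁.congr (mem' := s₂.mem) hb fun a ha => k3 a (by omega)
  have hf₂' := hf₁'.congr (mem' := s₂.mem) hb' fun a ha => k3 a (by omega)
  refine Runs.block ?_
  simp [wp, k4, hL, layout, hJ]
  split_ands <;> try omega
  refine Runs.seq (runs_walkLoop (B := B) (B' := B') (l := l) (l' := l') (aA' := 10 + 2 * r)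
    (τ := τ) (J := J) (D := 20 + 6 * r + 6 * r') (F := F) (by simpa using hf₂) (by simpa using hf₂')
    (by simp [hr]) (by simp [hr']) (by simp) (by simp) (by simp) (by simp) h1.lt ?_
    (by simpa using hb) (by simpa using hb') (by simp; omega) (by simp) (by simp; omega)
    (by omega) fun s₃ j1 j2 j3 j4 => ?_)
  · intro k hk
    simp
    rw [k3 _ (by omega), h2 k hk]
  simp only [] at j1
  simp [hr, hr'] at j1 j2 j4
  have j3 : ∀ x < 20, s₃.reg x = s₀.reg x := fun x hx => by
    rw [j3 x (by omega)]; simp (disch := omega) [Function.update_of_ne, k4]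
  have hf₃ := hf₂.congr (mem' := s₃.mem) hb fun a ha => j2 a (by omega)
  have hf₃' := hf₂'.congr (mem' := s₃.mem) hb' fun a ha => j2 a (by omega)
  refine Runs.block ?_
  simp [wp, j3, hL, layout, hJ, hJ']
  split_ands <;> try omega
  refine runs_preimageLoop (B := B') (l := l') (τ := τ) (J := J') (D := 20 + 6 * r + 6 * r')
    (F := F') (by simpa using hf₃') (by simp) (by simp) (by simp [hr']) (by simp [hr']) (by simp)
    (by simp) (by simp) (by simp) (by rw [hr']; exact k1) ?_ (by simpa using hb') (by simp; omega)
    (by simp) (by simp; omega) (by omega) fun s₄ i1 i2 i3 i4 => ?_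
  · intro k hk
    simp
    rw [j2 _ (by omega), k2 k hk]
  simp [hr'] at i1 i2 i4
  refine hQ s₄ F F' h1 (fun k hk => ?_) ?_ ?_ ⟨?_, ?_⟩ (fun x hx => ?_) ?_
  · rw [i2 _ (by omega), j2 _ (by omega), k3 _ (by omega), hP, h2 k hk]
  · rw [hP]
    exact j1.congr fun a _ _ => i2 a (by omega)
  · rw [hP]; exact i1
  · rw [hr, hr']; exact hf₃.congr hb fun a ha => i2 a (by omega)
  · rw [hr, hr']; exact hf₃'.congr hb' fun a ha => i2 a (by omega)
  · rw [i3 x (by omega)]; simp (disch := omega) [Function.update_of_ne, j3]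
  · omega

end WordRAM

/-! ### The complete construction -/

namespace WordRAM

open WordRAM.Expr WordRAM.Prog Bwt

/-- The data structure: a header, the tables of both strings, and the sorted samples. -/
structure QueryDS (mem : ℕ → ℕ) (B B' : List ℕ) (X Y : ℕ → ℕ) (q : ℕ) : Prop where
  runs_fst : mem 0 = (runStarts B).length
  runs_snd : mem 1 = (runStarts B').length
  numSamples : mem 2 = q + 1
  strings : ∃ l l', StringTables mem B B' l l'
  samples : ∃ l : List (ℕ × ℕ), l.Perm ((List.range (q + 1)).map fun k => (X k, Y k)) ∧
    l.Pairwise PLe ∧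
    Table mem (20 + 6 * (runStarts B).length + 6 * (runStarts B').length) (q + 1)
      fun k => l.getD k (0, 0)

/-- The construction of the data structure. -/
def build : Prog :=
  setLayout ;; relocate ;; buildStrings ;; buildSteps ;;
  (assign 30 (reg 13) ;; assign 31 (reg 18) ;; assign 32 (reg 14) ;; assign 33 (reg 15) ;;
   assign 34 (reg 16) ;; assign 35 (reg 19) ;; assign 36 (reg 5) ;; assign 37 (reg 12) ;;
   assign 29 (reg 17)) ;; sampleLoop ;;
  -- The header is written last, because the input starts at address 0; all tables lie at addresses
  -- from 8 on.
  (store 0 (reg 3) ;; store 1 (reg 4) ;; store 2 (reg 5 + 1))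

/-- A bound on the time of the construction. -/
def buildCost (r r' τ q : ℕ) : ℕ :=
  40 * r + 40 * r' + indexCost r + indexCost r' + stepsCost r r' τ +
    sampleCost (r * τ) (r' * τ) q + 300

theorem runs_build {E : Env} {s₀ : NatState} {Q : NatState → Prop} {B B' : List ℕ}
    {X Y : ℕ → ℕ} {τ q : ℕ} (hτ : 0 < τ) (hB : 0 < B.length) (hB' : 0 < B'.length)
    (hq : q = (B.length - 1) / τ)
    (h0 : s₀.reg 0 = τ) (h1 : s₀.reg 1 = B.length) (h2 : s₀.reg 2 = B'.length)
    (h3 : s₀.reg 3 = (runStarts B).length) (h4 : s₀.reg 4 = (runStarts B').length)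
    (ht : Table s₀.mem 0 (runStarts B).length
      fun k => (runStart B k + 1, B.getD (runStart B k) 0))
    (ht' : Table s₀.mem (2 * (runStarts B).length) (runStarts B').length
      fun k => (runStart B' k + 1, B'.getD (runStart B' k) 0))
    (hX0 : X 0 = 0) (hY0 : Y 0 = 0) (hX : ∀ k < q, (lf B)^[τ] (X k) = X (k + 1))
    (hY : ∀ k < q, rankList B' (context B τ (X k)) (Y k) = Y (k + 1))
    (hXlt : ∀ k ≤ q, X k < B.length) (hYle : ∀ k ≤ q, Y k ≤ B'.length)
    (hN : buildSpace (runStarts B).length (runStarts B').length τ q ≤ E.N)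
    (hM : 4 * E.N + 4 * B.length + 8 * B'.length + 10 ≤ E.M)
    (hQ : ∀ s', QueryDS s'.mem B B' X Y q →
      s'.clk ≤ s₀.clk + buildCost (runStarts B).length (runStarts B').length τ q → Q s') :
    Runs E build s₀ Q := by
  have hN₀ := hN
  unfold buildSpace at hN
  unfold buildCost at hQ
  refine Runs.seq (runs_setLayout hB hq h0 h1 h2 h3 h4 (by omega) fun s₁ a1 a2 a3 => ?_)
  refine Runs.seq (runs_relocate (q := q) (τ := τ) a2 (by rwa [a1]) (by rwa [a1])
    (by unfold dsSpace; omega) (by omega) fun s₂ b1 b2 b3 b4 => ?_)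
  have b3 := fun x hx => (b3 x hx).trans (a2 x hx)
  refine Runs.seq (runs_buildStrings hτ hB hB' b3 b1 b2 hN₀ (by omega)
    fun s₃ l l' c1 c2 c3 => ?_)
  have c2 := fun x hx => (c2 x hx).trans (b3 x hx)
  refine Runs.seq (runs_buildSteps hτ c2 c1 rfl hN₀ hM fun s₄ F F' d1 d2 d3 d4 d5 d6 d7 => ?_)
  have d6 := fun x hx => (d6 x hx).trans (c2 x hx)
  refine Runs.block ?_
  simp [wp, d6, layout]
  refine Runs.seq (runs_sampleLoop (B := B) (B' := B') (τ := τ)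
    (J := (runStarts B).length * τ) (J' := (runStarts B').length * τ) (q := q) (F := F) (F' := F')
    (X := X) (Y := Y) d1 (by simpa using d2) (by simpa using d3) (by simpa using d4) (by simp)
    (by simp) (by simp) hX0 hY0 hX hY hXlt hYle (by simp; omega) (by simp) (by simp; omega)
    (by simp) (by simp; omega) (by simp; omega) (by omega) fun s₅ ls e1 e2 e3 e4 e5 e6 => ?_)
  simp at e4 e6
  simp only [] at e3
  rw [Function.update_of_ne (by omega), Function.update_self] at e3
  have e5 : ∀ x < 20, s₅.reg x =
      layout τ B.length B'.length (runStarts B).length (runStarts B').length q x := fun x hx => by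
    rw [e5 x (by omega)]; simp (disch := omega) [Function.update_of_ne, d6]
  refine Runs.of_wp ?_
  simp [wp, e5, layout]
  split_ands <;> try omega
  have hm : ∀ x, 3 ≤ x → Function.update (Function.update (Function.update s₅.mem 0
      (runStarts B).length) 1 (runStarts B').length) 2 (q + 1) x = s₅.mem x := fun x hx => by
    rw [Function.update_of_ne (by omega), Function.update_of_ne (by omega),
      Function.update_of_ne (by omega)]
  refine hQ _ ⟨by simp, by simp, by simp, ⟨l, l', d5.congr fun a ha ha' => ?_⟩,
    ⟨ls, e1, e2, e3.congr fun a ha _ => hm a (by omega)⟩⟩ ?_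
  · simp only
    rw [hm a (by omega), e4 a (by omega)]
  · dsimp only; omega

end WordRAM

/-! ## Queries -/

namespace WordRAM

open WordRAM.Expr WordRAM.Prog Bwt

theorem QueryDS.congr {mem mem' : ℕ → ℕ} {B B' : List ℕ} {X Y : ℕ → ℕ} {q : ℕ}
    (h : QueryDS mem B B' X Y q)
    (hm : ∀ a < dsSpace (runStarts B).length (runStarts B').length q, mem' a = mem a) :
    QueryDS mem' B B' X Y q := by
  unfold dsSpace at hm
  obtain ⟨l, l', hl⟩ := h.strings
  obtain ⟨ls, h1, h2, h3⟩ := h.samples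
  exact ⟨by rw [hm _ (by omega), h.runs_fst], by rw [hm _ (by omega), h.runs_snd],
    by rw [hm _ (by omega), h.numSamples], ⟨l, l', hl.congr fun a ha _ => hm a (by omega)⟩,
    ⟨ls, h1, h2, h3.congr fun a _ _ => hm a (by omega)⟩⟩

/-- Search for the last sample whose first component is at most `reg 0`: the samples are at
`reg 12`, their number is in `reg 5`. -/
def findSample : Prog :=
  (assign 80 (reg 12) ;; assign 81 (reg 5) ;; assign 82 (reg 0 + 1) ;; assign 83 0) ;; search

/-- Because the first components are sorted, the last sample not exceeding the given rank hits it as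
soon as some sample does. `X 0 = 0` guarantees that there is such a sample at all. -/
theorem runs_findSample {E : Env} {s₀ : NatState} {Q : NatState → Prop} {X Y : ℕ → ℕ} {q a : ℕ}
    {l : List (ℕ × ℕ)} (hl : l.Perm ((List.range (q + 1)).map fun k => (X k, Y k)))
    (hs : l.Pairwise PLe) (ht : Table s₀.mem a (q + 1) fun k => l.getD k (0, 0))
    (hX0 : X 0 = 0) (ha : s₀.reg 12 = a) (h5 : s₀.reg 5 = q + 1)
    (hN : a + 2 * (q + 1) ≤ E.N) (hM : 4 * E.N + s₀.reg 0 + 10 ≤ E.M)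
    (hQ : ∀ s' c k, s'.mem = s₀.mem → (∀ x < 80, s'.reg x = s₀.reg x) → s'.reg 84 = c + 1 →
      c ≤ q → k ≤ q → s₀.mem (a + 2 * c) = X k → s₀.mem (a + 2 * c + 1) = Y k →
      X k ≤ s₀.reg 0 → (∀ j ≤ q, X j = s₀.reg 0 → X k = s₀.reg 0) →
      s'.clk ≤ s₀.clk + searchCost (q + 1) + 20 → Q s') :
    Runs E findSample s₀ Q := by
  have hlen : l.length = q + 1 := by rw [hl.length_eq]; simp
  have hmono : ∀ i j, i ≤ j → j < q + 1 → (l.getD i (0, 0)).1 ≤ (l.getD j (0, 0)).1 := by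
    intro i j hij hj
    rcases hij.eq_or_lt with rfl | hij
    · exact le_rfl
    rw [List.getD_eq_getElem _ _ (by omega), List.getD_eq_getElem _ _ (by omega)]
    have := List.pairwise_iff_getElem.1 hs i j (by omega) (by omega) hij
    simp only [PLe, PLt] at this; omega
  have hmem : ∀ c < q + 1, ∃ k ≤ q, l.getD c (0, 0) = (X k, Y k) := by
    intro c hc
    have : l.getD c (0, 0) ∈ l := by
      rw [List.getD_eq_getElem _ _ (by omega)]; exact List.getElem_mem _
    obtain ⟨k, hk, he⟩ := List.mem_map.1 (hl.mem_iff.1 this)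
    exact ⟨k, by have := List.mem_range.1 hk; omega, he.symm⟩
  have hsurj : ∀ k ≤ q, ∃ c < q + 1, l.getD c (0, 0) = (X k, Y k) := by
    intro k hk
    have : (X k, Y k) ∈ l :=
      hl.mem_iff.2 (List.mem_map.2 ⟨k, List.mem_range.2 (by omega), rfl⟩)
    obtain ⟨c, hc, he⟩ := List.getElem_of_mem this
    exact ⟨c, by omega, by rw [List.getD_eq_getElem _ _ hc, he]⟩
  refine Runs.block ?_
  simp [wp, ha, h5]
  split_ands <;> try omega
  refine runs_search (n := q + 1) (g := fun k => l.getD k (0, 0)) (by simpa using ht) (by simp)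
    ?_ (by simpa using hN) (by omega) fun s₁ k1 k2 k3 k4 k5 => ?_
  · intro i j hij hj h
    have := hmono i j hij.le hj
    simp [PLt, -List.getD_eq_getElem?_getD] at *; omega
  simp only [Function.update_self] at k1 k4 k5
  rw [Function.update_of_ne (by omega), Function.update_self] at k4
  have k4 : ∀ c < q + 1, c < s₁.reg 84 ↔ (l.getD c (0, 0)).1 ≤ s₀.reg 0 := fun c hc => by
    rw [k4 c hc]; simp only [PLt]; omega
  have hpos : 0 < s₁.reg 84 := by
    obtain ⟨c, hc, he⟩ := hsurj 0 (by omega)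
    have := (k4 c hc).2 (by rw [he, hX0]; omega)
    omega
  obtain ⟨c, hc⟩ : ∃ c, s₁.reg 84 = c + 1 := ⟨s₁.reg 84 - 1, by omega⟩
  obtain ⟨k, hk, he⟩ := hmem c (by omega)
  have hle := (k4 c (by omega)).1 (by omega)
  obtain ⟨t1, t2⟩ := ht c (by omega)
  beta_reduce at t1 t2
  rw [he] at t1 t2 hle
  refine hQ s₁ c k k1 (fun x hx => ?_) hc (by omega) hk t1 t2 hle (fun j hj hXj => ?_) ?_
  · rw [k2 x (by omega)]; simp (disch := omega) [Function.update_of_ne]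
  · obtain ⟨c', hc', he'⟩ := hsurj j hj
    have h1 := (k4 c' hc').2 (by rw [he', ← hXj])
    have h2 := hmono c' c (by omega) (by omega)
    rw [he, he'] at h2
    simp only at h2 hle
    omega
  · omega

/-- Reading the header. -/
def readHeader : Prog :=
  assign 3 (load 0) ;; assign 4 (load 1) ;; assign 5 (load 2) ;; assign 6 8 ;;
  assign 7 (10 + 2 * reg 3) ;; assign 8 (reg 7 + 2 + 2 * reg 4) ;;
  assign 9 (reg 8 + 2 + 2 * reg 3) ;; assign 10 (reg 9 + 2 + 2 * reg 3) ;;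
  assign 11 (reg 10 + 2 + 2 * reg 4) ;; assign 12 (reg 11 + 2 + 2 * reg 4) ;; assign 20 0

/-- Moving to the right up to the next sample. -/
def forwardLoop : Prog :=
  findSample ;;
  -- The query does not know its position in the text; a strictly smaller sample is the sign that
  -- the current suffix is not sampled. Register `20` counts the steps for the way back.
  loop (lt (load (reg 12 + 2 * (reg 84 - 1))) (reg 0))
    ((assign 71 (reg 9) ;; assign 72 (reg 3) ;; assign 74 (reg 0)) ;; psiStep ;;
     (assign 0 (reg 75) ;; assign 20 (reg 20 + 1)) ;; findSample)

/-- Moving back to the left. -/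
def backwardLoop : Prog :=
  loop (reg 20)
    ((assign 69 (reg 6) ;; assign 70 (reg 8) ;; assign 71 (reg 9) ;; assign 72 (reg 3) ;;
      assign 74 (reg 0)) ;; lfStep ;;
     (assign 0 (reg 75) ;; assign 70 (reg 10) ;; assign 71 (reg 11) ;; assign 72 (reg 4) ;;
      assign 74 (reg 21)) ;; rankStep ;;
     (assign 21 (reg 75) ;; assign 20 (reg 20 - 1)))

/-- The query. -/
def query : Prog :=
  readHeader ;; forwardLoop ;; assign 21 (load (reg 12 + 2 * (reg 84 - 1) + 1)) ;;
  backwardLoop ;; assign 0 (reg 21)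

/-- The contents of the registers during a query. -/
def queryLayout (r r' q : ℕ) : ℕ → ℕ
  | 3 => r
  | 4 => r'
  | 5 => q + 1
  | 6 => 8
  | 7 => 10 + 2 * r
  | 8 => 12 + 2 * r + 2 * r'
  | 9 => 14 + 4 * r + 2 * r'
  | 10 => 16 + 6 * r + 2 * r'
  | 11 => 18 + 6 * r + 4 * r'
  | 12 => 20 + 6 * r + 6 * r'
  | _ => 0

theorem runs_readHeader {E : Env} {s₀ : NatState} {Q : NatState → Prop} {r r' q : ℕ}
    (h0 : s₀.mem 0 = r) (h1 : s₀.mem 1 = r') (h2 : s₀.mem 2 = q + 1)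
    (hN : 3 ≤ E.N) (hM : 30 + 6 * r + 6 * r' < E.M)
    (hQ : ∀ s', s'.mem = s₀.mem →
      (∀ x, 3 ≤ x → x < 13 → s'.reg x = queryLayout r r' q x) → s'.reg 0 = s₀.reg 0 →
      s'.reg 20 = 0 → s'.clk ≤ s₀.clk + 80 → Q s') :
    Runs E readHeader s₀ Q := by
  refine Runs.of_wp ?_
  simp [readHeader, wp, h0, h1, h2]
  split_ands <;> try omega
  refine hQ _ rfl (fun x hx hx' => ?_) (by simp) (by simp) (by dsimp only; omega)
  interval_cases x <;> simp [queryLayout] <;> omega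

theorem suffixRank_injOn {S : List ℕ} {i j : ℕ} (hi : i < S.length) (hj : j < S.length)
    (h : suffixRank S (S.drop i) = suffixRank S (S.drop j)) : i = j := by
  have h1 := suffixRank_lt_suffixRank_iff hi (S.drop j)
  have h2 := suffixRank_lt_suffixRank_iff hj (S.drop i)
  rw [h] at h1 h2
  have h3 : ¬ S.drop i < S.drop j := fun hc => absurd (h1.2 hc) (lt_irrefl _)
  have h4 : ¬ S.drop j < S.drop i := fun hc => absurd (h2.2 hc) (lt_irrefl _)
  exact drop_injective hi hj (le_antisymm (not_lt.1 h4) (not_lt.1 h3))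

/-- The rank of the `k`-th sampled suffix of `S` among the suffixes of `T`. -/
def sampleRank (T S : List ℕ) (τ k : ℕ) : ℕ := suffixRank T (S.drop (S.length - 1 - k * τ))

/-- Ranks determine positions (`hinj`). Hence by `hd` no sample is hit during the first `d` tests,
and sample `k₀` is hit after `d` steps. The text is never left on the right, since position `p + d`
is inside it. -/
theorem runs_forwardLoop {E : Env} {s₀ : NatState} {Q : NatState → Prop} {S S' : List ℕ}
    {l l' ls : List (ℕ × ℕ)} {τ q p d k₀ : ℕ} (hS : IsText S)
    (hst : StringTables s₀.mem (bwt S) (bwt S') l l')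
    (hls : ls.Perm ((List.range (q + 1)).map
      fun k => (sampleRank S S τ k, sampleRank S' S τ k)))
    (hs : ls.Pairwise PLe)
    (ht : Table s₀.mem
      (20 + 6 * (runStarts (bwt S)).length + 6 * (runStarts (bwt S')).length) (q + 1)
      fun k => ls.getD k (0, 0))
    (hL : ∀ x, 3 ≤ x → x < 13 → s₀.reg x =
      queryLayout (runStarts (bwt S)).length (runStarts (bwt S')).length q x)
    (h0 : s₀.reg 0 = suffixRank S (S.drop p)) (h20 : s₀.reg 20 = 0)
    (hp : p + d = S.length - 1 - k₀ * τ) (hqτ : q * τ ≤ S.length - 1) (hk₀ : k₀ ≤ q)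
    (hd : ∀ t < d, ∀ k ≤ q, p + t ≠ S.length - 1 - k * τ)
    (hN : dsSpace (runStarts (bwt S)).length (runStarts (bwt S')).length q ≤ E.N)
    (hM : 4 * E.N + 4 * S.length + 10 ≤ E.M)
    (hQ : ∀ s', s'.mem = s₀.mem → (∀ x, 3 ≤ x → x < 13 → s'.reg x = s₀.reg x) →
      s'.reg 0 = suffixRank S (S.drop (p + d)) → s'.reg 20 = d →
      0 < s'.reg 84 → s'.reg 84 ≤ q + 1 →
      s₀.mem (s₀.reg 12 + 2 * (s'.reg 84 - 1) + 1) = suffixRank S' (S.drop (p + d)) →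
      s'.clk ≤ s₀.clk + (d + 1) * (searchCost (q + 1) +
        searchCost (runStarts (bwt S)).length + 200) → Q s') :
    Runs E forwardLoop s₀ Q := by
  have hpos := text_pos hS
  unfold dsSpace at hN
  set T := searchCost (q + 1) + searchCost (runStarts (bwt S)).length + 200 with hT
  have hTs : searchCost (q + 1) + 200 ≤ T := by omega
  have hX0 : sampleRank S S τ 0 = 0 := by
    rw [sampleRank, zero_mul, Nat.sub_zero]; exact suffixRank_last hS S
  have h12 : s₀.reg 12 =
      20 + 6 * (runStarts (bwt S)).length + 6 * (runStarts (bwt S')).length := by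
    simp [hL, queryLayout]
  have h5 : s₀.reg 5 = q + 1 := by simp [hL, queryLayout]
  have hk : ∀ k ≤ q, k * τ ≤ S.length - 1 := fun k hk =>
    (Nat.mul_le_mul_right _ hk).trans hqτ
  have hinj : ∀ j < S.length, ∀ k ≤ q, sampleRank S S τ k = suffixRank S (S.drop j) →
      S.length - 1 - k * τ = j := fun j hj k hk he => by
    exact suffixRank_injOn (by omega) hj he
  have hlt : ∀ t ≤ d, suffixRank S (S.drop (p + t)) < S.length := fun t ht =>
    suffixRank_lt (by omega)
  refine Runs.seq (runs_findSample hls hs ht hX0 h12 h5 (by omega)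
    (by have := hlt 0 (by omega); rw [add_zero] at this; omega)
    fun s₁ c k a1 a2 a3 a4 a5 a6 a7 a8 a9 a10 => ?_)
  refine Runs.loop_of_invariant (fun i s => i ≤ d ∧ s.mem = s₀.mem ∧
      (∀ x, 3 ≤ x → x < 13 → s.reg x = s₀.reg x) ∧ s.reg 20 = d - i ∧
      s.reg 0 = suffixRank S (S.drop (p + (d - i))) ∧
      (∃ c, s.reg 84 = c + 1 ∧ c ≤ q ∧ ∃ k ≤ q, s₀.mem (s₀.reg 12 + 2 * c) = sampleRank S S τ k ∧
        s₀.mem (s₀.reg 12 + 2 * c + 1) = sampleRank S' S τ k ∧ sampleRank S S τ k ≤ s.reg 0 ∧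
        ∀ j ≤ q, sampleRank S S τ j = s.reg 0 → sampleRank S S τ k = s.reg 0) ∧
      s.clk + i * T + 100 ≤ s₀.clk + (d + 1) * T) ?_ ?_ d ?_
  · rintro i s ⟨b1, b2, b3, b4, b5, ⟨c, b6, b7, k, b8, b9, b10, b11, b12⟩, b13⟩
    rw [add_mul] at b13
    obtain ⟨t, ht'⟩ : ∃ t, d - (i + 1) = t := ⟨_, rfl⟩
    rw [ht'] at b4 b5
    rw [show d - i = t + 1 by omega]
    have hne : sampleRank S S τ k < s.reg 0 := by
      refine lt_of_le_of_ne b11 fun he => ?_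
      rw [b5] at he
      exact hd t (by omega) k b8 (hinj _ (by omega) k b8 he).symm
    have hRt := hlt t (by omega)
    have hRt' := hlt (t + 1) (by omega)
    rw [← add_assoc] at hRt'
    have hpsi := psi_suffixRank hS (j := p + t) (by omega)
    refine ⟨by simp [b3, b6, h12]; omega, by simpa [b3, b6, b2, b9] using hne, Runs.block ?_⟩
    simp [wp, b3, hL, queryLayout]
    refine Runs.seq (runs_psiStep (n := (bwt S).length) (K := (runStarts (bwt S)).length)
      (key := fstSym (bwt S)) (f := psi (bwt S)) (F := runImage (bwt S) l)
      (by simpa [b2] using hst.fst.ds) (by simp) (by simpa [b5, bwt_length] using hRt)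
      (by simpa [b5, hpsi, bwt_length] using hRt') (by simp; omega) (by rw [bwt_length]; omega)
      fun s₂ c1 c2 c3 c4 => ?_)
    simp [b5, hpsi] at c1 c3 c4
    have c2 : ∀ x < 69, s₂.reg x = s.reg x := fun x hx => by
      rw [c2 x (by omega)]; simp (disch := omega) [Function.update_of_ne]
    refine Runs.block ?_
    simp [wp, c2, b4, c3]
    split_ands <;> try omega
    refine runs_findSample hls hs (by simpa [c1, b2] using ht) hX0 (by simp [c2, b3, h12])
      (by simp [c2, b3, h5]) (by omega) (by simp; omega)
      fun s₃ c k d1 d2 d3 d4 d5 d6 d7 d8 d9 d10 => ?_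
    simp [c1, b2] at d1 d6 d7 d8 d9 d10
    have e0 : s₃.reg 0 = suffixRank S (S.drop (p + t + 1)) := by rw [d2 0 (by omega)]; simp
    have e20 : s₃.reg 20 = t + 1 := by rw [d2 20 (by omega)]; simp
    refine ⟨by omega, d1, fun x hx hx' => ?_, e20, e0, ⟨c, d3, d4, k, d5, d6,
      d7, by rw [e0]; exact d8, by rw [e0]; exact d9⟩, by omega⟩
    rw [d2 x (by omega)]
    simp (disch := omega) [Function.update_of_ne, c2, b3]
  · rintro s ⟨b1, b2, b3, b4, b5, ⟨c, b6, b7, k, b8, b9, b10, b11, b12⟩, b13⟩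
    rw [Nat.sub_zero] at b4 b5
    have hfound : sampleRank S S τ k = s.reg 0 := b12 k₀ hk₀ (by rw [b5, hp]; rfl)
    have hpos' := hinj (p + d) (by omega) k b8 (by rw [hfound, b5])
    refine ⟨by simp [b3, b6, h12]; omega, by simp [b3, b6, b2, b9, hfound],
      hQ _ b2 b3 b5 b4 (by simp [b6]) (by simp [b6]; omega) ?_ ?_⟩
    · simp [b6, b10, sampleRank, hpos']
    · simp; omega
  · refine ⟨le_rfl, a1, fun x hx hx' => a2 x (by omega), ?_, ?_, ⟨c, a3, a4, k, a5, ?_, ?_, ?_, ?_⟩,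
      ?_⟩
    · rw [a2 20 (by omega), h20, Nat.sub_self]
    · rw [a2 0 (by omega), h0, Nat.sub_self, add_zero]
    · rw [h12, a6]
    · rw [h12, a7]
    · rw [a2 0 (by omega)]; exact a8
    · rw [a2 0 (by omega)]; exact a9
    · rw [add_mul]; omega

/-- The two ranks of one suffix are kept in registers `0` and `21`. LF in `S` also reveals the
preceding symbol, which is all that the step in `S'` needs. -/
theorem runs_backwardLoop {E : Env} {s₀ : NatState} {Q : NatState → Prop} {S S' : List ℕ}
    {l l' : List (ℕ × ℕ)} {q p d : ℕ} (hS : IsText S) (hS' : IsText S')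
    (hst : StringTables s₀.mem (bwt S) (bwt S') l l')
    (hL : ∀ x, 3 ≤ x → x < 13 → s₀.reg x =
      queryLayout (runStarts (bwt S)).length (runStarts (bwt S')).length q x)
    (h0 : s₀.reg 0 = suffixRank S (S.drop (p + d)))
    (h21 : s₀.reg 21 = suffixRank S' (S.drop (p + d)))
    (h20 : s₀.reg 20 = d) (hp : p + d < S.length)
    (hN : dsSpace (runStarts (bwt S)).length (runStarts (bwt S')).length q ≤ E.N)
    (hM : 4 * E.N + 4 * S.length + 4 * S'.length + 10 ≤ E.M)
    (hQ : ∀ s', s'.mem = s₀.mem → s'.reg 21 = suffixRank S' (S.drop p) →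
      s'.clk ≤ s₀.clk + d * (2 * searchCost (runStarts (bwt S)).length +
        searchCost (runStarts (bwt S')).length + 400) + 10 → Q s') :
    Runs E backwardLoop s₀ Q := by
  unfold dsSpace at hN
  set T := 2 * searchCost (runStarts (bwt S)).length +
    searchCost (runStarts (bwt S')).length + 400 with hT
  clear_value T
  refine Runs.loop_of_invariant (fun i s => i ≤ d ∧ s.mem = s₀.mem ∧
      (∀ x, 3 ≤ x → x < 13 → s.reg x = s₀.reg x) ∧ s.reg 20 = i ∧
      s.reg 0 = suffixRank S (S.drop (p + i)) ∧ s.reg 21 = suffixRank S' (S.drop (p + i)) ∧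
      s.clk + i * T ≤ s₀.clk + d * T) ?_ ?_ d ?_
  · rintro i s ⟨b1, b2, b3, b4, b5, b6, b7⟩
    rw [add_mul] at b7
    rw [← add_assoc] at b5 b6
    have hlt := suffixRank_lt (S := S) (j := p + i + 1) (by omega)
    have hle := suffixRank_le (S := S') (P := S.drop (p + i + 1))
    have hle' := suffixRank_le (S := S') (P := S.drop (p + i))
    have hlf := lf_suffixRank hS (j := p + i) (by omega)
    have hrm := rankMap_suffixRank hS hS' (j := p + i) (by omega)
    rw [← bwt_length] at hlt hle hle'
    refine ⟨by simp, by simp [b4], Runs.block ?_⟩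
    simp [wp, b3, hL, queryLayout]
    refine Runs.seq (runs_lfStep (B := bwt S) (l := l) (by simpa [b2] using hst.fst) (by simp)
      (by simpa [b5] using hlt) (by simp; omega) (by simp; omega) (by simp; omega)
      (by rw [bwt_length]; omega) fun s₁ c1 c2 c3 c4 c5 => ?_)
    simp only [Function.update_self, b5] at c3
    simp [b5, hlf] at c1 c4 c5
    have c2 : ∀ x < 69, s₁.reg x = s.reg x := fun x hx => by
      rw [c2 x (by omega)]; simp (disch := omega) [Function.update_of_ne]
    refine Runs.block ?_
    simp [wp, c2, b3, hL, queryLayout, c4, b6]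
    refine Runs.seq (runs_rankStep (n := (bwt S').length) (K := (runStarts (bwt S')).length)
      (key := fstSym (bwt S')) (f := psi (bwt S')) (F := runImage (bwt S') l')
      (g := suffixRank S' (S.drop (p + i)))
      (by simpa [c1, b2] using hst.snd.ds) (by simp) (by simpa using hle) hle' ?_
      (by simp; omega) (by simp; omega) (by rw [bwt_length]; omega) fun s₂ d1 d2 d3 d4 => ?_)
    · intro x hx
      simp only [Function.update_self]
      rw [Function.update_of_ne (by omega), Function.update_of_ne (by omega),
        Function.update_of_ne (by omega), Function.update_of_ne (by omega),
        Function.update_of_ne (by omega), c3, ← hrm]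
      exact lt_rankMap_iff hx
    simp [c1] at d1 d4
    have e0 : s₂.reg 0 = suffixRank S (S.drop (p + i)) := by rw [d2 0 (by omega)]; simp
    have d2 : ∀ x < 69, x ≠ 0 → s₂.reg x = s.reg x := fun x hx hx' => by
      rw [d2 x (by omega)]; simp (disch := omega) [Function.update_of_ne, c2]
    refine Runs.of_wp ?_
    simp [wp, d2, b4, d3, e0, d1, b2]
    refine ⟨by omega, by omega, fun x hx hx' => ?_, by omega⟩
    simp (disch := omega) [Function.update_of_ne, d2, b3]
  · rintro s ⟨b1, b2, b3, b4, b5, b6, b7⟩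
    refine ⟨by simp, by simp [b4], hQ _ b2 b6 ?_⟩
    simp; omega
  · exact ⟨le_rfl, rfl, fun _ _ _ => rfl, h20, h0, h21, le_rfl⟩

end WordRAM

/-! ### The complete query -/

namespace WordRAM

open WordRAM.Expr WordRAM.Prog Bwt

/-- A bound on the time of a query. -/
def queryCost (r r' τ q : ℕ) : ℕ :=
  τ * (searchCost (q + 1) + searchCost r + 200) + τ * (2 * searchCost r + searchCost r' + 400) + 120

theorem runs_query {E : Env} {s₀ : NatState} {Q : NatState → Prop} {S S' : List ℕ} {τ q p : ℕ}
    (hτ : 0 < τ) (hS : IsText S) (hS' : IsText S') (hq : q = (S.length - 1) / τ)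
    (hds : QueryDS s₀.mem (bwt S) (bwt S') (sampleRank S S τ) (sampleRank S' S τ) q)
    (hp : p < S.length) (h0 : s₀.reg 0 = suffixRank S (S.drop p))
    (hN : dsSpace (runStarts (bwt S)).length (runStarts (bwt S')).length q ≤ E.N)
    (hM : 4 * E.N + 4 * S.length + 4 * S'.length + 10 ≤ E.M)
    (hQ : ∀ s', s'.mem = s₀.mem → s'.reg 0 = suffixRank S' (S.drop p) →
      s'.clk ≤ s₀.clk + queryCost (runStarts (bwt S)).length (runStarts (bwt S')).length τ q →
      Q s') :
    Runs E query s₀ Q := by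
  obtain ⟨l, l', hst⟩ := hds.strings
  obtain ⟨ls, h1, h2, h3⟩ := hds.samples
  have hN₀ := hN
  unfold dsSpace at hN
  have hdiv := Nat.div_add_mod (S.length - 1 - p) τ
  have hdlt := Nat.mod_lt (S.length - 1 - p) hτ
  -- Samples sit at distances `k * τ` from the last position, so this remainder is the distance from
  -- `p` to the next sample on the right.
  set d := (S.length - 1 - p) % τ with hd
  set k₀ := (S.length - 1 - p) / τ with hk₀
  have hqτ : q * τ ≤ S.length - 1 := hq ▸ Nat.div_mul_le_self _ _
  have hkq : k₀ ≤ q := hq ▸ Nat.div_le_div_right (by omega)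
  rw [mul_comm] at hdiv
  refine Runs.seq (runs_readHeader hds.runs_fst hds.runs_snd hds.numSamples (by omega) (by omega)
    fun s₁ a1 a2 a3 a4 a5 => ?_)
  refine Runs.seq (runs_forwardLoop (p := p) (d := d) (k₀ := k₀) (τ := τ) hS (a1 ▸ hst) h1 h2
    (a1 ▸ h3) a2 (a3.trans h0) a4 (by omega) hqτ hkq ?_ hN₀ (by omega)
    fun s₂ b1 b2 b3 b4 b5 b6 b7 b8 => ?_)
  · intro t ht k hk he
    have hkτ := (Nat.mul_le_mul_right τ hk).trans hqτ
    -- An earlier sample would make `d - t` a multiple of `τ`, although it lies strictly between 0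
    -- and `τ`.
    have e : k₀ * τ + (d - t) = k * τ := by omega
    have := congrArg (· % τ) e
    simp only [Nat.mul_add_mod_self_right, Nat.mul_mod_left] at this
    rw [Nat.mod_eq_of_lt (by omega)] at this
    omega
  have b2 := fun x hx hx' => (b2 x hx hx').trans (a2 x hx hx')
  have h12 : s₁.reg 12 = 20 + 6 * (runStarts (bwt S)).length + 6 * (runStarts (bwt S')).length := by
    simp [a2, queryLayout]
  rw [h12] at b7
  refine Runs.block ?_
  simp [wp, b2, queryLayout, b1, b7]
  split_ands <;> try omega
  refine Runs.seq (runs_backwardLoop (p := p) (d := d) (q := q) (l := l) (l' := l') hS hS'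
    (by simpa [a1] using hst) (fun x hx hx' => ?_) (by simp [b3]) (by simp) (by simp [b4]) (by omega)
    hN₀ (by omega) fun s₃ c1 c2 c3 => Runs.of_wp ?_)
  · simp (disch := omega) [Function.update_of_ne, b2]
  simp at c1 c3
  simp [wp, c2]
  refine hQ _ (by simp [c1, a1]) (by simp) ?_
  unfold queryCost
  have m1 := Nat.mul_le_mul_right (searchCost (q + 1) + searchCost (runStarts (bwt S)).length + 200)
    (show d + 1 ≤ τ from hdlt)
  have m2 := Nat.mul_le_mul_right (2 * searchCost (runStarts (bwt S)).length +
    searchCost (runStarts (bwt S')).length + 400) hdlt.le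
  dsimp only; omega

end WordRAM

/-! ## Bounds on the costs -/

namespace WordRAM

theorem one_le_lg (x : ℝ) : 1 ≤ lg x := le_max_left _ _

theorem log_le_lg {n : ℕ} {x : ℝ} (h : (n : ℝ) ≤ x) : (Nat.log 2 n : ℝ) ≤ lg x := by
  rcases Nat.eq_zero_or_pos n with rfl | hn
  · simpa using zero_le_one.trans (one_le_lg x)
  · have h1 : (Nat.log 2 n : ℝ) ≤ Real.logb 2 n := by exact_mod_cast Real.natLog_le_logb n 2
    exact h1.trans ((Real.logb_le_logb_of_le one_lt_two (by exact_mod_cast hn) h).trans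
      (le_max_right _ _))

theorem log_succ_le_lg {n : ℕ} {x : ℝ} (h : (n : ℝ) ≤ x) :
    (Nat.log 2 (n + 1) : ℝ) ≤ lg x + 1 := by
  have h1 : Nat.log 2 (n + 1) ≤ Nat.log 2 n + 1 := by
    rcases Nat.eq_zero_or_pos n with rfl | hn
    · simp
    · rw [← Nat.log_mul_base (by omega) (by omega)]
      exact Nat.log_mono_right (by omega)
  have h2 : (Nat.log 2 (n + 1) : ℝ) ≤ Nat.log 2 n + 1 := by exact_mod_cast h1
  have := log_le_lg h
  linarith

theorem searchCost_le {n : ℕ} {Λ : ℝ} (h : (Nat.log 2 n : ℝ) ≤ Λ) (h1 : 1 ≤ Λ) :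
    (searchCost n : ℝ) ≤ 150 * Λ := by
  rw [searchCost]; push_cast; linarith

theorem sortCost_le {n : ℕ} {Λ : ℝ} (hn : 1 ≤ n) (h : (Nat.log 2 n : ℝ) ≤ Λ) (h1 : 1 ≤ Λ) :
    (sortCost n : ℝ) ≤ 500 * (Λ * n) := by
  have hn' : (1 : ℝ) ≤ n := by exact_mod_cast hn
  have h2 : ((Nat.log 2 n : ℝ) + 1) * (200 * n + 40) ≤ 2 * Λ * (240 * n) :=
    mul_le_mul (by linarith) (by linarith) (by positivity) (by linarith)
  have h3 : 1 ≤ Λ * n := one_le_mul_of_one_le_of_one_le h1 hn'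
  rw [sortCost]; push_cast; linarith

theorem indexCost_le {r : ℕ} {Λ : ℝ} (hr : 1 ≤ r) (h : (Nat.log 2 r : ℝ) ≤ Λ) (h1 : 1 ≤ Λ) :
    (indexCost r : ℝ) ≤ 860 * (Λ * r) := by
  have hr' : (1 : ℝ) ≤ r := by exact_mod_cast hr
  have h2 := sortCost_le hr h h1
  have h3 : (r : ℝ) * (searchCost r + 140) ≤ r * (290 * Λ) :=
    mul_le_mul_of_nonneg_left (by linarith [searchCost_le h h1]) (by linarith)
  have h4 : 1 ≤ Λ * r := one_le_mul_of_one_le_of_one_le h1 hr'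
  rw [indexCost]; push_cast; linarith

theorem orbitCost_le {J T : ℕ} {Λ : ℝ} (hJ : 1 ≤ J) (h : (Nat.log 2 J : ℝ) ≤ Λ) (h1 : 1 ≤ Λ)
    (hT : (T : ℝ) ≤ 500 * Λ) : (orbitCost J T : ℝ) ≤ 1130 * (Λ * J) := by
  have hJ' : (1 : ℝ) ≤ J := by exact_mod_cast hJ
  have h2 := sortCost_le hJ h h1
  have h3 : (J : ℝ) * (T + 100) ≤ J * (600 * Λ) :=
    mul_le_mul_of_nonneg_left (by linarith) (by linarith)
  have h4 : 1 ≤ Λ * J := one_le_mul_of_one_le_of_one_le h1 hJ'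
  rw [orbitCost]; push_cast; linarith

theorem walkCost_le {r r' τ : ℕ} {Λ : ℝ} (hτ : 1 ≤ τ) (h : (Nat.log 2 r : ℝ) ≤ Λ)
    (h' : (Nat.log 2 r' : ℝ) ≤ Λ) (h1 : 1 ≤ Λ) : (walkCost r r' τ : ℝ) ≤ 1120 * (Λ * τ) := by
  have hτ' : (1 : ℝ) ≤ τ := by exact_mod_cast hτ
  have h3 : (τ : ℝ) * (2 * searchCost r + 2 * searchCost r' + 500) ≤ τ * (1100 * Λ) :=
    mul_le_mul_of_nonneg_left (by linarith [searchCost_le h h1, searchCost_le h' h1]) (by linarith)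
  have h4 : 1 ≤ Λ * τ := one_le_mul_of_one_le_of_one_le h1 hτ'
  rw [walkCost]; push_cast; linarith

theorem preimageCost_le {r τ : ℕ} {Λ : ℝ} (hτ : 1 ≤ τ) (h : (Nat.log 2 r : ℝ) ≤ Λ)
    (h1 : 1 ≤ Λ) : (preimageCost r τ : ℝ) ≤ 1580 * (Λ * τ) := by
  have hτ' : (1 : ℝ) ≤ τ := by exact_mod_cast hτ
  have h3 : (τ : ℝ) * (searchCost r + 110) ≤ τ * (260 * Λ) :=
    mul_le_mul_of_nonneg_left (by linarith [searchCost_le h h1]) (by linarith)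
  have h4 : 1 ≤ Λ * τ := one_le_mul_of_one_le_of_one_le h1 hτ'
  rw [preimageCost]; push_cast; linarith [walkCost_le hτ h h h1]

/-- The dominating terms come from walking `τ` steps from each of the `(r + r') * τ` points; sorting
the points costs a factor `τ` less. -/
theorem stepsCost_le {r r' τ : ℕ} {Λ : ℝ} (hr : 1 ≤ r) (hr' : 1 ≤ r') (hτ : 1 ≤ τ)
    (h : (Nat.log 2 (r * τ + r' * τ) : ℝ) ≤ Λ) (h1 : 1 ≤ Λ) :
    (stepsCost r r' τ : ℝ) ≤ 3000 * ((τ : ℝ) ^ 2 * (r + r') * Λ) := by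
  have hlog : ∀ {n : ℕ}, n ≤ r * τ + r' * τ → (Nat.log 2 n : ℝ) ≤ Λ := fun hn =>
    le_trans (by exact_mod_cast Nat.log_mono_right hn) h
  have hJ := Nat.le_mul_of_pos_right r hτ
  have hJ' := Nat.le_mul_of_pos_right r' hτ
  have a1 : (1 : ℝ) ≤ r := by exact_mod_cast hr
  have a2 : (1 : ℝ) ≤ r' := by exact_mod_cast hr'
  have a3 : (1 : ℝ) ≤ τ := by exact_mod_cast hτ
  have l1 := hlog (n := r) (by omega)
  have l2 := hlog (n := r') (by omega)
  have o1 := orbitCost_le (J := r * τ) (T := searchCost r + 100) (by omega) (hlog (by omega)) h1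
    (by push_cast; linarith [searchCost_le l1 h1])
  have o2 := orbitCost_le (J := r' * τ) (T := 2 * (searchCost r' + 100)) (by omega)
    (hlog (by omega)) h1 (by push_cast; linarith [searchCost_le l2 h1])
  have one : 1 ≤ Λ * (τ : ℝ) := one_le_mul_of_one_le_of_one_le h1 a3
  have w1 : (r : ℝ) * τ * (walkCost r r' τ + 50) ≤ r * τ * (1170 * (Λ * τ)) :=
    mul_le_mul_of_nonneg_left (by linarith [walkCost_le hτ l1 l2 h1]) (by positivity)
  have w2 : (r' : ℝ) * τ * preimageCost r' τ ≤ r' * τ * (1580 * (Λ * τ)) :=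
    mul_le_mul_of_nonneg_left (preimageCost_le hτ l2 h1) (by positivity)
  have e1 : Λ * ((r : ℝ) * τ) ≤ Λ * (r * τ) * τ := le_mul_of_one_le_right (by positivity) a3
  have e2 : Λ * ((r' : ℝ) * τ) ≤ Λ * (r' * τ) * τ := le_mul_of_one_le_right (by positivity) a3
  have e3 : 1 ≤ Λ * ((r : ℝ) * τ) :=
    one_le_mul_of_one_le_of_one_le h1 (one_le_mul_of_one_le_of_one_le a1 a3)
  have e4 : (0 : ℝ) ≤ Λ * (r' * τ) * τ := by positivity
  push_cast at o1 o2
  rw [stepsCost]; push_cast; linarith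

theorem sampleCost_le {J J' q : ℕ} {U l₁ l₂ l₃ : ℝ} (hU : (q : ℝ) ≤ U)
    (h₁ : (Nat.log 2 J : ℝ) ≤ l₁) (h₂ : (Nat.log 2 J' : ℝ) ≤ l₂)
    (h₃ : (Nat.log 2 (q + 1) : ℝ) ≤ l₃ + 1) (o₁ : 1 ≤ l₁) (o₂ : 1 ≤ l₂) (o₃ : 1 ≤ l₃) :
    (sampleCost J J' q : ℝ) ≤ 2500 * (U * (l₁ + l₂ + l₃)) + 320 := by
  have hU0 : 0 ≤ U := le_trans (by positivity) hU
  have a1 : (q : ℝ) * (searchCost J + searchCost J' + 300) ≤ U * (300 * (l₁ + l₂ + l₃)) :=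
    mul_le_mul hU (by linarith [searchCost_le h₁ o₁, searchCost_le h₂ o₂]) (by positivity) hU0
  have a2 : (sortCost (q + 1) : ℝ) ≤ 2000 * (U * l₃) + 260 := by
    -- `U` stands for m/τ and may be below 1, so constant costs cannot be charged to it when `q =
    -- 0`; they remain as an additive constant.
    rcases Nat.eq_zero_or_pos q with rfl | hq
    · have : (0 : ℝ) ≤ U * l₃ := by positivity
      simp [sortCost]; linarith
    · have hq' : (1 : ℝ) ≤ q := by exact_mod_cast hq
      have b1 := sortCost_le (n := q + 1) (Λ := l₃ + 1) (by omega) h₃ (by linarith)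
      have b2 : (l₃ + 1) * ((q : ℝ) + 1) ≤ (l₃ + 1) * (U + U) :=
        mul_le_mul_of_nonneg_left (by linarith) (by linarith)
      have b3 : U ≤ U * l₃ := le_mul_of_one_le_right hU0 o₃
      push_cast at b1
      linarith
  have a3 : 0 ≤ U * l₁ := by positivity
  have a4 : 0 ≤ U * l₂ := by positivity
  have a5 : 0 ≤ U * l₃ := by positivity
  rw [sampleCost]; push_cast; linarith

/-- The additive constants are absorbed by the first term, which is at least 2 because both strings
have a run. -/
theorem buildCost_le {r r' τ q : ℕ} {Λ U l₁ l₂ l₃ : ℝ} (hr : 1 ≤ r) (hr' : 1 ≤ r') (hτ : 1 ≤ τ)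
    (h : (Nat.log 2 (r * τ + r' * τ) : ℝ) ≤ Λ) (h1 : 1 ≤ Λ) (hU : (q : ℝ) ≤ U)
    (h₁ : (Nat.log 2 (r * τ) : ℝ) ≤ l₁) (h₂ : (Nat.log 2 (r' * τ) : ℝ) ≤ l₂)
    (h₃ : (Nat.log 2 (q + 1) : ℝ) ≤ l₃ + 1) (o₁ : 1 ≤ l₁) (o₂ : 1 ≤ l₂) (o₃ : 1 ≤ l₃) :
    (buildCost r r' τ q : ℝ) ≤
      10000 * ((τ : ℝ) ^ 2 * (r + r') * Λ + U * (l₁ + l₂ + l₃)) := by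
  have hlog : ∀ {n : ℕ}, n ≤ r * τ + r' * τ → (Nat.log 2 n : ℝ) ≤ Λ := fun hn =>
    le_trans (by exact_mod_cast Nat.log_mono_right hn) h
  have hJ := Nat.le_mul_of_pos_right r hτ
  have hJ' := Nat.le_mul_of_pos_right r' hτ
  have a1 : (1 : ℝ) ≤ r := by exact_mod_cast hr
  have a2 : (1 : ℝ) ≤ r' := by exact_mod_cast hr'
  have a3 : (1 : ℝ) ≤ (τ : ℝ) ^ 2 := one_le_pow₀ (by exact_mod_cast hτ)
  have i1 := indexCost_le hr (hlog (by omega)) h1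
  have i2 := indexCost_le hr' (hlog (by omega)) h1
  have i3 := stepsCost_le hr hr' hτ h h1
  have i4 := sampleCost_le hU h₁ h₂ h₃ o₁ o₂ o₃
  have e1 : (r : ℝ) + r' ≤ Λ * (r + r') := le_mul_of_one_le_left (by linarith) h1
  have e2 : Λ * ((r : ℝ) + r') ≤ τ ^ 2 * (Λ * (r + r')) :=
    le_mul_of_one_le_left (by positivity) a3
  have hU0 : 0 ≤ U := le_trans (by positivity) hU
  have e3 : 0 ≤ U * (l₁ + l₂ + l₃) := by positivity
  rw [buildCost]; push_cast; linarith

theorem queryCost_le {r r' τ q : ℕ} {l₁ l₂ l₃ : ℝ} (hτ : 1 ≤ τ)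
    (h₁ : (Nat.log 2 (q + 1) : ℝ) ≤ l₁ + 1) (h₂ : (Nat.log 2 r : ℝ) ≤ l₂)
    (h₃ : (Nat.log 2 r' : ℝ) ≤ l₃) (o₁ : 1 ≤ l₁) (o₂ : 1 ≤ l₂) (o₃ : 1 ≤ l₃) :
    (queryCost r r' τ q : ℝ) ≤ 10000 * ((τ : ℝ) * (l₁ + l₂ + l₃)) := by
  have a3 : (1 : ℝ) ≤ τ := by exact_mod_cast hτ
  have c1 := searchCost_le h₁ (by linarith)
  have c2 := searchCost_le h₂ o₂
  have c3 := searchCost_le h₃ o₃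
  have b1 : (τ : ℝ) * (searchCost (q + 1) + searchCost r + 200) ≤ τ * (1000 * (l₁ + l₂ + l₃)) :=
    mul_le_mul_of_nonneg_left (by linarith) (by linarith)
  have b2 : (τ : ℝ) * (2 * searchCost r + searchCost r' + 400) ≤ τ * (1000 * (l₁ + l₂ + l₃)) :=
    mul_le_mul_of_nonneg_left (by linarith) (by linarith)
  have b3 : 1 ≤ (τ : ℝ) * (l₁ + l₂ + l₃) := one_le_mul_of_one_le_of_one_le a3 (by linarith)
  rw [queryCost]; push_cast; linarith

end WordRAM

/-! ## The main result -/

namespace WordRAM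

open WordRAM.Expr WordRAM.Prog Bwt

/-- The natural numbers in a machine state. -/
def State.toNatState {w : ℕ} (σ : State w) : NatState :=
  ⟨fun x => (σ.reg x).toNat, fun a => (σ.mem (BitVec.ofNat w a)).toNat, 0⟩

theorem rel_toNatState {w : ℕ} (σ : State w) : Rel σ σ.toNatState :=
  ⟨fun _ => rfl, fun _ _ => rfl⟩

theorem getElem?_flatMap_pair (l : List (ℕ × ℕ)) {k : ℕ} (hk : k < l.length) :
    (l.flatMap fun p => [p.1, p.2])[2 * k]? = some l[k].1 ∧
    (l.flatMap fun p => [p.1, p.2])[2 * k + 1]? = some l[k].2 := by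
  induction l generalizing k with
  | nil => simp at hk
  | cons a l ih =>
    cases k with
    | zero => simp
    | succ k =>
      have := ih (k := k) (by simpa using hk)
      simpa [Nat.mul_succ] using this

theorem holds_getElem? {w : ℕ} {mem : BitVec w → BitVec w} {l : List ℕ} (h : Holds mem l)
    {k x : ℕ} (hk : l[k]? = some x) (hx : x < 2 ^ w) : (mem (BitVec.ofNat w k)).toNat = x := by
  obtain ⟨hlt, he⟩ := List.getElem?_eq_some_iff.1 hk
  rw [h k hlt, he, BitVec.toNat_ofNat, Nat.mod_eq_of_lt hx]

theorem rlbwt_getElem? {S : List ℕ} {k : ℕ} (hk : k < (runStarts (bwt S)).length) :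
    (rlbwt S)[k]? = some (runStart (bwt S) k + 1, (bwt S).getD (runStart (bwt S) k) 0) := by
  rw [rlbwt, List.getElem?_map, List.getElem?_eq_getElem hk, runStart,
    List.getD_eq_getElem _ _ hk]
  rfl

theorem numRuns_eq (S : List ℕ) : numRuns S = (runStarts (bwt S)).length := by
  rw [numRuns, rlbwt, List.length_map]

theorem bwt_getD_lt {S : List ℕ} {M : ℕ} (h : ∀ c ∈ S, c < M) (hM : 0 < M) (i : ℕ) :
    (bwt S).getD i 0 < M := by
  have hS : ∀ j, S.getD j 0 < M := fun j => by
    rcases Nat.lt_or_ge j S.length with hj | hj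
    · rw [List.getD_eq_getElem _ _ hj]; exact h _ (List.getElem_mem _)
    · rwa [List.getD_eq_default _ _ hj]
  rcases Nat.lt_or_ge i (bwt S).length with hi | hi
  · rw [List.getD_eq_getElem _ _ hi]
    have : (bwt S)[i] ∈ bwt S := List.getElem_mem _
    obtain ⟨j, _, hj⟩ := List.mem_map.1 this
    rw [← hj]; exact hS _
  · rwa [List.getD_eq_default _ _ hi]

/-- The input as tables. -/
theorem table_of_isInput {w : ℕ} {S S' : List ℕ} {σ : State w}
    (h : Holds σ.mem ((rlbwt S ++ rlbwt S').flatMap fun p => [p.1, p.2]))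
    (hS : S.length < 2 ^ w) (hS' : S'.length < 2 ^ w) (hc : ∀ c ∈ S, c < 2 ^ w)
    (hc' : ∀ c ∈ S', c < 2 ^ w) :
    Table σ.toNatState.mem 0 (runStarts (bwt S)).length
      (fun k => (runStart (bwt S) k + 1, (bwt S).getD (runStart (bwt S) k) 0)) ∧
    Table σ.toNatState.mem (2 * (runStarts (bwt S)).length) (runStarts (bwt S')).length
      (fun k => (runStart (bwt S') k + 1, (bwt S').getD (runStart (bwt S') k) 0)) := by
  have hl : (rlbwt S).length = (runStarts (bwt S)).length := numRuns_eq S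
  have hl' : (rlbwt S').length = (runStarts (bwt S')).length := numRuns_eq S'
  have key : ∀ k (p : ℕ × ℕ), (rlbwt S ++ rlbwt S')[k]? = some p → p.1 < 2 ^ w → p.2 < 2 ^ w →
      σ.toNatState.mem (2 * k) = p.1 ∧ σ.toNatState.mem (2 * k + 1) = p.2 := by
    intro k p hk h1 h2
    obtain ⟨hlt, rfl⟩ := List.getElem?_eq_some_iff.1 hk
    obtain ⟨e1, e2⟩ := getElem?_flatMap_pair _ hlt
    exact ⟨holds_getElem? h e1 h1, holds_getElem? h e2 h2⟩
  refine ⟨fun k hk => ?_, fun k hk => ?_⟩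
  · have := runStart_lt hk
    rw [bwt_length] at this
    rw [zero_add]
    refine key k _ ?_ (by simp only; omega) (bwt_getD_lt hc (by positivity) _)
    rw [List.getElem?_append_left (by omega), rlbwt_getElem? hk]
  · have := runStart_lt hk
    rw [bwt_length] at this
    rw [← mul_add]
    refine key _ _ ?_ (by simp only; omega) (bwt_getD_lt hc' (by positivity) _)
    rw [List.getElem?_append_right (by omega), hl, Nat.add_sub_cancel_left, rlbwt_getElem? hk]

theorem pow_le_of_mul_logb_le {κ Z w : ℕ} (hZ : 0 < Z)
    (h : (κ : ℝ) * Real.logb 2 Z ≤ w) : Z ^ κ ≤ 2 ^ w := by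
  rw [← Real.logb_pow, Real.logb_le_iff_le_rpow one_lt_two (by positivity), Real.rpow_natCast] at h
  exact_mod_cast h

end WordRAM

open WordRAM Bwt in
theorem mainTheorem9 :
    ∃ (build query : WordRAM.Prog) (κ C : ℕ),
      ∀ (S S' : List ℕ) (τ w : ℕ),
        IsText S → IsText S' → 1 ≤ τ →
        (κ : ℝ) * Real.logb 2 ((S.length : ℝ) + S'.length + τ) ≤ w →
        (∀ c ∈ S, c < 2 ^ w) → (∀ c ∈ S', c < 2 ^ w) →
        ∀ s : WordRAM.State w, IsInput S S' τ s →
          ∃ (s' : WordRAM.State w) (t N L : ℕ),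
            WordRAM.Exec build s s' t N ∧
            (t : ℝ) ≤ C * ((τ : ℝ) ^ 2 * ((numRuns S : ℝ) + numRuns S') *
                  lg ((numRuns S : ℝ) * τ + (numRuns S' : ℝ) * τ)
                + (S.length : ℝ) / τ *
                  (lg ((numRuns S : ℝ) * τ) + lg ((numRuns S' : ℝ) * τ)
                    + lg ((S.length : ℝ) / τ))) ∧
            (N : ℝ) ≤ C * ((τ : ℝ) ^ 2 * ((numRuns S : ℝ) + numRuns S')
                + (S.length : ℝ) / τ) ∧
            (L : ℝ) ≤ C * ((S.length : ℝ) / τ + numRuns S + numRuns S') ∧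
            AnswersQueries query S S' s'.mem L
              (C * ((τ : ℝ) * (lg ((S.length : ℝ) / τ) + lg (numRuns S) + lg (numRuns S')))) := by
  -- The space and all values are of order `Z ^ 2` for `Z = m + m' + τ`. Since `Z ≥ 3`, the
  -- remaining factor `Z ^ 6 ≥ 729` of `Z ^ 8` covers every constant; hence the exponent 8.
  refine ⟨WordRAM.build, WordRAM.query, 8, 10000, ?_⟩
  intro S S' τ w hS hS' hτ hw hc hc' σ ⟨i0, i1, i2, i3, i4, i5⟩
  rw [numRuns_eq, numRuns_eq] at *
  have hm := text_pos hS
  have hm' := text_pos hS'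
  have hB : 0 < (bwt S).length := by rwa [bwt_length]
  have hB' : 0 < (bwt S').length := by rwa [bwt_length]
  have hr : 1 ≤ (runStarts (bwt S)).length := runStarts_length_pos hB
  have hr' : 1 ≤ (runStarts (bwt S')).length := runStarts_length_pos hB'
  have hrm : (runStarts (bwt S)).length ≤ S.length := runStarts_length_le.trans bwt_length.le
  have hrm' : (runStarts (bwt S')).length ≤ S'.length := runStarts_length_le.trans bwt_length.le
  obtain ⟨q, hq⟩ : ∃ q, q = (S.length - 1) / τ := ⟨_, rfl⟩
  have hqτ : q * τ ≤ S.length - 1 := hq ▸ Nat.div_mul_le_self _ _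
  have hqm : q ≤ S.length := (Nat.le_mul_of_pos_right q hτ).trans (by omega)
  generalize hrdef : (runStarts (bwt S)).length = r at *
  generalize hrdef' : (runStarts (bwt S')).length = r' at *
  obtain ⟨Z, hZ⟩ : ∃ Z, S.length + S'.length + τ = Z := ⟨_, rfl⟩
  have hpow : Z ^ 8 ≤ 2 ^ w := pow_le_of_mul_logb_le (by omega) (by
    rw [← hZ]; push_cast; exact_mod_cast hw)
  have hM : 4 * buildSpace r r' τ q + 4 * S.length + 8 * S'.length + 10 ≤ Z ^ 8 := by
    have h1 : r * τ ≤ Z * Z := Nat.mul_le_mul (by omega) (by omega)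
    have h2 : r' * τ ≤ Z * Z := Nat.mul_le_mul (by omega) (by omega)
    have h3 : 3 * Z ≤ Z * Z := Nat.mul_le_mul_right _ (by omega)
    have h4 : 3 ^ 6 * (Z * Z) ≤ Z ^ 6 * (Z * Z) :=
      Nat.mul_le_mul_right _ (Nat.pow_le_pow_left (by omega) _)
    have h5 : Z ^ 6 * (Z * Z) = Z ^ 8 := by ring
    unfold buildSpace
    omega
  have hτr : τ ≤ r * τ := Nat.le_mul_of_pos_left τ hr
  have hZw : Z < 2 ^ w := lt_of_lt_of_le (by unfold buildSpace; omega) (hM.trans hpow)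
  have toNat : ∀ {x : ℕ}, x ≤ Z → (BitVec.ofNat w x).toNat = x := fun hx => by
    rw [BitVec.toNat_ofNat, Nat.mod_eq_of_lt (by omega)]
  obtain ⟨t1, t2⟩ := table_of_isInput i5 (by omega) (by omega) hc hc'
  have hN : dsSpace r r' q ≤ buildSpace r r' τ q := by unfold dsSpace buildSpace; omega
  have hk : ∀ k ≤ q, k * τ ≤ S.length - 1 := fun k hk => (Nat.mul_le_mul_right _ hk).trans hqτ
  -- Consecutive samples are exactly `τ` positions apart; the truncated subtraction is harmless
  -- because of `hk`.
  have hstep : ∀ k < q, S.length - 1 - (k + 1) * τ + τ = S.length - 1 - k * τ := fun k hkq => by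
    have := hk (k + 1) hkq
    rw [add_mul, one_mul] at *; omega
  have hrun := runs_build (E := ⟨w, buildSpace r r' τ q, 2 ^ w⟩) (s₀ := σ.toNatState)
    (B := bwt S) (B' := bwt S') (X := sampleRank S S τ) (Y := sampleRank S' S τ) (τ := τ) (q := q)
    (Q := fun s' => QueryDS s'.mem (bwt S) (bwt S') (sampleRank S S τ) (sampleRank S' S τ) q ∧
      s'.clk ≤ buildCost r r' τ q)
    hτ hB hB' (by rw [bwt_length, hq])
    (by simp only [State.toNatState, i0]; exact toNat (by omega))
    (by simp only [State.toNatState, i1, bwt_length]; exact toNat (by omega))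
    (by simp only [State.toNatState, i2, bwt_length]; exact toNat (by omega))
    (by simp only [State.toNatState, i3, hrdef]; exact toNat (by omega))
    (by simp only [State.toNatState, i4, hrdef']; exact toNat (by omega))
    t1 t2
    (by rw [sampleRank, zero_mul, Nat.sub_zero]; exact suffixRank_last hS S)
    (by rw [sampleRank, zero_mul, Nat.sub_zero]; exact suffixRank_last hS S')
    (fun k hkq => by
      rw [sampleRank, sampleRank, ← hstep k hkq]
      exact lf_iterate_suffixRank hS (by rw [hstep k hkq]; omega))
    (fun k hkq => by
      rw [sampleRank, sampleRank, sampleRank, ← hstep k hkq]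
      exact rankList_context_suffixRank hS hS' (by rw [hstep k hkq]; omega))
    (fun k _ => by rw [bwt_length]; exact suffixRank_lt (by omega))
    (fun k _ => by rw [bwt_length]; exact suffixRank_le)
    (by rw [hrdef, hrdef']) (by rw [bwt_length, bwt_length]; exact hM.trans hpow)
    (fun s' h1 h2 => ⟨h1, by rw [hrdef, hrdef'] at h2; simpa [State.toNatState] using h2⟩)
  obtain ⟨σ', t, n, s', e1, e2, e3, e4, e5, e6⟩ := hrun
    ⟨by simp only; omega, le_rfl, by simp only; omega⟩ σ (rel_toNatState σ)
  have hU : (q : ℝ) ≤ (S.length : ℝ) / τ := by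
    rw [le_div_iff₀ (by exact_mod_cast hτ)]
    exact_mod_cast hqτ.trans (Nat.sub_le _ _)
  have hU0 : (0 : ℝ) ≤ (S.length : ℝ) / τ := by positivity
  have a1 : (1 : ℝ) ≤ r := by exact_mod_cast hr
  have a2 : (1 : ℝ) ≤ r' := by exact_mod_cast hr'
  have a3 : (1 : ℝ) ≤ τ := by exact_mod_cast hτ
  refine ⟨σ', t, n, dsSpace r r' q, e1, ?_, ?_, ?_, ?_⟩
  · have : t ≤ buildCost r r' τ q := by
      simp only [State.toNatState] at e3; omega
    refine (Nat.cast_le.2 this).trans ?_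
    exact_mod_cast buildCost_le hr hr' hτ (log_le_lg (by push_cast; rfl)) (one_le_lg _) hU
      (log_le_lg (by push_cast; rfl)) (log_le_lg (by push_cast; rfl)) (log_succ_le_lg hU)
      (one_le_lg _) (one_le_lg _) (one_le_lg _)
  · refine (Nat.cast_le.2 e2).trans ?_
    -- Apart from the samples the construction uses only O(τ(r + r')) words, a factor `τ` less than
    -- allowed.
    have b1 : (τ : ℝ) ≤ τ ^ 2 := le_self_pow₀ a3 two_ne_zero
    have b2 : (τ : ℝ) * (r + r') ≤ τ ^ 2 * (r + r') :=
      mul_le_mul_of_nonneg_right b1 (by positivity)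
    have b3 : (r : ℝ) + r' ≤ τ * (r + r') := le_mul_of_one_le_left (by positivity) a3
    simp only [buildSpace]; push_cast; linarith
  · simp only [dsSpace]; push_cast; linarith
  · intro j hj ρ hD h0
    have hmem : ∀ a < dsSpace r r' q, ρ.toNatState.mem a = s'.mem a := fun a ha => by
      have haw : a < 2 ^ w := by omega
      rw [← e4.2 a haw, State.toNatState]
      simp only
      rw [hD _ (by rwa [BitVec.toNat_ofNat, Nat.mod_eq_of_lt haw])]
    have hj1 := suffixRank_lt hj
    have hj2 := suffixRank_le (S := S') (P := S.drop j)
    obtain ⟨ρ', t', n', u, f1, f2, f3, f4, f5, f6, f7⟩ := runs_query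
      -- The address bound of the query is the size of the data structure itself, so nothing outside
      -- it is accessed.
      (E := ⟨w, dsSpace r r' q, 2 ^ w⟩) (s₀ := ρ.toNatState) (p := j)
      (Q := fun u => u.mem = ρ.toNatState.mem ∧ u.reg 0 = suffixRank S' (S.drop j) ∧
        u.clk ≤ queryCost r r' τ q) hτ hS hS' hq
      (e5.congr (by rw [hrdef, hrdef']; exact hmem)) hj
      (by simp only [State.toNatState, h0]; exact toNat (by omega))
      (by rw [hrdef, hrdef']) (by simp only; omega)
      (fun u h1 h2 h3 => ⟨h1, h2, by
        rw [hrdef, hrdef'] at h3; simpa [State.toNatState] using h3⟩)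
      ⟨by simp only; omega, le_rfl, by simp only; omega⟩ ρ (rel_toNatState ρ)
    refine ⟨ρ', t', n', f1, ?_, f2, ?_, fun a ha => ?_⟩
    · have : t' ≤ queryCost r r' τ q := by
        simp only [State.toNatState] at f3; omega
      refine (Nat.cast_le.2 this).trans ?_
      exact_mod_cast queryCost_le hτ (log_succ_le_lg hU) (log_le_lg le_rfl) (log_le_lg le_rfl)
        (one_le_lg _) (one_le_lg _) (one_le_lg _)
    · rw [← BitVec.toNat_inj, f4.1, f6, toNat (by omega)]
    · rw [← hD a ha, ← BitVec.toNat_inj]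
      have := f4.2 a.toNat a.isLt
      rw [f5, BitVec.ofNat_toNat, BitVec.setWidth_eq] at this
      rw [this]
      simp [State.toNatState]
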